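/- Let $0<\sigma<2$, let $p(x)=(|x|^2+|x|^{2-\sigma})^{1/2}$ and $\langle x\rangle=(1+|x|^2)^{1/2}$ for $x\in\mathbb R^3$, and for $r,l\in\{1,2\}$ and $\lambda>0$ put $$\Phi_{r,l}(\xi,\eta)=p(\xi)+(-1)^r p(\xi-\eta)+(-1)^l p(\eta),\qquad \mathfrak M_{r,l}(\xi,\eta)=\frac{|\xi|^{\frac{2-\sigma}{2}}\,|\eta|^{\frac{2-\sigma}{2}}\,|\xi-\eta|^{\frac{2-\sigma}{2}}}{\langle \xi-\eta\rangle^{2\lambda}\,\langle\eta\rangle^{2\lambda}\,\Phi_{r,l}(\xi,\eta)},\qquad \xi,\eta\in\mathbb R^3 .$$ Fix a smooth radial function $\psi:\mathbb R^3\to[0,1]$ with $\operatorname{supp}\psi\subseteq\{|x|\le 2\}$ and $\psi(x)=1$ for $|x|\le 1$, and for $N\in 2^{\mathbb Z}$ let $P_N$ be the Littlewood--Paley operator on $L^2(\mathbb R^3)$, $\widehat{P_Nf}(x)=\big(\psi(x/N)-\psi(2x/N)\big)\hat f(x)$, where $\hat f(x)$ denotes the $L^2$ Fourier transform with kernel $e^{-ix\cdot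 y}$. Write $P_N^\eta$ (respectively $P_N^\xi$) for $P_N$ acting in the variable $\eta$ (respectively $\xi$), and for a kernel $\mathfrak M(\xi,\eta)$ set $$\|\mathfrak M\|_{M^{k,\infty}_{\xi,\eta}}=\sum_{N\in2^{\mathbb Z}}\operatorname*{ess\,sup}_{\xi\in\mathbb R^3}\big\|P_N^\eta\mathfrak M(\xi,\cdot)\big\|_{\dot H^k(\mathbb R^3)},\qquad \|\mathfrak M\|_{M^{k,\infty}_{\eta,\xi}}=\sum_{N\in2^{\mathbb Z}}\operatorname*{ess\,sup}_{\eta\in\mathbb R^3}\big\|P_N^\xi\mathfrak M(\cdot,\eta)\big\|_{\dot H^k(\mathbb R^3)},$$ where $\|f\|_{\dot H^k}=\||\nabla|^kf\|_{L^2}$ and the value $\infty$ is assigned to a slice that is not in $L^2$. Then for every $0\le k\le 3/2$ and every $\lambda>\frac74+\sigma k$ there is a finite constant $C$, depending only on $\sigma,k,\lambda$ and $\psi$, such that for all $r,l\in\{1,2\}$ $$\|\mathfrak M_{r,l}\|_{M^{k,\infty}_{\xi,\eta}}+\|\mathfrak M_{r,l}\|_{M^{k,\infty}_{\eta,\xi}}\le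 C .$$ -/

import Mathlib

open MeasureTheory
open scoped ENNReal NNReal FourierTransform ContDiff

noncomputable section

namespace EulerRiesz

/-- Three-dimensional Euclidean space. -/
abbrev R3 : Type := EuclideanSpace ℝ (Fin 3)

/-- The dispersion relation `p(x) = (|x|^2 + |x|^(2-σ))^(1/2)`. -/
def disp (σ : ℝ) (x : R3) : ℝ :=
  Real.sqrt (‖x‖ ^ 2 + ‖x‖ ^ (2 - σ))

/-- The Japanese bracket `⟨x⟩ = (1 + |x|^2)^(1/2)`. -/
def bracket (x : R3) : ℝ :=
  Real.sqrt (1 + ‖x‖ ^ 2)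

/-- The phase `Φ_{r,l}(ξ, η) = p(ξ) + (-1)^r p(ξ-η) + (-1)^l p(η)`. -/
def phase (σ : ℝ) (r l : ℕ) (ξ η : R3) : ℝ :=
  disp σ ξ + (-1) ^ r * disp σ (ξ - η) + (-1) ^ l * disp σ η

/-- The modified kernel `𝔐_{r,l}(ξ, η)`. -/
def kernel (σ lam : ℝ) (r l : ℕ) (ξ η : R3) : ℝ :=
  (‖ξ‖ ^ ((2 - σ) / 2) * ‖η‖ ^ ((2 - σ) / 2) * ‖ξ - η‖ ^ ((2 - σ) / 2)) /
    (bracket (ξ - η) ^ (2 * lam) * bracket η ^ (2 * lam) * phase σ r l ξ η)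

/-- A smooth radial cutoff `ψ : ℝ³ → [0,1]`, supported in `{|x| ≤ 2}` and equal to `1` on
`{|x| ≤ 1}`, from which the Littlewood–Paley decomposition is built. -/
structure Cutoff where
  toFun : R3 → ℝ
  contDiff : ContDiff ℝ ∞ toFun
  radial : ∀ x y : R3, ‖x‖ = ‖y‖ → toFun x = toFun y
  mem_Icc : ∀ x, toFun x ∈ Set.Icc (0 : ℝ) 1
  tsupport_subset : tsupport toFun ⊆ Metric.closedBall 0 2
  eq_one : ∀ x : R3, ‖x‖ ≤ 1 → toFun x = 1

/-- The Littlewood–Paley symbol `φ_N(x) = ψ(x/N) - ψ(2x/N)`. -/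
def Cutoff.symbol (ψ : Cutoff) (N : ℝ) (x : R3) : ℝ :=
  ψ.toFun (N⁻¹ • x) - ψ.toFun ((2 * N⁻¹) • x)

/-- The symbol at the angular frequency `2πζ`, where `ζ` is the frequency variable of
Mathlib's Fourier transform, whose kernel is `exp (-2πi ⟨x, ζ⟩)`. -/
def Cutoff.multiplier (ψ : Cutoff) (N : ℝ) (ζ : R3) : ℂ :=
  (ψ.symbol N ((2 * Real.pi) • ζ) : ℂ)

theorem Cutoff.memLp_mul (ψ : Cutoff) (N : ℝ) (f : Lp ℂ 2 (volume : Measure R3)) :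
    MemLp (fun ζ => ψ.multiplier N ζ * f ζ) 2 (volume : Measure R3) := by
  have hc : Continuous (ψ.multiplier N) := by
    have h := ψ.contDiff.continuous
    unfold Cutoff.multiplier Cutoff.symbol
    fun_prop
  refine (Lp.memLp f).of_le (hc.aestronglyMeasurable.mul (Lp.aestronglyMeasurable f)) ?_
  refine Filter.Eventually.of_forall fun ζ => ?_
  rw [norm_mul]
  refine mul_le_of_le_one_left (norm_nonneg _) ?_
  rw [Cutoff.multiplier, Complex.norm_real, Real.norm_eq_abs, Cutoff.symbol, abs_le]
  have h1 := ψ.mem_Icc (N⁻¹ • ((2 * Real.pi) • ζ))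
  have h2 := ψ.mem_Icc ((2 * N⁻¹) • ((2 * Real.pi) • ζ))
  constructor <;> linarith [h1.1, h1.2, h2.1, h2.2]

/-- The Littlewood–Paley operator `P_N` on `L²(ℝ³)`: the Fourier transform of `P_N f` is
`φ_N` times the Fourier transform of `f`. -/
def littlewoodPaley (ψ : Cutoff) (N : ℝ) (f : Lp ℂ 2 (volume : Measure R3)) :
    Lp ℂ 2 (volume : Measure R3) :=
  𝓕⁻ ((ψ.memLp_mul N (𝓕 f)).toLp _)

/-- The homogeneous Sobolev norm `‖f‖_{Ḣ^k} = ‖ |∇|^k f ‖_{L²}` (possibly infinite) of an `L²`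
function, computed on the Fourier side. -/
def homSobolevNorm (k : ℝ) (f : Lp ℂ 2 (volume : Measure R3)) : ℝ≥0∞ :=
  eLpNorm (fun ζ : R3 => (((2 * Real.pi * ‖ζ‖) ^ k : ℝ) : ℂ) * (𝓕 f) ζ) 2 volume

open Classical in
/-- `‖P_N f‖_{Ḣ^k}` for a function `f` on `ℝ³`; it is `∞` if `f` is not in `L²`. -/
def blockNorm (ψ : Cutoff) (k N : ℝ) (f : R3 → ℂ) : ℝ≥0∞ :=
  if h : MemLp f 2 (volume : Measure R3) then
    homSobolevNorm k (littlewoodPaley ψ N (h.toLp f))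
  else ⊤

/-- `∑_{N ∈ 2^ℤ} ‖P_N^y m(x, y)‖_{L^∞_x Ḣ^k_y}`, where `x` is the first and `y` is the second
variable of `m`, and `L^∞_x` is the essential supremum for Lebesgue measure. -/
def mixedNorm (ψ : Cutoff) (k : ℝ) (m : R3 → R3 → ℂ) : ℝ≥0∞ :=
  ∑' n : ℤ, essSup (fun x => blockNorm ψ k ((2 : ℝ) ^ n) (m x)) (volume : Measure R3)

/-- The norm `M^{k,∞}_{ξ,η}` of a kernel `m(ξ, η)`. -/
def normXiEta (ψ : Cutoff) (k : ℝ) (m : R3 → R3 → ℝ) : ℝ≥0∞ :=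
  mixedNorm ψ k (fun ξ η => (m ξ η : ℂ))

/-- The norm `M^{k,∞}_{η,ξ}` of a kernel `m(ξ, η)`: the roles of `ξ` and `η` are exchanged. -/
def normEtaXi (ψ : Cutoff) (k : ℝ) (m : R3 → R3 → ℝ) : ℝ≥0∞ :=
  mixedNorm ψ k (fun η ξ => (m ξ η : ℂ))

end EulerRiesz

end

open scoped ENNReal NNReal FourierTransform ContDiff

noncomputable section

namespace EulerRiesz

/-! Fix one frequency F (ξ or η, depending on the norm) and let the other one, x, move. The kernel
is then a function of |F|, |x| and |x - F| whose only singularities in x are at 0 and F. The Ḣ^k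
norm of a block costs N^k times the L² mass of the Fourier transform on an annulus of size N. For N
≥ 1 that mass is controlled by second differences of step 1/N; for N ≤ 1 by Cauchy-Schwarz on large
balls around 0 and F and by decay outside them. `exists_mixedNorm_le` therefore asks, uniformly in
F, for a square integrable majorant with some room at infinity, and for second differences of size
h^s W with s > k and W in L².

The regularity 3/2 is critical in dimension three. A bounded function that looks homogeneous of
degree 0 at the origin has second derivatives of size |x|^(-2), and interpolation yields h^(3/2)
|x|^(-3/2), which just misses L². A gain |x|^ε in the first two derivatives repairs this:
`abs_secondDiff_line_le` turns bounds |x|^(ε-1) and |x|^(ε-2) into h^(3/2+ε/2) |x|^(ε/2-3/2), whose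
weight is square integrable near 0, so that k = 3/2 is reached.

The derivative bounds rest on the phase. Since p(r)/r is decreasing, p is strictly subadditive, and
`phaseSize_le_abs` bounds |Φ| below by a multiple of z^(2-σ)/p(z), where z is the smallest of the
three lengths. The numerator contributes z^((2-σ)/2), which leaves only the factor sqrt(1+z^σ). When
F is the smallest frequency and the signs of the other two are opposite, the derivative of Φ is a
difference of two nearby gradients, so that a derivative of the kernel costs (1+|F|^σ)/|x| only. All
losses are powers of z for large z, and the brackets absorb them because λ > 7/4.

The delicate region is x near 0 with opposite signs at F and x - F: there |x|^((2-σ)/2)/Φ does not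
tend to 0. But Φ |x|^(-(2-σ)/2) is a constant up to O(|x|^ε + (|x|/|F|)^ε), and derivatives see only
the error (`isGainSymbol_normalizedPhase`). The neighbourhood of x = F follows by reflection. -/

/-! ### The L² Fourier transform: duality and translations. -/

open scoped SchwartzMap in
theorem integral_schwartz_mul_fourier (φ : 𝓢(R3, ℂ)) (f : Lp ℂ 2 (volume : Measure R3)) :
    ∫ ζ, φ ζ * (𝓕 f) ζ = ∫ x, (𝓕 φ) x * f x := by
  have h := congrArg (fun T => T φ) (Lp.fourier_toTemperedDistribution_eq f)
  simp only [TemperedDistribution.fourier_apply, Lp.toTemperedDistribution_apply] at h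
  simpa [smul_eq_mul] using h.symm

theorem locallyIntegrable_Lp_two (f : Lp ℂ 2 (volume : Measure R3)) :
    LocallyIntegrable f (volume : Measure R3) :=
  (Lp.memLp f).locallyIntegrable (by norm_num)

open scoped SchwartzMap in
/-- An `L²` Fourier transform is determined by duality against compactly supported smooth
functions. -/
theorem fourier_ae_eq_of_weak (f : Lp ℂ 2 (volume : Measure R3)) (g : R3 → ℂ)
    (hg : LocallyIntegrable g volume)
    (h : ∀ φ : 𝓢(R3, ℂ), HasCompactSupport φ → ∫ x, (𝓕 φ) x * f x = ∫ ζ, φ ζ * g ζ) :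
    (𝓕 f : Lp ℂ 2 (volume : Measure R3)) =ᵐ[volume] g := by
  refine ae_eq_of_integral_contDiff_smul_eq (locallyIntegrable_Lp_two _) hg fun u hu hc => ?_
  have hc' : HasCompactSupport (fun x => (u x : ℂ)) := hc.comp_left Complex.ofReal_zero
  have hu' : ContDiff ℝ ∞ (fun x => (u x : ℂ)) := Complex.ofRealCLM.contDiff.comp hu
  have h1 := h (hc'.toSchwartzMap hu') hc'
  rw [← integral_schwartz_mul_fourier] at h1
  simpa [Complex.real_smul] using h1

open scoped SchwartzMap in
/-- On `L¹ ∩ L²` the `L²` Fourier transform is the Fourier integral. -/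
theorem fourier_toLp_ae_eq {f : R3 → ℂ} (hf : MemLp f 2 volume) (hf1 : Integrable f volume) :
    (𝓕 (hf.toLp f) : Lp ℂ 2 (volume : Measure R3)) =ᵐ[volume] 𝓕 f := by
  have hcont : Continuous (𝓕 f) :=
    VectorFourier.fourierIntegral_continuous Real.continuous_fourierChar
      (by exact continuous_inner) hf1
  refine fourier_ae_eq_of_weak _ _ hcont.locallyIntegrable fun φ _ => ?_
  have h1 := VectorFourier.integral_fourierIntegral_smul_eq_flip (L := innerₗ R3)
    Real.continuous_fourierChar continuous_inner (SchwartzMap.integrable (μ := volume) φ) hf1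
  have h2 : ∫ x, (𝓕 φ) x * (hf.toLp f) x = ∫ x, (𝓕 φ) x * f x :=
    integral_congr_ae (hf.coeFn_toLp.mono fun x hx => by simp only [hx])
  rw [h2]
  simp only [smul_eq_mul, flip_innerₗ] at h1
  rw [SchwartzMap.fourier_coe]
  exact h1

-- Tested against φ, a translation of f becomes a translation of the transform of φ, which is the
-- transform of φ times a character. The compact support of φ makes this product a Schwartz function
-- at once.
open scoped SchwartzMap in
theorem fourier_translate_ae_eq {f : R3 → ℂ} (v : R3) (hf : MemLp f 2 volume)
    (hfv : MemLp (fun x => f (x + v)) 2 volume) :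
    (𝓕 (hfv.toLp _) : Lp ℂ 2 (volume : Measure R3)) =ᵐ[volume]
      fun ζ => (Real.fourierChar (inner ℝ v ζ) : ℂ) * (𝓕 (hf.toLp f)) ζ := by
  have he : ContDiff ℝ ∞ (fun ζ : R3 => (Real.fourierChar (inner ℝ v ζ) : ℂ)) := by
    simp only [Real.fourierChar_apply]
    have : ContDiff ℝ ∞ (fun ζ : R3 => ((2 * Real.pi * inner ℝ v ζ : ℝ) : ℂ)) :=
      Complex.ofRealCLM.contDiff.comp (contDiff_const.mul (contDiff_const.inner ℝ contDiff_id))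
    exact (this.mul contDiff_const).cexp
  refine fourier_ae_eq_of_weak _ _ ?_ fun φ hφ => ?_
  · refine MemLp.locallyIntegrable (p := 2) ?_ (by norm_num)
    refine (Lp.memLp (𝓕 (hf.toLp f))).of_le
      (he.continuous.aestronglyMeasurable.mul (Lp.aestronglyMeasurable _))
      (Filter.Eventually.of_forall fun ζ => ?_)
    rw [norm_mul, Circle.norm_coe, one_mul]
  have hc : HasCompactSupport
      (fun ζ : R3 => (Real.fourierChar (inner ℝ v ζ) : ℂ) * φ ζ) := hφ.mul_left
  set φ' : 𝓢(R3, ℂ) := hc.toSchwartzMap (he.mul φ.smooth') with hφ'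
  have hshift : ∀ x, (𝓕 φ) (x - v) = (𝓕 φ') x := fun x => by
    simp only [SchwartzMap.fourier_coe, Real.fourier_eq, Circle.smul_def, smul_eq_mul]
    refine integral_congr_ae (Filter.Eventually.of_forall fun w => ?_)
    simp only [hφ', HasCompactSupport.toSchwartzMap_toFun, ← mul_assoc, inner_sub_right, neg_sub]
    rw [← Circle.coe_mul, ← AddChar.map_add_eq_mul, real_inner_comm v w]
    congr 3
    ring
  calc ∫ x, (𝓕 φ) x * (hfv.toLp _) x = ∫ x, (𝓕 φ) x * f (x + v) :=
        integral_congr_ae (hfv.coeFn_toLp.mono fun x hx => by simp only [hx])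
    _ = ∫ x, (𝓕 φ) (x - v) * f x := by
        have := integral_add_right_eq_self (μ := volume)
          (fun x : R3 => (𝓕 φ : 𝓢(R3, ℂ)) (x - v) * f x) v
        simpa only [add_sub_cancel_right] using this
    _ = ∫ x, (𝓕 φ') x * (hf.toLp f) x :=
        integral_congr_ae (hf.coeFn_toLp.mono fun x hx => by simp only [hx, hshift])
    _ = ∫ ζ, φ' ζ * (𝓕 (hf.toLp f)) ζ := (integral_schwartz_mul_fourier _ _).symm
    _ = _ := by
        refine integral_congr_ae (Filter.Eventually.of_forall fun w => ?_)
        simp only [hφ', HasCompactSupport.toSchwartzMap_toFun]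
        ring

/-! ### Littlewood–Paley blocks and frequency annuli. -/

/-- A representative of the `L²` Fourier transform. -/
abbrev fourierL2 {f : R3 → ℂ} (hf : MemLp f 2 (volume : Measure R3)) : R3 → ℂ :=
  ((𝓕 (hf.toLp f) : Lp ℂ 2 (volume : Measure R3)) : R3 → ℂ)

/-- The frequency annulus on which the symbol of `P_N` lives. -/
def annulus (N : ℝ) : Set R3 := {ζ | N / 2 ≤ 2 * Real.pi * ‖ζ‖ ∧ 2 * Real.pi * ‖ζ‖ ≤ 2 * N}

theorem measurableSet_annulus (N : ℝ) : MeasurableSet (annulus N) :=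
  have h : Measurable fun ζ : R3 => 2 * Real.pi * ‖ζ‖ := by fun_prop
  (measurableSet_le measurable_const h).inter (measurableSet_le h measurable_const)

theorem Cutoff.norm_multiplier_le (ψ : Cutoff) (N : ℝ) (ζ : R3) : ‖ψ.multiplier N ζ‖ ≤ 1 := by
  rw [Cutoff.multiplier, Complex.norm_real, Real.norm_eq_abs, Cutoff.symbol, abs_le]
  have h1 := ψ.mem_Icc (N⁻¹ • ((2 * Real.pi) • ζ))
  have h2 := ψ.mem_Icc ((2 * N⁻¹) • ((2 * Real.pi) • ζ))
  constructor <;> linarith [h1.1, h1.2, h2.1, h2.2]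

/-- Below the annulus both cutoffs are 1 and cancel; above it both vanish. -/
theorem Cutoff.multiplier_eq_zero (ψ : Cutoff) {N : ℝ} (hN : 0 < N) {ζ : R3}
    (hζ : ζ ∉ annulus N) : ψ.multiplier N ζ = 0 := by
  have hpi : 0 < 2 * Real.pi := by positivity
  have e1 : ‖N⁻¹ • ((2 * Real.pi) • ζ)‖ = 2 * Real.pi * ‖ζ‖ / N := by
    rw [norm_smul, norm_smul, Real.norm_of_nonneg hpi.le, Real.norm_of_nonneg (by positivity)]
    field_simp
  have e2 : ‖(2 * N⁻¹) • ((2 * Real.pi) • ζ)‖ = 2 * (2 * Real.pi * ‖ζ‖) / N := by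
    rw [norm_smul, norm_smul, Real.norm_of_nonneg hpi.le, Real.norm_of_nonneg (by positivity)]
    field_simp
  have key : ψ.symbol N ((2 * Real.pi) • ζ) = 0 := by
    rw [Cutoff.symbol]
    by_cases h : 2 * Real.pi * ‖ζ‖ < N / 2
    · rw [ψ.eq_one _ (by rw [e1, div_le_one hN]; linarith),
        ψ.eq_one _ (by rw [e2, div_le_one hN]; linarith), sub_self]
    · have h' : 2 * N < 2 * Real.pi * ‖ζ‖ := by
        by_contra h2
        exact hζ ⟨not_lt.1 h, not_lt.1 h2⟩
      have hz : ∀ x : R3, 2 < ‖x‖ → ψ.toFun x = 0 := fun x hx =>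
        image_eq_zero_of_notMem_tsupport fun hm => by
          have := ψ.tsupport_subset hm
          rw [mem_closedBall_zero_iff] at this
          linarith
      rw [hz _ (by rw [e1, lt_div_iff₀ hN]; linarith),
        hz _ (by rw [e2, lt_div_iff₀ hN]; linarith), sub_self]
  rw [Cutoff.multiplier, key, Complex.ofReal_zero]

/-- The order k enters only here, through |2πζ|^k ≤ (2N)^k on the annulus; what remains is to
estimate the L² mass of the transform there. -/
theorem blockNorm_le (ψ : Cutoff) {k N : ℝ} (hk : 0 ≤ k) (hN : 0 < N) {f : R3 → ℂ}
    (hf : MemLp f 2 volume) :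
    blockNorm ψ k N f ≤ ENNReal.ofReal ((2 * N) ^ k) *
      eLpNorm ((annulus N).indicator (fourierL2 hf)) 2 volume := by
  rw [blockNorm, dif_pos hf, homSobolevNorm, littlewoodPaley, FourierTransform.fourier_fourierInv_eq]
  have h1 : ENNReal.ofReal ((2 * N) ^ k) = ‖(2 * N) ^ k‖ₑ := by
    rw [Real.enorm_of_nonneg (by positivity)]
  rw [h1, ← eLpNorm_const_smul]
  refine eLpNorm_mono_ae ?_
  filter_upwards [(ψ.memLp_mul N (𝓕 (hf.toLp f))).coeFn_toLp] with ζ hζ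
  rw [hζ, Pi.smul_apply]
  by_cases hA : ζ ∈ annulus N
  · rw [Set.indicator_of_mem hA, norm_mul, norm_mul, norm_smul, Complex.norm_real]
    have h2 : ‖(2 * Real.pi * ‖ζ‖) ^ k‖ ≤ ‖(2 * N) ^ k‖ := by
      rw [Real.norm_of_nonneg (by positivity), Real.norm_of_nonneg (by positivity)]
      exact Real.rpow_le_rpow (by positivity) hA.2 hk
    refine mul_le_mul h2 ?_ (by positivity) (by positivity)
    exact mul_le_of_le_one_left (norm_nonneg _) (ψ.norm_multiplier_le N ζ)
  · rw [ψ.multiplier_eq_zero hN hA, zero_mul, mul_zero, norm_zero]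
    positivity

/-! ### High frequencies: second differences. -/

theorem eLpNorm_fourier (f : Lp ℂ 2 (volume : Measure R3)) :
    eLpNorm (𝓕 f : Lp ℂ 2 (volume : Measure R3)) 2 volume = eLpNorm f 2 volume := by
  have h := Lp.norm_fourier_eq f
  rw [Lp.norm_def, Lp.norm_def] at h
  exact (ENNReal.toReal_eq_toReal_iff' (Lp.eLpNorm_ne_top _) (Lp.eLpNorm_ne_top _)).1 h

/-- The second difference `f(x + 2v) - 2 f(x + v) + f(x)`. -/
def secondDiff {E : Type*} [AddCommGroup E] (f : R3 → E) (v : R3) (x : R3) : E :=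
  f (x + (v + v)) - (f (x + v) + f (x + v)) + f x

theorem memLp_translate {f : R3 → ℂ} (hf : MemLp f 2 volume) (v : R3) :
    MemLp (fun x => f (x + v)) 2 volume :=
  hf.comp_measurePreserving (measurePreserving_add_right volume v)

theorem memLp_secondDiff {f : R3 → ℂ} (hf : MemLp f 2 volume) (v : R3) :
    MemLp (secondDiff f v) 2 volume :=
  ((memLp_translate hf (v + v)).sub ((memLp_translate hf v).add (memLp_translate hf v))).add hf

/-- Differences of second order are needed because k may exceed 1: one difference of step 1/N gains
at most one power of N, even for smooth functions. -/
theorem fourier_secondDiff_ae_eq {f : R3 → ℂ} (hf : MemLp f 2 volume) (v : R3) :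
    (𝓕 ((memLp_secondDiff hf v).toLp _) : Lp ℂ 2 (volume : Measure R3)) =ᵐ[volume]
      fun ζ => ((Real.fourierChar (inner ℝ v ζ) : ℂ) - 1) ^ 2 * (𝓕 (hf.toLp f)) ζ := by
  have h1 := memLp_translate hf v
  have h2 := memLp_translate hf (v + v)
  have e : (memLp_secondDiff hf v).toLp _ =
      h2.toLp _ - (h1.toLp _ + h1.toLp _) + hf.toLp f := rfl
  have hsub : ∀ u w : Lp ℂ 2 (volume : Measure R3), 𝓕 (u - w) = 𝓕 u - 𝓕 w :=
    fun u w => (Lp.fourierTransformₗᵢ R3 ℂ).map_sub u w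
  rw [e, FourierTransform.fourier_add, hsub, FourierTransform.fourier_add]
  filter_upwards [Lp.coeFn_add (𝓕 (h2.toLp _) - (𝓕 (h1.toLp _) + 𝓕 (h1.toLp _))) (𝓕 (hf.toLp f)),
    Lp.coeFn_sub (𝓕 (h2.toLp _)) (𝓕 (h1.toLp _) + 𝓕 (h1.toLp _)),
    Lp.coeFn_add (𝓕 (h1.toLp _)) (𝓕 (h1.toLp _)),
    fourier_translate_ae_eq v hf h1, fourier_translate_ae_eq (v + v) hf h2] with ζ a1 a2 a3 a4 a5
  rw [a1, Pi.add_apply, a2, Pi.sub_apply, a3, Pi.add_apply, a4, a5, inner_add_left,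
    AddChar.map_add_eq_mul, Circle.coe_mul]
  ring

/-- The chord has length 2|sin(θ/2)|, and Jordan's inequality together with π < 4 bounds it below
linearly. -/
theorem abs_le_norm_fourierChar_sub_one {t : ℝ} (ht : |2 * Real.pi * t| ≤ 2) :
    |2 * Real.pi * t| / 2 ≤ ‖(Real.fourierChar t : ℂ) - 1‖ := by
  rw [Real.fourierChar_apply, mul_comm _ Complex.I, Complex.norm_exp_I_mul_ofReal_sub_one, norm_mul,
    Real.norm_eq_abs, Real.norm_eq_abs, abs_two]
  set θ := 2 * Real.pi * t
  have h3 := Real.pi_gt_three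
  have h4 := Real.pi_lt_four
  have h := Real.mul_abs_le_abs_sin (x := θ / 2) (by rw [abs_div, abs_two]; linarith)
  rw [abs_div, abs_two] at h
  have : |θ| / 4 ≤ 2 / Real.pi * (|θ| / 2) := by
    rw [div_mul_div_comm, div_le_div_iff₀ (by norm_num) (by positivity)]
    nlinarith [abs_nonneg θ]
  linarith

/-- With step 1/N the three phases θ_i are at most 2 in absolute value, so no character returns to 1
by periodicity, and their squares add up to at least 1/4. The constant 64 is not sharp. -/
theorem one_le_sum_norm_sq {N : ℝ} (hN : 0 < N) {ζ : R3} (hζ : ζ ∈ annulus N) :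
    1 ≤ 64 * ∑ i : Fin 3,
      ‖(Real.fourierChar (inner ℝ (EuclideanSpace.single i N⁻¹ : R3) ζ) : ℂ) - 1‖ ^ 2 := by
  obtain ⟨h1, h2⟩ := hζ
  have hpi := Real.pi_pos
  have hin : ∀ i, inner ℝ (EuclideanSpace.single i N⁻¹ : R3) ζ = N⁻¹ * ζ i := fun i => by
    rw [EuclideanSpace.inner_single_left]; simp
  have hle : ∀ i, |2 * Real.pi * (N⁻¹ * ζ i)| ≤ 2 := fun i => by
    have : |ζ i| ≤ ‖ζ‖ := by simpa using PiLp.norm_apply_le ζ i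
    rw [abs_mul, abs_of_pos (by positivity : 0 < 2 * Real.pi), abs_mul, abs_of_pos (inv_pos.2 hN)]
    calc 2 * Real.pi * (N⁻¹ * |ζ i|) = (2 * Real.pi * |ζ i|) / N := by field_simp
      _ ≤ (2 * Real.pi * ‖ζ‖) / N := by gcongr
      _ ≤ 2 := by rw [div_le_iff₀ hN]; linarith
  have hsum : ∑ i, (2 * Real.pi * (N⁻¹ * ζ i)) ^ 2 = (2 * Real.pi * ‖ζ‖ / N) ^ 2 := by
    have : ‖ζ‖ ^ 2 = ∑ i, ζ i ^ 2 := by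
      rw [EuclideanSpace.norm_sq_eq]; simp
    rw [div_pow, mul_pow _ ‖ζ‖, this, Finset.mul_sum, Finset.sum_div]
    exact Finset.sum_congr rfl fun i _ => by field_simp
  have hge : (1 : ℝ) / 4 ≤ (2 * Real.pi * ‖ζ‖ / N) ^ 2 := by
    have : 1 / 2 ≤ 2 * Real.pi * ‖ζ‖ / N := by rw [le_div_iff₀ hN]; linarith
    nlinarith
  have hterm : ∀ i, (2 * Real.pi * (N⁻¹ * ζ i)) ^ 2 ≤
      4 * ‖(Real.fourierChar (inner ℝ (EuclideanSpace.single i N⁻¹ : R3) ζ) : ℂ) - 1‖ ^ 2 :=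
    fun i => by
      rw [hin]
      have := abs_le_norm_fourierChar_sub_one (hle i)
      rw [← sq_abs]
      nlinarith [abs_nonneg (2 * Real.pi * (N⁻¹ * ζ i))]
  have := Finset.sum_le_sum fun i (_ : i ∈ Finset.univ) => hterm i
  rw [hsum, ← Finset.mul_sum] at this
  linarith

/-- High-frequency estimate: on the annulus of size `N` the Fourier transform is controlled by
second differences with step `1/N`. -/
theorem eLpNorm_annulus_le_secondDiff {N : ℝ} (hN : 0 < N) {f : R3 → ℂ} (hf : MemLp f 2 volume) :
    eLpNorm ((annulus N).indicator (fourierL2 hf)) 2 volume ≤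
      64 * ∑ i : Fin 3, eLpNorm (secondDiff f (EuclideanSpace.single i N⁻¹)) 2 volume := by
  set v : Fin 3 → R3 := fun i => EuclideanSpace.single i N⁻¹
  have h1 : ∀ i, eLpNorm (secondDiff f (v i)) 2 volume =
      eLpNorm (fun ζ => ((Real.fourierChar (inner ℝ (v i) ζ) : ℂ) - 1) ^ 2 *
        (𝓕 (hf.toLp f)) ζ) 2 volume := fun i => by
    rw [← eLpNorm_congr_ae (memLp_secondDiff hf (v i)).coeFn_toLp, ← eLpNorm_fourier]
    exact eLpNorm_congr_ae (fourier_secondDiff_ae_eq hf (v i))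
  have hae : ∀ i, AEStronglyMeasurable (fun ζ => ‖((Real.fourierChar (inner ℝ (v i) ζ) : ℂ) - 1) ^ 2
      * (𝓕 (hf.toLp f)) ζ‖) volume := fun i =>
    ((Lp.aestronglyMeasurable (𝓕 ((memLp_secondDiff hf (v i)).toLp _))).congr
      (fourier_secondDiff_ae_eq hf (v i))).norm
  have h64 : (64 : ℝ≥0∞) = ‖(64 : ℝ)‖ₑ := by
    rw [Real.enorm_of_nonneg (by norm_num)]; norm_num
  calc _ ≤ eLpNorm ((64 : ℝ) • ∑ i : Fin 3,
        (fun ζ => ‖((Real.fourierChar (inner ℝ (v i) ζ) : ℂ) - 1) ^ 2 * (𝓕 (hf.toLp f)) ζ‖))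
        2 volume := by
        refine eLpNorm_mono fun ζ => ?_
        simp only [Pi.smul_apply, Finset.sum_apply, norm_mul, norm_pow, smul_eq_mul]
        rw [← Finset.sum_mul, norm_mul, norm_norm, ← mul_assoc, ← norm_mul]
        by_cases hA : ζ ∈ annulus N
        · rw [Set.indicator_of_mem hA]
          have := one_le_sum_norm_sq hN hA
          rw [Real.norm_of_nonneg (by positivity)]
          exact le_mul_of_one_le_left (norm_nonneg _) this
        · rw [Set.indicator_of_notMem hA, norm_zero]
          positivity
    _ ≤ 64 * ∑ i : Fin 3, eLpNorm (secondDiff f (v i)) 2 volume := by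
        rw [eLpNorm_const_smul, h64]
        gcongr
        refine (eLpNorm_sum_le (fun i _ => hae i) (by norm_num)).trans (le_of_eq ?_)
        exact Finset.sum_congr rfl fun i _ => by rw [eLpNorm_norm, h1]

/-! ### Low frequencies: splitting between L¹ and L². -/

/-- For the second summand the annulus is discarded and Plancherel is used; it will be the tail of
the function, already small in L². -/
theorem eLpNorm_annulus_add_le (N : ℝ) {f g : R3 → ℂ} (hf : MemLp f 2 volume)
    (hg : MemLp g 2 volume) :
    eLpNorm ((annulus N).indicator (fourierL2 (hf.add hg))) 2 volume ≤
      eLpNorm ((annulus N).indicator (fourierL2 hf)) 2 volume + eLpNorm g 2 volume := by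
  rw [fourierL2, MemLp.toLp_add, FourierTransform.fourier_add]
  have hm := measurableSet_annulus N
  calc _ = eLpNorm ((annulus N).indicator (fourierL2 hf) +
        (annulus N).indicator (fourierL2 hg)) 2 volume := by
        refine eLpNorm_congr_ae ?_
        rw [← Set.indicator_add']
        exact (Lp.coeFn_add _ _).indicator
    _ ≤ _ := by
        refine (eLpNorm_add_le ((Lp.aestronglyMeasurable _).indicator hm)
          ((Lp.aestronglyMeasurable _).indicator hm) (by norm_num)).trans ?_
        gcongr
        refine (eLpNorm_indicator_le _).trans (le_of_eq ?_)
        rw [eLpNorm_fourier, eLpNorm_congr_ae hg.coeFn_toLp]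

/-- The transform is bounded by the L¹ norm, so the smallness comes from the volume of the annulus.
-/
theorem eLpNorm_annulus_le_integral {N : ℝ} {f : R3 → ℂ} (hf : MemLp f 2 volume)
    (hf1 : Integrable f volume) :
    eLpNorm ((annulus N).indicator (fourierL2 hf)) 2 volume ≤
      eLpNorm f 1 volume * volume (annulus N) ^ (1 / 2 : ℝ) := by
  rw [eLpNorm_congr_ae (fourier_toLp_ae_eq hf hf1).indicator,
    eLpNorm_indicator_eq_eLpNorm_restrict (measurableSet_annulus N)]
  have hb : ∀ ζ, ‖𝓕 f ζ‖ ≤ (eLpNorm f 1 volume).toReal := fun ζ => by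
    refine (VectorFourier.norm_fourierIntegral_le_integral_norm _ _ _ _ _).trans (le_of_eq ?_)
    rw [eLpNorm_one_eq_lintegral_enorm, integral_norm_eq_lintegral_enorm hf1.1]
  refine (eLpNorm_le_of_ae_bound (Filter.Eventually.of_forall hb)).trans (le_of_eq ?_)
  rw [ENNReal.ofReal_toReal (memLp_one_iff_integrable.2 hf1).eLpNorm_ne_top,
    Measure.restrict_apply_univ, mul_comm]
  norm_num

/-- Low-frequency estimate: the mass of `f` on a set `S` of finite measure contributes through its
`L¹` norm, the rest through its `L²` norm. -/
theorem eLpNorm_annulus_le_split {N : ℝ} {f : R3 → ℂ} (hf : MemLp f 2 volume) {S : Set R3}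
    (hS : MeasurableSet S) (hfin : volume S ≠ ⊤) :
    eLpNorm ((annulus N).indicator (fourierL2 hf)) 2 volume ≤
      eLpNorm f 2 volume * volume S ^ (1 / 2 : ℝ) * volume (annulus N) ^ (1 / 2 : ℝ) +
        eLpNorm (Sᶜ.indicator f) 2 volume := by
  have h1 := hf.indicator hS
  have h2 := hf.indicator hS.compl
  have hle : eLpNorm (S.indicator f) 1 volume ≤ eLpNorm f 2 volume * volume S ^ (1 / 2 : ℝ) := by
    rw [eLpNorm_indicator_eq_eLpNorm_restrict hS]
    refine (eLpNorm_le_eLpNorm_mul_rpow_measure_univ (p := 1) (q := 2) (by norm_num)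
      hf.1.restrict).trans ?_
    rw [Measure.restrict_apply_univ]
    norm_num
    gcongr
    exact Measure.restrict_le_self
  have hint : Integrable (S.indicator f) volume :=
    memLp_one_iff_integrable.1 ⟨h1.1, hle.trans_lt (ENNReal.mul_lt_top hf.2
      (ENNReal.rpow_lt_top_of_nonneg (by norm_num) hfin))⟩
  have e : hf.toLp f = (h1.add h2).toLp (S.indicator f + Sᶜ.indicator f) :=
    (MemLp.toLp_eq_toLp_iff _ _).2 (by rw [Set.indicator_self_add_compl])
  rw [fourierL2, e]
  refine (eLpNorm_annulus_add_le N h1 h2).trans ?_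
  gcongr
  exact (eLpNorm_annulus_le_integral h1 hint).trans (by gcongr)

/-! ### Block estimates from majorants centred at 0 and F, and dyadic summation. -/

/-- Two copies of a profile, centred at `0` and at `F`. -/
def twoCentre (w : R3 → ℝ) (F x : R3) : ℝ := w x + w (x - F)

theorem eLpNorm_twoCentre_le {w : R3 → ℝ} (hw : AEStronglyMeasurable w volume) (F : R3) :
    eLpNorm (twoCentre w F) 2 volume ≤ 2 * eLpNorm w 2 volume := by
  have hp := measurePreserving_sub_right (volume : Measure R3) F
  have h1 : AEStronglyMeasurable (fun x => w (x - F)) volume := hw.comp_measurePreserving hp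
  refine (eLpNorm_add_le hw h1 (by norm_num)).trans (le_of_eq ?_)
  have : eLpNorm (fun x => w (x - F)) 2 volume = eLpNorm w 2 volume :=
    eLpNorm_comp_measurePreserving hw hp
  rw [this, two_mul]

theorem eLpNorm_le_twoCentre {f : R3 → ℂ} {w : R3 → ℝ} (hw : AEStronglyMeasurable w volume)
    {F : R3} {c : ℝ} (hc : 0 ≤ c) (h : ∀ᵐ x, ‖f x‖ ≤ c * twoCentre w F x) :
    eLpNorm f 2 volume ≤ ENNReal.ofReal c * (2 * eLpNorm w 2 volume) := by
  calc eLpNorm f 2 volume ≤ eLpNorm (c • twoCentre w F) 2 volume := by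
        refine eLpNorm_mono_ae (h.mono fun x hx => hx.trans ?_)
        exact Real.le_norm_self _
    _ ≤ _ := by
        rw [eLpNorm_const_smul, Real.enorm_of_nonneg hc]
        gcongr
        exact eLpNorm_twoCentre_le hw F

theorem volume_annulus_le {N : ℝ} (hN : 0 ≤ N) :
    volume (annulus N) ≤ ENNReal.ofReal (N ^ 3) * volume (Metric.ball (0 : R3) 1) := by
  have h : annulus N ⊆ Metric.closedBall 0 N := fun ζ hζ => by
    rw [mem_closedBall_zero_iff]
    have := hζ.2
    nlinarith [Real.pi_gt_three, norm_nonneg ζ]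
  refine (measure_mono h).trans (le_of_eq ?_)
  rw [Measure.addHaar_closedBall _ _ hN]
  simp

/-- The differences gain N^(-s) and the Sobolev weight costs N^k. The constant is 384 = 64 · 3 · 2:
the annulus estimate, three axes, two centres. -/
theorem blockNorm_le_high (ψ : Cutoff) {k N s C : ℝ} (hk : 0 ≤ k) (hN : 0 < N) (hC : 0 ≤ C)
    {f : R3 → ℂ} (hf : MemLp f 2 volume) {w : R3 → ℝ} (hw : AEStronglyMeasurable w volume)
    {F : R3} (hd : ∀ i : Fin 3, ∀ᵐ x, ‖secondDiff f (EuclideanSpace.single i N⁻¹) x‖ ≤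
      C * N ^ (-s) * twoCentre w F x) :
    blockNorm ψ k N f ≤
      ENNReal.ofReal (2 ^ k * (384 * C)) * eLpNorm w 2 volume * ENNReal.ofReal (N ^ (k - s)) := by
  refine (blockNorm_le ψ hk hN hf).trans ?_
  have h0 := Real.rpow_nonneg hN.le (-s)
  calc _ ≤ ENNReal.ofReal ((2 * N) ^ k) * (64 * ∑ i : Fin 3,
        ENNReal.ofReal (C * N ^ (-s)) * (2 * eLpNorm w 2 volume)) := by
        gcongr
        refine (eLpNorm_annulus_le_secondDiff hN hf).trans ?_
        gcongr with i
        exact eLpNorm_le_twoCentre hw (mul_nonneg hC h0) (hd i)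
    _ = _ := by
        have e : 2 ^ k * (384 * C) * N ^ (k - s) = (2 * N) ^ k * (384 * (C * N ^ (-s))) := by
          rw [Real.mul_rpow (by norm_num) hN.le, sub_eq_add_neg, Real.rpow_add hN]
          ring
        rw [mul_right_comm, ← ENNReal.ofReal_mul (by positivity), e,
          ENNReal.ofReal_mul (p := (2 * N) ^ k) (by positivity),
          ENNReal.ofReal_mul (p := 384) (by norm_num)]
        simp only [Finset.sum_const, Finset.card_univ, Fintype.card_fin, nsmul_eq_mul]
        norm_num
        ring

/-- Cut at distance L = N^(-1/2) from both centres. Inside, Cauchy-Schwarz and the volume of the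
annulus give (L N)^(3/2) = N^(3/4); outside, the spare weight |x|^δ gives L^(-δ) = N^(δ/2). The
worse of the two exponents is kept. -/
theorem blockNorm_le_low (ψ : Cutoff) {k N δ C : ℝ} (hk : 0 ≤ k) (hN : 0 < N) (hN1 : N ≤ 1)
    (hC : 0 ≤ C) (hδ : 0 < δ)
    {f : R3 → ℂ} (hf : MemLp f 2 volume) {w : R3 → ℝ} (hw0 : ∀ x, 0 ≤ w x)
    (hw : AEStronglyMeasurable w volume)
    {F : R3} (hb : ∀ᵐ x, ‖f x‖ ≤ C * twoCentre w F x) :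
    blockNorm ψ k N f ≤
      ENNReal.ofReal (2 ^ k * (4 * C)) *
        (eLpNorm w 2 volume * volume (Metric.ball (0 : R3) 1) +
          eLpNorm (fun x => ‖x‖ ^ δ * w x) 2 volume) *
        ENNReal.ofReal (N ^ (min (3 / 4) (δ / 2))) := by
  refine (blockNorm_le ψ hk hN hf).trans ?_
  set B := volume (Metric.ball (0 : R3) 1)
  set γ := min (3 / 4) (δ / 2)
  set L := N ^ (-(1 / 2) : ℝ) with hL
  have hLpos : 0 < L := Real.rpow_pos_of_pos hN _
  set S : Set R3 := Metric.closedBall 0 L ∪ Metric.closedBall F L with hS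
  have hSm : MeasurableSet S := measurableSet_closedBall.union measurableSet_closedBall
  have hvS : volume S ≤ 2 * (ENNReal.ofReal (L ^ 3) * B) := by
    refine (measure_union_le _ _).trans (le_of_eq ?_)
    rw [Measure.addHaar_closedBall _ _ hLpos.le, Measure.addHaar_closedBall _ _ hLpos.le, two_mul]
    simp [B]
  have hBfin : B ≠ ⊤ := measure_ball_lt_top.ne
  have hSfin : volume S ≠ ⊤ := (hvS.trans_lt (by finiteness)).ne
  have hwδ : AEStronglyMeasurable (fun x : R3 => ‖x‖ ^ δ * w x) volume :=
    ((measurable_norm.pow_const δ).aestronglyMeasurable).mul hw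
  have hvol : volume S ^ (1 / 2 : ℝ) * volume (annulus N) ^ (1 / 2 : ℝ) ≤
      2 * B * ENNReal.ofReal (N ^ γ) := by
    rw [← ENNReal.mul_rpow_of_nonneg _ _ (by norm_num)]
    have e1 : L ^ 3 * N ^ 3 = (N ^ (3 / 4 : ℝ)) ^ 2 := by
      rw [hL, ← Real.rpow_natCast, ← Real.rpow_natCast, ← Real.rpow_natCast, ← Real.rpow_mul hN.le,
        ← Real.rpow_mul hN.le, ← Real.rpow_add hN]
      norm_num
    have h1 : volume S * volume (annulus N) ≤ (2 * B * ENNReal.ofReal (N ^ (3 / 4 : ℝ))) ^ 2 := by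
      calc _ ≤ 2 * (ENNReal.ofReal (L ^ 3) * B) * (ENNReal.ofReal (N ^ 3) * B) :=
            mul_le_mul' hvS (volume_annulus_le hN.le)
        _ = 2 * B ^ 2 * ENNReal.ofReal ((N ^ (3 / 4 : ℝ)) ^ 2) := by
            rw [← e1, ENNReal.ofReal_mul (by positivity)]; ring
        _ ≤ 4 * B ^ 2 * ENNReal.ofReal ((N ^ (3 / 4 : ℝ)) ^ 2) := by
            gcongr
            norm_num
        _ = _ := by
            rw [ENNReal.ofReal_pow (by positivity)]; ring
    calc _ ≤ ((2 * B * ENNReal.ofReal (N ^ (3 / 4 : ℝ))) ^ 2) ^ (1 / 2 : ℝ) := by gcongr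
      _ = 2 * B * ENNReal.ofReal (N ^ (3 / 4 : ℝ)) := by
          rw [← ENNReal.rpow_natCast, ← ENNReal.rpow_mul]
          norm_num
      _ ≤ _ := by
          gcongr 2 * B * ENNReal.ofReal ?_
          exact Real.rpow_le_rpow_of_exponent_ge hN hN1 (min_le_left _ _)
  have htail : eLpNorm (Sᶜ.indicator f) 2 volume ≤ ENNReal.ofReal (C * N ^ γ) *
      (2 * eLpNorm (fun x => ‖x‖ ^ δ * w x) 2 volume) := by
    refine eLpNorm_le_twoCentre (F := F) hwδ (by positivity) ?_
    filter_upwards [hb] with x hx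
    by_cases hxS : x ∈ S
    · rw [Set.indicator_of_notMem (by simpa using hxS), norm_zero, twoCentre]
      have := hw0 x
      have := hw0 (x - F)
      positivity
    · rw [Set.indicator_of_mem (by simpa using hxS)]
      rw [hS, Set.mem_union, not_or, mem_closedBall_zero_iff, mem_closedBall_iff_norm, not_le,
        not_le] at hxS
      -- Since L^δ = N^(-δ/2) and γ ≤ δ/2, the factor N^γ ‖y‖^δ is at least 1 beyond the radius L
      -- when N ≤ 1.
      have key : ∀ y : R3, L < ‖y‖ → w y ≤ N ^ γ * (‖y‖ ^ δ * w y) := fun y hy => by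
        rw [← mul_assoc]
        refine le_mul_of_one_le_left (hw0 y) ?_
        have h1 : L ^ δ ≤ ‖y‖ ^ δ := Real.rpow_le_rpow hLpos.le hy.le hδ.le
        have h2 : N ^ γ * L ^ δ = N ^ (γ - δ / 2) := by
          rw [hL, ← Real.rpow_mul hN.le, ← Real.rpow_add hN]; ring_nf
        calc (1 : ℝ) ≤ N ^ (γ - δ / 2) :=
              Real.one_le_rpow_of_pos_of_le_one_of_nonpos hN hN1
                (by linarith [min_le_right (3 / 4) (δ / 2)])
          _ ≤ _ := by rw [← h2]; gcongr
      calc ‖f x‖ ≤ C * (w x + w (x - F)) := hx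
        _ ≤ C * (N ^ γ * (‖x‖ ^ δ * w x) + N ^ γ * (‖x - F‖ ^ δ * w (x - F))) := by
            gcongr
            · exact key _ hxS.1
            · exact key _ hxS.2
        _ = _ := by rw [twoCentre]; ring
  -- For N ≤ 1 the Sobolev weight (2N)^k is at most 2^k and plays no further role.
  calc _ ≤ ENNReal.ofReal (2 ^ k) * (ENNReal.ofReal C * (2 * eLpNorm w 2 volume) *
        (2 * B * ENNReal.ofReal (N ^ γ)) + ENNReal.ofReal (C * N ^ γ) *
      (2 * eLpNorm (fun x => ‖x‖ ^ δ * w x) 2 volume)) := by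
        gcongr
        · linarith
        refine (eLpNorm_annulus_le_split hf hSm hSfin).trans ?_
        rw [mul_assoc]
        gcongr
        exact eLpNorm_le_twoCentre hw hC hb
    _ ≤ ENNReal.ofReal (2 ^ k) * (ENNReal.ofReal C * (2 * eLpNorm w 2 volume) *
        (2 * B * ENNReal.ofReal (N ^ γ)) + ENNReal.ofReal (C * N ^ γ) *
      (4 * eLpNorm (fun x => ‖x‖ ^ δ * w x) 2 volume)) := by
        gcongr
        norm_num
    _ = _ := by
        rw [ENNReal.ofReal_mul (by positivity), ENNReal.ofReal_mul (by positivity),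
          ENNReal.ofReal_mul (p := 4) (by norm_num)]
        norm_num
        ring

theorem summable_rpow_neg_abs {γ : ℝ} (hγ : 0 < γ) :
    Summable fun n : ℤ => ((2 : ℝ) ^ (-γ)) ^ n.natAbs := by
  have h : Summable fun n : ℕ => ((2 : ℝ) ^ (-γ)) ^ n :=
    summable_geometric_of_lt_one (by positivity)
      (Real.rpow_lt_one_of_one_lt_of_neg (by norm_num) (by linarith))
  exact Summable.of_nat_of_neg (by simpa using h) (by simpa using h)

/-- Criterion for a kernel to have a finite mixed norm, with a bound depending only on the
constants in the hypotheses. -/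
theorem exists_mixedNorm_le (ψ : Cutoff) {k s δ C : ℝ} (hk : 0 ≤ k) (hks : k < s) (hδ : 0 < δ)
    (hC : 0 ≤ C) {w W : R3 → ℝ} (hw0 : ∀ x, 0 ≤ w x) (hw : MemLp w 2 volume)
    (hwδ : MemLp (fun x => ‖x‖ ^ δ * w x) 2 volume) (hW : MemLp W 2 volume) :
    ∃ D : ℝ≥0, ∀ m : R3 → R3 → ℂ, (∀ᵐ F, AEStronglyMeasurable (m F) volume ∧
      (∀ᵐ x, ‖m F x‖ ≤ C * twoCentre w F x) ∧
      ∀ i : Fin 3, ∀ h : ℝ, 0 < h → h ≤ 1 →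
        ∀ᵐ x, ‖secondDiff (m F) (EuclideanSpace.single i h) x‖ ≤ C * h ^ s * twoCentre W F x) →
      mixedNorm ψ k m ≤ D := by
  set E1 : ℝ≥0∞ := ENNReal.ofReal (2 ^ k * (384 * C)) * eLpNorm W 2 volume
  set E2 : ℝ≥0∞ := ENNReal.ofReal (2 ^ k * (4 * C)) *
        (eLpNorm w 2 volume * volume (Metric.ball (0 : R3) 1) +
          eLpNorm (fun x => ‖x‖ ^ δ * w x) 2 volume)
  -- A common geometric rate: s - k for N ≥ 1, and the low-frequency exponent for N ≤ 1.
  set γ := min (s - k) (min (3 / 4) (δ / 2))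
  have hγ : 0 < γ := lt_min (by linarith) (lt_min (by norm_num) (by linarith))
  have hEfin : E1 + E2 ≠ ⊤ := by
    have h1 := hw.2.ne
    have h2 := hW.2.ne
    have h3 := hwδ.2.ne
    have h4 : volume (Metric.ball (0 : R3) 1) ≠ ⊤ := measure_ball_lt_top.ne
    finiteness
  have hsum := summable_rpow_neg_abs hγ
  have hfin : (∑' n : ℤ, (E1 + E2) * ENNReal.ofReal (((2 : ℝ) ^ (-γ)) ^ n.natAbs)) ≠ ⊤ := by
    rw [ENNReal.tsum_mul_left]
    exact ENNReal.mul_ne_top hEfin hsum.tsum_ofReal_ne_top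
  refine ⟨(∑' n : ℤ, (E1 + E2) * ENNReal.ofReal (((2 : ℝ) ^ (-γ)) ^ n.natAbs)).toNNReal,
    fun m hm => ?_⟩
  rw [ENNReal.coe_toNNReal hfin, mixedNorm]
  refine ENNReal.tsum_le_tsum fun n => essSup_le_of_ae_le _ ?_
  filter_upwards [hm] with F ⟨hmeas, hb, hd⟩
  have hf : MemLp (m F) 2 volume :=
    ⟨hmeas, (eLpNorm_le_twoCentre hw.1 hC hb).trans_lt (by
      have := hw.2.ne
      exact (by finiteness : ENNReal.ofReal C * (2 * eLpNorm w 2 volume) ≠ ⊤).lt_top)⟩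
  have hN : (0 : ℝ) < 2 ^ n := by positivity
  rcases le_total 0 n with hn | hn
  · obtain ⟨j, rfl⟩ := Int.eq_ofNat_of_zero_le hn
    have hN1 : (1 : ℝ) ≤ 2 ^ (j : ℤ) := one_le_zpow₀ (by norm_num) hn
    -- The step h = 1/N is at most 1, hence admissible in the hypothesis on second differences.
    have h1 := blockNorm_le_high ψ (s := s) hk hN hC hf hW.1 (F := F) fun i => by
      have := hd i ((2 : ℝ) ^ (j : ℤ))⁻¹ (inv_pos.2 hN) (inv_le_one_of_one_le₀ hN1)
      rwa [Real.inv_rpow hN.le, ← Real.rpow_neg hN.le] at this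
    refine h1.trans ?_
    gcongr
    · exact le_self_add
    · rw [Int.natAbs_natCast, zpow_natCast, ← Real.rpow_natCast, ← Real.rpow_natCast,
        ← Real.rpow_mul (by norm_num), ← Real.rpow_mul (by norm_num)]
      refine Real.rpow_le_rpow_of_exponent_le (by norm_num) ?_
      have : γ ≤ s - k := min_le_left _ _
      nlinarith [(Nat.cast_nonneg j : (0 : ℝ) ≤ j)]
  · obtain ⟨j, hj⟩ := Int.eq_ofNat_of_zero_le (neg_nonneg.2 hn)
    obtain rfl : n = -(j : ℤ) := by omega
    have hN1 : (2 : ℝ) ^ (-(j : ℤ)) ≤ 1 := zpow_le_one_of_nonpos₀ (by norm_num) hn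
    refine (blockNorm_le_low ψ hk hN hN1 hC hδ hf hw0 hw.1 hb).trans ?_
    gcongr
    · exact le_add_self
    · rw [Int.natAbs_neg, Int.natAbs_natCast, zpow_neg, zpow_natCast, ← Real.rpow_natCast,
        ← Real.rpow_natCast, ← Real.rpow_neg (by norm_num), ← Real.rpow_mul (by norm_num),
        ← Real.rpow_mul (by norm_num)]
      refine Real.rpow_le_rpow_of_exponent_le (by norm_num) ?_
      have : γ ≤ min (3 / 4) (δ / 2) := min_le_right _ _
      nlinarith [(Nat.cast_nonneg j : (0 : ℝ) ≤ j)]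

/-! ### Radial profiles. -/

/-- The radial profile `r^α` for `r ≤ 1`, `r^(-β)` for `r ≥ 1`. -/
def profile (α β r : ℝ) : ℝ := min 1 r ^ α * max 1 r ^ (-β)

theorem profile_nonneg (α β : ℝ) {r : ℝ} (hr : 0 ≤ r) : 0 ≤ profile α β r :=
  mul_nonneg (Real.rpow_nonneg (le_min zero_le_one hr) _) (by positivity)

theorem profile_of_le_one {r : ℝ} (α β : ℝ) (h : r ≤ 1) : profile α β r = r ^ α := by
  simp [profile, h]

theorem profile_of_one_le {r : ℝ} (α β : ℝ) (h : 1 ≤ r) : profile α β r = r ^ (-β) := by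
  simp [profile, h]

theorem measurable_profile (α β : ℝ) : Measurable (profile α β) :=
  ((measurable_const.min measurable_id).pow_const α).mul
    ((measurable_const.max measurable_id).pow_const (-β))

/-- In polar coordinates the square has density r^(2+2α) near 0 and r^(2-2β) at infinity; 3/2 is
half the dimension in both conditions. -/
theorem memLp_profile {α β : ℝ} (hα : -(3 / 2) < α) (hβ : 3 / 2 < β) :
    MemLp (fun x : R3 => profile α β ‖x‖) 2 volume := by
  have hm : AEStronglyMeasurable (fun x : R3 => profile α β ‖x‖) volume :=
    ((measurable_profile α β).comp measurable_norm).aestronglyMeasurable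
  rw [memLp_two_iff_integrable_sq hm,
    integrable_fun_norm_addHaar volume (f := fun r => profile α β r ^ 2),
    ← Set.Ioc_union_Ioi_eq_Ioi zero_le_one]
  simp only [finrank_euclideanSpace, Fintype.card_fin, smul_eq_mul]
  refine IntegrableOn.union ?_ ?_
  · have h := (intervalIntegral.intervalIntegrable_rpow' (a := 0) (b := 1)
      (by linarith : -1 < 2 + 2 * α)).1
    refine h.congr_fun (fun r hr => ?_) measurableSet_Ioc
    beta_reduce
    rw [profile_of_le_one _ _ hr.2, Real.rpow_add hr.1, mul_comm 2 α, Real.rpow_mul hr.1.le]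
    norm_num
  · have h := integrableOn_Ioi_rpow_of_lt (by linarith : 2 + -β * 2 < -1) one_pos
    refine h.congr_fun (fun r hr => ?_) measurableSet_Ioi
    have hr0 : (0 : ℝ) < r := one_pos.trans hr
    beta_reduce
    rw [profile_of_one_le _ _ (le_of_lt hr), Real.rpow_add hr0, Real.rpow_mul hr0.le]
    norm_num

/-- The extra weight lowers the decay exponent from β to β - δ, which is still beyond 3/2. -/
theorem memLp_rpow_mul_profile {β δ : ℝ} (hδ : 0 < δ) (hβ : 3 / 2 < β - δ) :
    MemLp (fun x : R3 => ‖x‖ ^ δ * profile 0 β ‖x‖) 2 volume := by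
  refine (memLp_profile (α := 0) (β := β - δ) (by norm_num) hβ).of_le
    ((measurable_norm.pow_const δ).mul
      ((measurable_profile 0 β).comp measurable_norm)).aestronglyMeasurable
    (Filter.Eventually.of_forall fun x => ?_)
  have h0 := profile_nonneg 0 β (norm_nonneg x)
  rw [Real.norm_of_nonneg (by positivity), Real.norm_of_nonneg (profile_nonneg _ _ (norm_nonneg x))]
  simp only [profile, Real.rpow_zero, one_mul]
  have hm : (0 : ℝ) < max 1 ‖x‖ := lt_max_of_lt_left one_pos
  calc ‖x‖ ^ δ * max 1 ‖x‖ ^ (-β) ≤ max 1 ‖x‖ ^ δ * max 1 ‖x‖ ^ (-β) := by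
        gcongr
        exact le_max_right _ _
    _ = _ := by rw [← Real.rpow_add hm]; congr 1; ring

/-- A profile with nonpositive exponents grows at most by a constant factor when the radius is
at most halved. -/
theorem profile_le_of_half_le {α β r r' : ℝ} (hα : α ≤ 0) (hβ : 0 ≤ β) (hr : 0 < r)
    (h : r / 2 ≤ r') : profile α β r' ≤ 2 ^ (β - α) * profile α β r := by
  have h1 : min 1 r / 2 ≤ min 1 r' := by
    refine le_min ?_ ((div_le_div_of_nonneg_right (min_le_right _ _) (by norm_num)).trans h)
    linarith [min_le_left 1 r]
  have h2 : max 1 r / 2 ≤ max 1 r' := by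
    rcases le_total 1 r with h3 | h3
    · rw [max_eq_right h3]; exact h.trans (le_max_right _ _)
    · rw [max_eq_left h3]; linarith [le_max_left 1 r']
  have hm : 0 < min 1 r := lt_min one_pos hr
  have hM : 0 < max 1 r := lt_max_of_lt_left one_pos
  calc profile α β r' ≤ (min 1 r / 2) ^ α * (max 1 r / 2) ^ (-β) := by
        refine mul_le_mul (Real.rpow_le_rpow_of_nonpos (by positivity) h1 hα)
          (Real.rpow_le_rpow_of_nonpos (by positivity) h2 (by linarith)) (by positivity)
          (by positivity)
    _ = _ := by
        rw [Real.div_rpow hm.le (by norm_num), Real.div_rpow hM.le (by norm_num), profile,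
          sub_eq_add_neg, Real.rpow_add (by norm_num), Real.rpow_neg (by norm_num) α,
          Real.rpow_neg (x := 2) (by norm_num) β]
        field_simp

/-- Replaces a profile by a pure power, which can then be compared with a power of the projection to
a line. -/
theorem profile_le_rpow {α β r : ℝ} (h : -β ≤ α) : profile α β r ≤ r ^ α := by
  rcases le_total r 1 with h1 | h1
  · rw [profile_of_le_one _ _ h1]
  · rw [profile_of_one_le _ _ h1]
    exact Real.rpow_le_rpow_of_exponent_le h1 h

/-! ### From derivative bounds along a line to second differences. -/

section Increment

variable {ε h : ℝ}

theorem integrable_indicator_rpow_abs (hε : 0 < ε) :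
    Integrable (fun u : ℝ => (Set.Iic h).indicator (fun r => r ^ (ε - 1)) |u|) volume := by
  have key := integrable_fun_norm_addHaar (E := ℝ) volume
    (f := (Set.Iic h).indicator (fun r : ℝ => r ^ (ε - 1)))
  simp only [Real.norm_eq_abs] at key
  rw [key]
  simp only [Module.finrank_self, le_refl, tsub_eq_zero_of_le, pow_zero, one_smul]
  rw [integrableOn_indicator_iff measurableSet_Iic, Set.inter_comm, Set.Ioi_inter_Iic]
  exact (intervalIntegral.intervalIntegrable_rpow' (by linarith)).1

theorem integral_indicator_rpow_abs (hε : 0 < ε) (hh : 0 < h) :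
    ∫ u : ℝ, (Set.Iic h).indicator (fun r => r ^ (ε - 1)) |u| = 2 / ε * h ^ ε := by
  rw [integral_comp_abs, setIntegral_indicator measurableSet_Iic, Set.Ioi_inter_Iic,
    ← intervalIntegral.integral_of_le hh.le, integral_rpow (Or.inl (by linarith))]
  rw [sub_add_cancel, Real.zero_rpow hε.ne']
  ring

/-- A function whose derivative has two integrable power singularities is Hölder continuous. -/
theorem abs_increment_le {f f' : ℝ → ℝ} (hf : ∀ t, HasDerivAt f (f' t) t) (hc : Continuous f')
    {A t₀ t₁ : ℝ} (hε : 0 < ε) (hε1 : ε ≤ 1) (hh : 0 < h)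
    (hb : ∀ t, t ≠ t₀ → t ≠ t₁ → |f' t| ≤ A * (|t - t₀| ^ (ε - 1) + |t - t₁| ^ (ε - 1)))
    (hA : 0 ≤ A) (a : ℝ) : |f (a + h) - f a| ≤ A * (2 * (1 + 2 / ε)) * h ^ ε := by
  set g : ℝ → ℝ := fun u => (Set.Iic h).indicator (fun r => r ^ (ε - 1)) |u| with hg
  have hgi : Integrable g volume := integrable_indicator_rpow_abs hε
  have hg0 : ∀ u, 0 ≤ g u := fun u =>
    Set.indicator_apply_nonneg fun _ => Real.rpow_nonneg (abs_nonneg u) _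
  -- The singularity is cut at distance h. Over an interval of length h, the constant part
  -- integrates to h^ε and the truncated singularity to at most (2/ε) h^ε, wherever the interval
  -- lies.
  have hpt : ∀ u : ℝ, u ≠ 0 → |u| ^ (ε - 1) ≤ h ^ (ε - 1) + g u := fun u hu => by
    by_cases h1 : |u| ≤ h
    · have : g u = |u| ^ (ε - 1) := Set.indicator_of_mem (s := Set.Iic h) h1 _
      rw [this]
      linarith [Real.rpow_nonneg hh.le (ε - 1)]
    · have := Real.rpow_le_rpow_of_nonpos hh (not_le.1 h1).le (by linarith : ε - 1 ≤ 0)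
      linarith [hg0 u]
  have hgt : ∀ c, Integrable (fun t => g (t - c)) volume := fun c => hgi.comp_sub_right c
  have hgint : ∀ c, ∫ t in a..(a + h), g (t - c) ≤ 2 / ε * h ^ ε := fun c => by
    rw [intervalIntegral.integral_of_le (by linarith), ← integral_indicator_rpow_abs hε hh,
      ← integral_sub_right_eq_self (μ := volume)
        (fun u : ℝ => (Set.Iic h).indicator (fun r => r ^ (ε - 1)) |u|) c]
    exact setIntegral_le_integral (hgt c) (Filter.Eventually.of_forall fun t => hg0 _)
  set B : ℝ → ℝ := fun t => A * ((h ^ (ε - 1) + g (t - t₀)) + (h ^ (ε - 1) + g (t - t₁))) with hB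
  have hi : ∀ c, IntervalIntegrable (fun t => h ^ (ε - 1) + g (t - c)) volume a (a + h) :=
    fun c => intervalIntegrable_const.add (hgt c).intervalIntegrable
  have hBi : IntervalIntegrable B volume a (a + h) := ((hi t₀).add (hi t₁)).const_mul A
  rw [← intervalIntegral.integral_eq_sub_of_hasDerivAt (fun t _ => hf t)
    (hc.intervalIntegrable _ _), ← Real.norm_eq_abs]
  have hae : ∀ᵐ t : ℝ, t ≠ t₀ ∧ t ≠ t₁ := by
    filter_upwards [(Set.countable_singleton t₀).ae_notMem volume,
      (Set.countable_singleton t₁).ae_notMem volume] with t h1 h2 using ⟨h1, h2⟩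
  refine (intervalIntegral.norm_integral_le_of_norm_le (by linarith) ?_ hBi).trans ?_
  · filter_upwards [hae] with t ht _
    refine (hb t ht.1 ht.2).trans ?_
    exact mul_le_mul_of_nonneg_left (add_le_add (hpt _ (sub_ne_zero.2 ht.1))
      (hpt _ (sub_ne_zero.2 ht.2))) hA
  · have e : h * h ^ (ε - 1) = h ^ ε := by
      rw [Real.rpow_sub_one hh.ne']; field_simp
    have e1 : ∀ c, ∫ t in a..(a + h), (h ^ (ε - 1) + g (t - c)) ≤ (1 + 2 / ε) * h ^ ε := fun c => by
      rw [intervalIntegral.integral_add intervalIntegrable_const (hgt c).intervalIntegrable,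
        intervalIntegral.integral_const, add_sub_cancel_left, smul_eq_mul, e]
      linarith [hgint c]
    rw [hB, intervalIntegral.integral_const_mul, intervalIntegral.integral_add (hi _) (hi _)]
    calc _ ≤ A * ((1 + 2 / ε) * h ^ ε + (1 + 2 / ε) * h ^ ε) := by
          gcongr
          · exact e1 _
          · exact e1 _
      _ = _ := by ring

end Increment

/-- Two mean value inequalities: one for f' over a distance h, one for the increment t ↦ f(t+h) -
f(t) over [0, h]. -/
theorem abs_secondDiff_le_of_abs_deriv_two_le {f f' f'' : ℝ → ℝ} (hf : ∀ t, HasDerivAt f (f' t) t)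
    (hf' : ∀ t, HasDerivAt f' (f'' t) t) {h M : ℝ} (hh : 0 < h)
    (hb : ∀ t, 0 ≤ t → t ≤ 2 * h → |f'' t| ≤ M) : |f (2 * h) - (f h + f h) + f 0| ≤ h ^ 2 * M := by
  have h1 : ∀ t ∈ Set.Icc 0 h, ‖f' (t + h) - f' t‖ ≤ M * h := fun t ht => by
    have := Convex.norm_image_sub_le_of_norm_hasDerivWithin_le (f := f') (f' := f'') (C := M)
      (s := Set.Icc 0 (2 * h)) (x := t) (y := t + h) (fun x _ => (hf' x).hasDerivWithinAt)
      (fun x hx => hb x hx.1 hx.2) (convex_Icc _ _) ⟨ht.1, by linarith [ht.2]⟩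
      ⟨by linarith [ht.1], by linarith [ht.2]⟩
    simpa [abs_of_pos hh] using this
  have h2 := Convex.norm_image_sub_le_of_norm_hasDerivWithin_le (f := fun t => f (t + h) - f t)
      (f' := fun t => f' (t + h) - f' t) (C := M * h)
      (s := Set.Icc 0 h) (x := 0) (y := h)
      (fun x _ => (((hf (x + h)).comp_add_const x h).sub (hf x)).hasDerivWithinAt)
      h1 (convex_Icc _ _) ⟨le_rfl, hh.le⟩ ⟨hh.le, le_rfl⟩
  simp only [zero_add, sub_zero, Real.norm_eq_abs, abs_of_pos hh] at h2
  calc |f (2 * h) - (f h + f h) + f 0| = |f (h + h) - f h - (f h - f 0)| := by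
        rw [two_mul]; congr 1; ring
    _ ≤ M * h * h := h2
    _ = _ := by ring

/-- Second differences along a line of a function whose first two derivatives along this line have
power singularities at `0` and at `F`. -/
theorem abs_secondDiff_line_le {ε β C : ℝ} (hε : 0 < ε) (hε1 : ε ≤ 1) (hβ : 3 / 2 ≤ β)
    (hC : 0 ≤ C) {F x e : R3} (he : ‖e‖ = 1) (hx : ∀ t : ℝ, x + t • e ≠ 0)
    (hy : ∀ t : ℝ, x - F + t • e ≠ 0)
    {f f' f'' : ℝ → ℝ} (hf : ∀ t, HasDerivAt f (f' t) t)
    (hf' : ∀ t, HasDerivAt f' (f'' t) t)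
    (hb1 : ∀ t, |f' t| ≤
      C * (profile (ε - 1) β ‖x + t • e‖ + profile (ε - 1) β ‖x - F + t • e‖))
    (hb2 : ∀ t, |f'' t| ≤
      C * (profile (ε - 2) β ‖x + t • e‖ + profile (ε - 2) β ‖x - F + t • e‖))
    {h : ℝ} (hh : 0 < h) (hh1 : h ≤ 1) :
    |f (2 * h) - (f h + f h) + f 0| ≤
      C * (2 ^ (β + 2) + 256 * (1 + 2 / ε) * 4 ^ β) * h ^ (3 / 2 + ε / 2) *
        (profile (ε / 2 - 3 / 2) β ‖x‖ + profile (ε / 2 - 3 / 2) β ‖x - F‖) := by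
  have hx0 : 0 < ‖x‖ := norm_pos_iff.2 (by simpa using hx 0)
  have hy0 : 0 < ‖x - F‖ := norm_pos_iff.2 (by simpa using hy 0)
  have hP := profile_nonneg (ε / 2 - 3 / 2) β hx0.le
  have hQ := profile_nonneg (ε / 2 - 3 / 2) β hy0.le
  have hhs : 0 < h ^ (3 / 2 + ε / 2) := Real.rpow_pos_of_pos hh _
  -- At distance at least 4h from both centres the segment of length 2h at most halves the
  -- distances, and the second derivative is used. Closer to a centre, only the Hölder bound of
  -- order ε is available, and the weight is large enough there.
  by_cases hfar : 4 * h ≤ ‖x‖ ∧ 4 * h ≤ ‖x - F‖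
  · have hline : ∀ z : R3, 4 * h ≤ ‖z‖ → 0 < ‖z‖ → ∀ t, 0 ≤ t → t ≤ 2 * h →
        profile (ε - 2) β ‖z + t • e‖ ≤ 2 ^ (β + 2) * profile (ε - 2) β ‖z‖ :=
      fun z hz hz0 t ht0 ht => by
        have h1 : ‖z‖ / 2 ≤ ‖z + t • e‖ := by
          have h2 : ‖z‖ ≤ ‖z + t • e‖ + ‖t • e‖ := by
            simpa using norm_sub_le (z + t • e) (t • e)
          rw [norm_smul, he, mul_one, Real.norm_of_nonneg ht0] at h2
          linarith
        refine (profile_le_of_half_le (by linarith) (by linarith) hz0 h1).trans ?_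
        gcongr
        · exact profile_nonneg _ _ hz0.le
        · norm_num
        · linarith
    -- Interpolation: the spare factor h^(1/2-ε/2) is at most min(1, r)^(1/2-ε/2), as h ≤ min(1, r)
    -- and ε ≤ 1.
    have hscale : ∀ r, 4 * h ≤ r → h ^ 2 * profile (ε - 2) β r ≤
        h ^ (3 / 2 + ε / 2) * profile (ε / 2 - 3 / 2) β r := fun r hr => by
      have hm : 0 < min 1 r := lt_min one_pos (by linarith)
      have hhm : h ≤ min 1 r := le_min hh1 (by linarith)
      have e1 : h ^ 2 = h ^ (3 / 2 + ε / 2) * h ^ (1 / 2 - ε / 2) := by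
        rw [← Real.rpow_natCast, ← Real.rpow_add hh]; norm_num
      have e2 : min 1 r ^ (ε / 2 - 3 / 2) = min 1 r ^ (1 / 2 - ε / 2) * min 1 r ^ (ε - 2) := by
        rw [← Real.rpow_add hm]; ring_nf
      rw [profile, profile, e1, e2, mul_assoc, mul_assoc]
      gcongr
      linarith
    refine (abs_secondDiff_le_of_abs_deriv_two_le hf hf' (M := C * 2 ^ (β + 2) *
      (profile (ε - 2) β ‖x‖ + profile (ε - 2) β ‖x - F‖)) hh fun t ht0 ht => ?_).trans ?_
    · refine (hb2 t).trans ?_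
      rw [mul_assoc]
      refine mul_le_mul_of_nonneg_left ?_ hC
      rw [mul_add]
      exact add_le_add (hline x hfar.1 hx0 t ht0 ht) (hline (x - F) hfar.2 hy0 t ht0 ht)
    · calc _ = C * 2 ^ (β + 2) * (h ^ 2 * profile (ε - 2) β ‖x‖ +
            h ^ 2 * profile (ε - 2) β ‖x - F‖) := by ring
        _ ≤ C * 2 ^ (β + 2) * (h ^ (3 / 2 + ε / 2) * profile (ε / 2 - 3 / 2) β ‖x‖ +
            h ^ (3 / 2 + ε / 2) * profile (ε / 2 - 3 / 2) β ‖x - F‖) := by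
            gcongr ?_ * (?_ + ?_)
            · exact hscale _ hfar.1
            · exact hscale _ hfar.2
        _ = C * 2 ^ (β + 2) * h ^ (3 / 2 + ε / 2) *
            (profile (ε / 2 - 3 / 2) β ‖x‖ + profile (ε / 2 - 3 / 2) β ‖x - F‖) := by ring
        _ ≤ _ := by
            gcongr
            have : 0 ≤ 256 * (1 + 2 / ε) * 4 ^ β := by positivity
            linarith
  · have hinc : ∀ a, |f (a + h) - f a| ≤ C * (2 * (1 + 2 / ε)) * h ^ ε := fun a => by
      -- A vector is at least as long as its projection to e, so the singularity along the line is
      -- at worst a power singularity at the foot of the perpendicular.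
      have hproj : ∀ z : R3, ∀ t : ℝ, z + t • e ≠ 0 → t ≠ -inner ℝ z e →
          profile (ε - 1) β ‖z + t • e‖ ≤ |t - -inner ℝ z e| ^ (ε - 1) := fun z t hz ht => by
        refine (profile_le_rpow (by linarith)).trans ?_
        refine Real.rpow_le_rpow_of_nonpos (abs_pos.2 (sub_ne_zero.2 ht)) ?_ (by linarith)
        have h1 := abs_real_inner_le_norm (z + t • e) e
        rw [inner_add_left, real_inner_smul_left, real_inner_self_eq_norm_sq, he] at h1
        rw [sub_neg_eq_add, add_comm]
        simpa using h1
      refine abs_increment_le hf (continuous_iff_continuousAt.2 fun t => (hf' t).continuousAt)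
        hε hε1 hh (t₀ := -inner ℝ x e) (t₁ := -inner ℝ (x - F) e) (fun t h0 h1 => ?_) hC a
      refine (hb1 t).trans (mul_le_mul_of_nonneg_left ?_ hC)
      exact add_le_add (hproj x t (hx t) h0) (hproj (x - F) t (hy t) h1)
    have hnear : ∀ r, 0 < r → r < 4 * h →
        h ^ ε ≤ 64 * 4 ^ β * (h ^ (3 / 2 + ε / 2) * profile (ε / 2 - 3 / 2) β r) :=
      fun r hr hr4 => by
        have hm : 0 < min 1 r := lt_min one_pos hr
        have hM : 0 < max 1 r := lt_max_of_lt_left one_pos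
        have h1 : (4 * h) ^ (ε / 2 - 3 / 2) ≤ min 1 r ^ (ε / 2 - 3 / 2) :=
          Real.rpow_le_rpow_of_nonpos hm ((min_le_right _ _).trans hr4.le) (by linarith)
        have h2 : (4 : ℝ) ^ (-β) ≤ max 1 r ^ (-β) :=
          Real.rpow_le_rpow_of_nonpos hM (max_le (by norm_num) (by linarith)) (by linarith)
        -- The exponent ε/2 - 3/2 is at least -3, and 4^(-3) = 1/64.
        have h3 : (1 : ℝ) / 64 ≤ 4 ^ (ε / 2 - 3 / 2) := by
          have : (4 : ℝ) ^ (-3 : ℝ) ≤ 4 ^ (ε / 2 - 3 / 2) :=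
            Real.rpow_le_rpow_of_exponent_le (by norm_num) (by linarith)
          refine le_trans (le_of_eq ?_) this
          rw [Real.rpow_neg (by norm_num)]
          norm_num
        have h4 : (4 : ℝ) ^ β * 4 ^ (-β) = 1 := by
          rw [← Real.rpow_add (by norm_num), add_neg_cancel, Real.rpow_zero]
        have h5 : h ^ (3 / 2 + ε / 2) * h ^ (ε / 2 - 3 / 2) = h ^ ε := by
          rw [← Real.rpow_add hh]; ring_nf
        calc h ^ ε = 64 * 4 ^ β * (h ^ (3 / 2 + ε / 2) *
              ((1 / 64 * h ^ (ε / 2 - 3 / 2)) * 4 ^ (-β))) := by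
              rw [← h5]; linear_combination
                (-(h ^ (3 / 2 + ε / 2) * h ^ (ε / 2 - 3 / 2))) * h4
          _ ≤ 64 * 4 ^ β * (h ^ (3 / 2 + ε / 2) *
              ((4 ^ (ε / 2 - 3 / 2) * h ^ (ε / 2 - 3 / 2)) * 4 ^ (-β))) := by gcongr
          _ ≤ _ := by
              rw [← Real.mul_rpow (by norm_num) hh.le, profile]
              gcongr
    have hε' : h ^ ε ≤ 64 * 4 ^ β * (h ^ (3 / 2 + ε / 2) *
        (profile (ε / 2 - 3 / 2) β ‖x‖ + profile (ε / 2 - 3 / 2) β ‖x - F‖)) := by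
      rw [not_and_or, not_le, not_le] at hfar
      rcases hfar with h1 | h1
      · refine (hnear _ hx0 h1).trans ?_
        gcongr
        linarith
      · refine (hnear _ hy0 h1).trans ?_
        gcongr
        linarith
    have i1 := hinc 0
    have i2 := hinc h
    rw [zero_add] at i1
    rw [← two_mul] at i2
    -- Near a centre the second difference is treated as a difference of two increments, without
    -- using their cancellation.
    calc |f (2 * h) - (f h + f h) + f 0| = |(f (2 * h) - f h) - (f h - f 0)| := by congr 1; ring
      _ ≤ C * (2 * (1 + 2 / ε)) * h ^ ε + C * (2 * (1 + 2 / ε)) * h ^ ε :=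
          (abs_sub _ _).trans (add_le_add i2 i1)
      _ = C * (4 * (1 + 2 / ε)) * h ^ ε := by ring
      _ ≤ C * (4 * (1 + 2 / ε)) * (64 * 4 ^ β * (h ^ (3 / 2 + ε / 2) *
        (profile (ε / 2 - 3 / 2) β ‖x‖ + profile (ε / 2 - 3 / 2) β ‖x - F‖))) := by gcongr
      _ = C * (256 * (1 + 2 / ε) * 4 ^ β) * h ^ (3 / 2 + ε / 2) *
        (profile (ε / 2 - 3 / 2) β ‖x‖ + profile (ε / 2 - 3 / 2) β ‖x - F‖) := by ring
      _ ≤ _ := by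
          gcongr
          have : (0 : ℝ) ≤ 2 ^ (β + 2) := by positivity
          linarith

/-! ### Symbol calculus: bounds w ℓ^(-j) on derivatives of families of functions. -/

section SymbolCalculus

variable {ι : Type*}

/-- `IsSymbol U ℓ n w f`: the family `f i : ℝ → ℝ` is `n` times differentiable, and on the region
`U` its `j`-th derivatives, `j ≤ n`, are bounded by a uniform multiple of `w * ℓ ^ (-j)`. -/
def IsSymbol (U : ι → ℝ → Prop) (ℓ : ι → ℝ → ℝ) : ℕ → (ι → ℝ → ℝ) → (ι → ℝ → ℝ) → Prop
  | 0, w, f => ∃ C, ∀ i t, U i t → |f i t| ≤ C * w i t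
  | n + 1, w, f => (∃ C, ∀ i t, U i t → |f i t| ≤ C * w i t) ∧
      (∀ i, Differentiable ℝ (f i)) ∧ IsSymbol U ℓ n (w / ℓ) (fun i => deriv (f i))

variable {U V : ι → ℝ → Prop} {ℓ ℓ' w v δ : ι → ℝ → ℝ} {f g : ι → ℝ → ℝ} {n : ℕ}

namespace IsSymbol

theorem bound (h : IsSymbol U ℓ n w f) : ∃ C, ∀ i t, U i t → |f i t| ≤ C * w i t := by
  cases n with
  | zero => exact h
  | succ n => exact h.1

theorem differentiable (h : IsSymbol U ℓ (n + 1) w f) (i : ι) : Differentiable ℝ (f i) := h.2.1 i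

theorem deriv (h : IsSymbol U ℓ (n + 1) w f) :
    IsSymbol U ℓ n (w / ℓ) (fun i => deriv (f i)) := h.2.2

theorem of_succ (h : IsSymbol U ℓ (n + 1) w f) : IsSymbol U ℓ n w f := by
  induction n generalizing w f with
  | zero => exact h.1
  | succ n ih => exact ⟨h.1, h.2.1, ih h.2.2⟩

theorem region (h : IsSymbol U ℓ n w f) (hVU : ∀ i t, V i t → U i t) : IsSymbol V ℓ n w f := by
  induction n generalizing w f with
  | zero => exact h.imp fun C hC i t ht => hC i t (hVU i t ht)
  | succ n ih => exact ⟨h.1.imp fun C hC i t ht => hC i t (hVU i t ht), h.2.1, ih h.2.2⟩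

/-- Weights may be enlarged and scales shrunk, up to constants. -/
theorem mono (h : IsSymbol U ℓ n w f) (hℓ' : ∀ i t, U i t → 0 < ℓ' i t) (D E : ℝ)
    (hw : ∀ i t, U i t → 0 ≤ w i t ∧ w i t ≤ D * v i t)
    (hℓ : ∀ i t, U i t → ℓ' i t ≤ E * ℓ i t ∧ 0 < ℓ i t) : IsSymbol U ℓ' n v f := by
  have key : ∀ {D : ℝ} {w v : ι → ℝ → ℝ} {f : ι → ℝ → ℝ},
      (∀ i t, U i t → 0 ≤ w i t ∧ w i t ≤ D * v i t) →
      (∃ C, ∀ i t, U i t → |f i t| ≤ C * w i t) → ∃ C, ∀ i t, U i t → |f i t| ≤ C * v i t := by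
    rintro D w v f hw ⟨C, hC⟩
    refine ⟨|C| * D, fun i t ht => (hC i t ht).trans ?_⟩
    rw [mul_assoc]
    exact (mul_le_mul_of_nonneg_right (le_abs_self C) (hw i t ht).1).trans
      (mul_le_mul_of_nonneg_left (hw i t ht).2 (abs_nonneg C))
  induction n generalizing w v f D with
  | zero => exact key hw h
  | succ n ih =>
    refine ⟨key hw h.1, h.2.1, ih h.2.2 (D * E) fun i t ht => ?_⟩
    obtain ⟨h1, h2⟩ := hw i t ht
    obtain ⟨h3, h4⟩ := hℓ i t ht
    have h5 := hℓ' i t ht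
    refine ⟨div_nonneg h1 h4.le, ?_⟩
    change w i t / ℓ i t ≤ D * E * (v i t / ℓ' i t)
    rw [div_le_iff₀ h4]
    calc w i t ≤ D * v i t := h2
      _ = D * v i t / ℓ' i t * ℓ' i t := by field_simp
      _ ≤ D * v i t / ℓ' i t * (E * ℓ i t) := by
          refine mul_le_mul_of_nonneg_left h3 (div_nonneg (h1.trans h2) h5.le)
      _ = _ := by ring

/-- Only the weight is enlarged. -/
theorem weight (h : IsSymbol U ℓ n w f) (hℓ : ∀ i t, U i t → 0 < ℓ i t) (D : ℝ)
    (hw : ∀ i t, U i t → 0 ≤ w i t ∧ w i t ≤ D * v i t) : IsSymbol U ℓ n v f :=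
  h.mono hℓ D 1 hw fun i t ht => ⟨by rw [one_mul], hℓ i t ht⟩

theorem weight_congr (h : IsSymbol U ℓ n w f) (hw : ∀ i t, U i t → w i t = v i t) :
    IsSymbol U ℓ n v f := by
  induction n generalizing w v f with
  | zero => exact h.imp fun C hC i t ht => hw i t ht ▸ hC i t ht
  | succ n ih =>
    refine ⟨h.1.imp fun C hC i t ht => hw i t ht ▸ hC i t ht, h.2.1, ih h.2.2 fun i t ht => ?_⟩
    change w i t / ℓ i t = v i t / ℓ i t
    rw [hw i t ht]

theorem add (hf : IsSymbol U ℓ n w f) (hg : IsSymbol U ℓ n w g) : IsSymbol U ℓ n w (f + g) := by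
  have key : ∀ {w f g : ι → ℝ → ℝ}, (∃ C, ∀ i t, U i t → |f i t| ≤ C * w i t) →
      (∃ C, ∀ i t, U i t → |g i t| ≤ C * w i t) →
        ∃ C, ∀ i t, U i t → |(f + g) i t| ≤ C * w i t := by
    rintro w f g ⟨C, hC⟩ ⟨D, hD⟩
    refine ⟨C + D, fun i t ht => ?_⟩
    rw [add_mul]
    exact (abs_add_le _ _).trans (add_le_add (hC i t ht) (hD i t ht))
  induction n generalizing w f g with
  | zero => exact key hf hg
  | succ n ih =>
    refine ⟨key hf.1 hg.1, fun i => (hf.2.1 i).add (hg.2.1 i), ?_⟩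
    have e : (fun i => _root_.deriv ((f + g) i)) =
        (fun i => _root_.deriv (f i)) + fun i => _root_.deriv (g i) := by
      funext i t
      exact deriv_add (hf.2.1 i t) (hg.2.1 i t)
    rw [e]
    exact ih hf.2.2 hg.2.2

theorem mul (hf : IsSymbol U ℓ n w f) (hg : IsSymbol U ℓ n v g) :
    IsSymbol U ℓ n (w * v) (f * g) := by
  have key : ∀ {w v f g : ι → ℝ → ℝ}, (∃ C, ∀ i t, U i t → |f i t| ≤ C * w i t) →
      (∃ C, ∀ i t, U i t → |g i t| ≤ C * v i t) →
        ∃ C, ∀ i t, U i t → |(f * g) i t| ≤ C * (w * v) i t := by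
    rintro w v f g ⟨C, hC⟩ ⟨D, hD⟩
    refine ⟨C * D, fun i t ht => ?_⟩
    change |f i t * g i t| ≤ C * D * (w i t * v i t)
    rw [abs_mul]
    calc _ ≤ (C * w i t) * (D * v i t) :=
          mul_le_mul (hC i t ht) (hD i t ht) (abs_nonneg _) ((abs_nonneg _).trans (hC i t ht))
      _ = _ := by ring
  induction n generalizing w v f g with
  | zero => exact key hf hg
  | succ n ih =>
    refine ⟨key hf.1 hg.1, fun i => (hf.2.1 i).mul (hg.2.1 i), ?_⟩
    have e : (fun i => _root_.deriv ((f * g) i)) =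
        (fun i => _root_.deriv (f i)) * g + f * fun i => _root_.deriv (g i) := by
      funext i t
      exact deriv_mul (hf.2.1 i t) (hg.2.1 i t)
    rw [e]
    refine add ?_ ?_
    · have := ih hf.2.2 hg.of_succ
      rwa [show w / ℓ * v = w * v / ℓ by rw [div_mul_eq_mul_div]] at this
    · have := ih hf.of_succ hg.2.2
      rwa [show w * (v / ℓ) = w * v / ℓ by rw [mul_div_assoc]] at this

theorem of_param (c : ι → ℝ) (hc : ∃ C, ∀ i t, U i t → |c i| ≤ C * w i t)
    (hw : ∀ i t, U i t → 0 ≤ w i t) (hℓ : ∀ i t, U i t → 0 < ℓ i t) :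
    IsSymbol U ℓ n w (fun i _ => c i) := by
  induction n generalizing w c with
  | zero => exact hc
  | succ n ih =>
    refine ⟨hc, fun i => differentiable_const _, ?_⟩
    have e : (fun i => _root_.deriv fun _ : ℝ => c i) = fun _ _ => 0 := by
      funext i t
      simp
    rw [e]
    have hw' : ∀ i t, U i t → 0 ≤ (w / ℓ) i t :=
      fun i t ht => div_nonneg (hw i t ht) (hℓ i t ht).le
    exact ih (fun _ => 0) ⟨1, fun i t ht => by simpa using hw' i t ht⟩ hw'

/-- Functions of the parameter only. -/
theorem param (c : ι → ℝ) (hw : ∀ i t, U i t → 0 ≤ w i t) (hℓ : ∀ i t, U i t → 0 < ℓ i t)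
    (hc : ∀ i t, U i t → |c i| ≤ w i t) : IsSymbol U ℓ n w (fun i _ => c i) :=
  of_param c ⟨1, fun i t ht => by rw [one_mul]; exact hc i t ht⟩ hw hℓ

theorem const_mul (c : ℝ) (hf : IsSymbol U ℓ n w f) :
    IsSymbol U ℓ n w (fun i t => c * f i t) := by
  have key : ∀ {w f : ι → ℝ → ℝ}, (∃ C, ∀ i t, U i t → |f i t| ≤ C * w i t) →
        ∃ C, ∀ i t, U i t → |c * f i t| ≤ C * w i t := by
    rintro w f ⟨C, hC⟩
    refine ⟨|c| * C, fun i t ht => ?_⟩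
    rw [abs_mul, mul_assoc]
    exact mul_le_mul_of_nonneg_left (hC i t ht) (abs_nonneg c)
  induction n generalizing w f with
  | zero => exact key hf
  | succ n ih =>
    refine ⟨key hf.1, fun i => (hf.2.1 i).const_mul c, ?_⟩
    have e : (fun i => _root_.deriv fun t => c * f i t) =
        fun i t => c * _root_.deriv (f i) t := by
      funext i t
      exact deriv_const_mul c (hf.2.1 i t)
    rw [e]
    exact ih hf.2.2

theorem neg (hf : IsSymbol U ℓ n w f) : IsSymbol U ℓ n w (-f) := by
  have := hf.const_mul (-1)
  simp only [neg_one_mul] at this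
  exact this

theorem sub (hf : IsSymbol U ℓ n w f) (hg : IsSymbol U ℓ n w g) : IsSymbol U ℓ n w (f - g) := by
  rw [sub_eq_add_neg]
  exact hf.add hg.neg

/-- Real powers of positive elliptic symbols. -/
theorem rpow (hf : IsSymbol U ℓ n w f) (hpos : ∀ i t, 0 < f i t) {c : ℝ} (hc : 0 < c)
    (hw : ∀ i t, U i t → 0 < w i t ∧ c * w i t ≤ f i t) (s : ℝ) :
    IsSymbol U ℓ n (fun i t => w i t ^ s) (fun i t => f i t ^ s) := by
  obtain ⟨C, hC⟩ := hf.bound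
  have key : ∀ s : ℝ, ∃ D, ∀ i t, U i t → |f i t ^ s| ≤ D * w i t ^ s := fun s => by
    refine ⟨max (c ^ s) (C ^ s), fun i t ht => ?_⟩
    obtain ⟨h1, h2⟩ := hw i t ht
    have h3 : f i t ≤ C * w i t := (le_abs_self _).trans (hC i t ht)
    have hCpos : 0 < C := by
      by_contra hcon
      nlinarith [hpos i t]
    rw [abs_of_pos (Real.rpow_pos_of_pos (hpos i t) s)]
    rcases le_total 0 s with hs | hs
    · calc f i t ^ s ≤ (C * w i t) ^ s := Real.rpow_le_rpow (hpos i t).le h3 hs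
        _ = C ^ s * w i t ^ s := Real.mul_rpow hCpos.le h1.le
        _ ≤ _ := by gcongr; exact le_max_right _ _
    · calc f i t ^ s ≤ (c * w i t) ^ s := Real.rpow_le_rpow_of_nonpos (by positivity) h2 hs
        _ = c ^ s * w i t ^ s := Real.mul_rpow hc.le h1.le
        _ ≤ _ := by gcongr; exact le_max_left _ _
  induction n generalizing s with
  | zero => exact key s
  | succ n ih =>
    refine ⟨key s, fun i => (hf.2.1 i).rpow_const fun t => Or.inl (hpos i t).ne', ?_⟩
    have e : (fun i => _root_.deriv fun t => f i t ^ s) =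
        fun i t => s * ((fun i t => f i t ^ (s - 1)) * fun i => _root_.deriv (f i)) i t := by
      funext i t
      rw [deriv_rpow_const (hf.2.1 i t) (Or.inl (hpos i t).ne')]
      simp only [Pi.mul_apply]
      ring
    rw [e]
    refine (((ih hf.of_succ (s - 1)).mul hf.2.2).weight_congr fun i t ht => ?_).const_mul s
    have h1 := (hw i t ht).1
    simp only [Pi.mul_apply, Pi.div_apply]
    rw [Real.rpow_sub_one h1.ne']
    field_simp

/-- Reciprocals: only the lower bound and the derivative of `f` matter. -/
theorem inv (hd : ∀ i, Differentiable ℝ (f i)) (hne : ∀ i t, f i t ≠ 0) {c : ℝ} (hc : 0 < c)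
    (hw : ∀ i t, U i t → 0 < w i t ∧ c * w i t ≤ |f i t|)
    (hf' : IsSymbol U ℓ n (w / ℓ) (fun i => _root_.deriv (f i))) :
    IsSymbol U ℓ (n + 1) w⁻¹ (fun i t => (f i t)⁻¹) := by
  have key : ∃ C, ∀ i t, U i t → |(f i t)⁻¹| ≤ C * w⁻¹ i t := by
    refine ⟨c⁻¹, fun i t ht => ?_⟩
    obtain ⟨h1, h2⟩ := hw i t ht
    rw [abs_inv, Pi.inv_apply, Pi.inv_apply, ← mul_inv]
    exact inv_anti₀ (by positivity) h2
  have e : (fun i => _root_.deriv fun t => (f i t)⁻¹) =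
      fun i t => (-1) * (((fun i t => (f i t)⁻¹) * fun i t => (f i t)⁻¹) *
        fun i => _root_.deriv (f i)) i t := by
    funext i t
    have := ((hd i t).hasDerivAt.inv (hne i t)).deriv
    simp only [Pi.mul_apply]
    refine Eq.trans this ?_
    field_simp
  -- Weights match in (1/f)' = -(1/f)² f': w^(-2) · (w/ℓ) is w^(-1)/ℓ. No upper bound for f by w is
  -- involved, which matters when w is only a lower bound for the phase.
  have hstep : ∀ m, IsSymbol U ℓ m w⁻¹ (fun i t => (f i t)⁻¹) →
      IsSymbol U ℓ m (w / ℓ) (fun i => _root_.deriv (f i)) →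
      IsSymbol U ℓ (m + 1) w⁻¹ (fun i t => (f i t)⁻¹) := fun m h1 h2 => by
    refine ⟨key, fun i t => (hd i t).inv (hne i t), ?_⟩
    rw [e]
    refine (((h1.mul h1).mul h2).weight_congr fun i t ht => ?_).const_mul (-1)
    have := (hw i t ht).1
    simp only [Pi.mul_apply, Pi.inv_apply, Pi.div_apply]
    field_simp
  induction n with
  | zero => exact hstep 0 key hf'
  | succ n ih => exact hstep _ (ih hf'.of_succ) hf'

end IsSymbol

/-- Two symbols of the same size `w` whose difference is smaller by the factor `δ`. -/
structure IsSymbolPair (U : ι → ℝ → Prop) (ℓ : ι → ℝ → ℝ) (n : ℕ) (δ w f g : ι → ℝ → ℝ) :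
    Prop where
  left : IsSymbol U ℓ n w f
  right : IsSymbol U ℓ n w g
  diff : IsSymbol U ℓ n (δ * w) (f - g)

namespace IsSymbolPair

variable {f₁ g₁ f₂ g₂ : ι → ℝ → ℝ}

theorem add (h₁ : IsSymbolPair U ℓ n δ w f₁ g₁) (h₂ : IsSymbolPair U ℓ n δ w f₂ g₂) :
    IsSymbolPair U ℓ n δ w (f₁ + f₂) (g₁ + g₂) :=
  ⟨h₁.left.add h₂.left, h₁.right.add h₂.right, by
    rw [add_sub_add_comm]; exact h₁.diff.add h₂.diff⟩

theorem mul (h₁ : IsSymbolPair U ℓ n δ w f₁ g₁) (h₂ : IsSymbolPair U ℓ n δ v f₂ g₂) :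
    IsSymbolPair U ℓ n δ (w * v) (f₁ * f₂) (g₁ * g₂) :=
  ⟨h₁.left.mul h₂.left, h₁.right.mul h₂.right, by
    have e : f₁ * f₂ - g₁ * g₂ = (f₁ - g₁) * f₂ + g₁ * (f₂ - g₂) := by ring
    rw [e]
    refine IsSymbol.add ?_ ?_
    · have := h₁.diff.mul h₂.left
      rwa [mul_assoc] at this
    · have := h₁.right.mul h₂.diff
      rwa [mul_left_comm] at this⟩

theorem weight_congr (h : IsSymbolPair U ℓ n δ w f g) (hw : ∀ i t, U i t → w i t = v i t) :
    IsSymbolPair U ℓ n δ v f g :=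
  ⟨h.left.weight_congr hw, h.right.weight_congr hw, h.diff.weight_congr fun i t ht => by
    simp only [Pi.mul_apply, hw i t ht]⟩

theorem const_mul (c : ℝ) (h : IsSymbolPair U ℓ n δ w f g) :
    IsSymbolPair U ℓ n δ w (fun i t => c * f i t) (fun i t => c * g i t) :=
  ⟨h.left.const_mul c, h.right.const_mul c, by
    have := h.diff.const_mul c
    simp only [Pi.sub_apply, mul_sub] at this
    exact this⟩

theorem of_succ (h : IsSymbolPair U ℓ (n + 1) δ w f g) : IsSymbolPair U ℓ n δ w f g :=
  ⟨h.left.of_succ, h.right.of_succ, h.diff.of_succ⟩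

theorem deriv (h : IsSymbolPair U ℓ (n + 1) δ w f g) :
    IsSymbolPair U ℓ n δ (w / ℓ) (fun i => deriv (f i)) (fun i => deriv (g i)) :=
  ⟨h.left.deriv, h.right.deriv, by
    have e : (fun i => _root_.deriv (f i)) - (fun i => _root_.deriv (g i)) =
        fun i => _root_.deriv ((f - g) i) := by
      funext i t
      exact (deriv_sub (h.left.2.1 i t) (h.right.2.1 i t)).symm
    rw [e, ← mul_div_assoc]
    exact h.diff.deriv⟩

/-- Mean value inequality; x^(s-1) is monotone, so its maximum on [m, M] is attained at one of the
endpoints, according to the sign of s - 1. -/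
theorem abs_rpow_sub_rpow_le {a b m M : ℝ} (hm : 0 < m) (ha : a ∈ Set.Icc m M)
    (hb : b ∈ Set.Icc m M) (s : ℝ) :
    |a ^ s - b ^ s| ≤ |s| * max (m ^ (s - 1)) (M ^ (s - 1)) * |a - b| := by
  refine Convex.norm_image_sub_le_of_norm_hasDerivWithin_le (f := fun x : ℝ => x ^ s)
    (f' := fun x => s * x ^ (s - 1)) (s := Set.Icc m M)
    (fun x hx => (Real.hasDerivAt_rpow_const (Or.inl (hm.trans_le hx.1).ne')).hasDerivWithinAt)
    (fun x hx => ?_) (convex_Icc m M) hb ha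
  have hx0 := hm.trans_le hx.1
  rw [norm_mul, Real.norm_eq_abs, Real.norm_of_nonneg (Real.rpow_nonneg hx0.le _)]
  refine mul_le_mul_of_nonneg_left ?_ (abs_nonneg s)
  rcases le_total 0 (s - 1) with hs | hs
  · exact (Real.rpow_le_rpow hx0.le hx.2 hs).trans (le_max_right _ _)
  · exact (Real.rpow_le_rpow_of_nonpos hm hx.1 hs).trans (le_max_left _ _)

/-- The derivative of f^s - g^s is the difference of the product pair s f^(s-1) f', s g^(s-1) g', so
the factor δ survives differentiation and the induction on n closes. -/
theorem rpow (h : IsSymbolPair U ℓ n δ w f g) (hf : ∀ i t, 0 < f i t) (hg : ∀ i t, 0 < g i t)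
    {c : ℝ} (hc : 0 < c)
    (hw : ∀ i t, U i t → 0 < w i t ∧ c * w i t ≤ f i t ∧ c * w i t ≤ g i t) (s : ℝ) :
    IsSymbolPair U ℓ n δ (fun i t => w i t ^ s) (fun i t => f i t ^ s) (fun i t => g i t ^ s) := by
  have hwf : ∀ i t, U i t → 0 < w i t ∧ c * w i t ≤ f i t := fun i t ht =>
    ⟨(hw i t ht).1, (hw i t ht).2.1⟩
  have hwg : ∀ i t, U i t → 0 < w i t ∧ c * w i t ≤ g i t := fun i t ht =>
    ⟨(hw i t ht).1, (hw i t ht).2.2⟩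
  refine ⟨h.left.rpow hf hc hwf s, h.right.rpow hg hc hwg s, ?_⟩
  obtain ⟨C, hC⟩ := h.left.bound
  obtain ⟨C', hC'⟩ := h.right.bound
  obtain ⟨D, hD⟩ := h.diff.bound
  have key : ∀ s : ℝ, ∃ K, ∀ i t, U i t →
      |((fun i t => f i t ^ s) - fun i t => g i t ^ s) i t| ≤
        K * (δ * fun i t => w i t ^ s) i t := fun s => by
    refine ⟨|s| * max (c ^ (s - 1)) (max C C' ^ (s - 1)) * D, fun i t ht => ?_⟩
    obtain ⟨h0, h1, h2⟩ := hw i t ht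
    have h3 : f i t ≤ max C C' * w i t := ((le_abs_self _).trans (hC i t ht)).trans
      (mul_le_mul_of_nonneg_right (le_max_left _ _) h0.le)
    have h4 : g i t ≤ max C C' * w i t := ((le_abs_self _).trans (hC' i t ht)).trans
      (mul_le_mul_of_nonneg_right (le_max_right _ _) h0.le)
    have hM : 0 < max C C' := by
      by_contra hcon
      nlinarith [hf i t]
    have h5 := hD i t ht
    simp only [Pi.sub_apply, Pi.mul_apply] at h5 ⊢
    refine (abs_rpow_sub_rpow_le (by positivity) ⟨h1, h3⟩ ⟨h2, h4⟩ s).trans ?_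
    rw [Real.mul_rpow hc.le h0.le, Real.mul_rpow hM.le h0.le,
      ← max_mul_of_nonneg _ _ (Real.rpow_nonneg h0.le _)]
    calc _ ≤ |s| * (max (c ^ (s - 1)) (max C C' ^ (s - 1)) * w i t ^ (s - 1)) *
          (D * (δ i t * w i t)) := by gcongr
      _ = _ := by
          rw [Real.rpow_sub_one h0.ne' s]
          field_simp
  induction n generalizing s with
  | zero => exact key s
  | succ n ih =>
    refine ⟨key s, fun i => ?_, ?_⟩
    · exact ((h.left.2.1 i).rpow_const fun t => Or.inl (hf i t).ne').sub
        ((h.right.2.1 i).rpow_const fun t => Or.inl (hg i t).ne')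
    · have hp : IsSymbolPair U ℓ n δ (fun i t => w i t ^ (s - 1)) (fun i t => f i t ^ (s - 1))
          (fun i t => g i t ^ (s - 1)) :=
        ⟨h.left.of_succ.rpow hf hc hwf _, h.right.of_succ.rpow hg hc hwg _,
          ih h.of_succ (s - 1)⟩
      have hq := ((hp.mul h.deriv).const_mul s).diff
      have e : (fun i => _root_.deriv
          (((fun i t => f i t ^ s) - fun i t => g i t ^ s) i)) =
          (fun i t => s * ((fun i t => f i t ^ (s - 1)) * fun i => _root_.deriv (f i)) i t) -
          (fun i t => s * ((fun i t => g i t ^ (s - 1)) * fun i => _root_.deriv (g i)) i t) := by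
        funext i t
        have h1 : HasDerivAt (fun t => f i t ^ s) _ t :=
          (h.left.2.1 i t).hasDerivAt.rpow_const (Or.inl (hf i t).ne')
        have h2 : HasDerivAt (fun t => g i t ^ s) _ t :=
          (h.right.2.1 i t).hasDerivAt.rpow_const (Or.inl (hg i t).ne')
        refine (h1.sub h2).deriv.trans ?_
        simp only [Pi.sub_apply, Pi.mul_apply]
        ring
      rw [e]
      refine hq.weight_congr fun i t ht => ?_
      have h1 := (hw i t ht).1
      simp only [Pi.mul_apply, Pi.div_apply]
      rw [Real.rpow_sub_one h1.ne']
      field_simp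

end IsSymbolPair

/-- A twice differentiable family of size `w` whose first two derivatives gain an extra factor
`κ`. -/
structure IsGainSymbol (U : ι → ℝ → Prop) (ℓ : ι → ℝ → ℝ) (κ w f : ι → ℝ → ℝ) : Prop where
  symbol : IsSymbol U ℓ 2 w f
  gain : IsSymbol U ℓ 1 (κ * w / ℓ) (fun i => deriv (f i))

namespace IsGainSymbol

variable {κ : ι → ℝ → ℝ}

theorem mul (hf : IsGainSymbol U ℓ κ w f) (hg : IsGainSymbol U ℓ κ v g) :
    IsGainSymbol U ℓ κ (w * v) (f * g) := by
  refine ⟨hf.symbol.mul hg.symbol, ?_⟩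
  have e : (fun i => _root_.deriv ((f * g) i)) =
      (fun i => _root_.deriv (f i)) * g + f * fun i => _root_.deriv (g i) := by
    funext i t
    exact deriv_mul (hf.symbol.2.1 i t) (hg.symbol.2.1 i t)
  rw [e]
  refine IsSymbol.add ?_ ?_
  · have := hf.gain.mul hg.symbol.of_succ
    rwa [show κ * w / ℓ * v = κ * (w * v) / ℓ by rw [div_mul_eq_mul_div, mul_assoc]] at this
  · have := hf.symbol.of_succ.mul hg.gain
    rwa [show w * (κ * v / ℓ) = κ * (w * v) / ℓ by rw [← mul_div_assoc, mul_left_comm]] at this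

theorem rpow (hf : IsGainSymbol U ℓ κ w f) (hpos : ∀ i t, 0 < f i t) {c : ℝ} (hc : 0 < c)
    (hw : ∀ i t, U i t → 0 < w i t ∧ c * w i t ≤ f i t) (s : ℝ) :
    IsGainSymbol U ℓ κ (fun i t => w i t ^ s) (fun i t => f i t ^ s) := by
  refine ⟨hf.symbol.rpow hpos hc hw s, ?_⟩
  have e : (fun i => _root_.deriv fun t => f i t ^ s) =
      fun i t => s * ((fun i t => f i t ^ (s - 1)) * fun i => _root_.deriv (f i)) i t := by
    funext i t
    rw [deriv_rpow_const (hf.symbol.2.1 i t) (Or.inl (hpos i t).ne')]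
    simp only [Pi.mul_apply]
    ring
  rw [e]
  refine (((hf.symbol.of_succ.rpow hpos hc hw (s - 1)).mul hf.gain).weight_congr
    fun i t ht => ?_).const_mul s
  have h1 := (hw i t ht).1
  simp only [Pi.mul_apply, Pi.div_apply]
  rw [Real.rpow_sub_one h1.ne']
  field_simp

/-- The derivative of 1/f contains f' exactly once, which is where the factor κ enters. -/
theorem inv (hf : IsGainSymbol U ℓ κ w f) (hne : ∀ i t, f i t ≠ 0) {c : ℝ} (hc : 0 < c)
    (hw : ∀ i t, U i t → 0 < w i t ∧ c * w i t ≤ |f i t|) :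
    IsGainSymbol U ℓ κ w⁻¹ (fun i t => (f i t)⁻¹) := by
  have h := IsSymbol.inv (hf.symbol.2.1) hne hc hw hf.symbol.deriv
  refine ⟨h, ?_⟩
  have e : (fun i => _root_.deriv fun t => (f i t)⁻¹) =
      fun i t => (-1) * (((fun i t => (f i t)⁻¹) * fun i t => (f i t)⁻¹) *
        fun i => _root_.deriv (f i)) i t := by
    funext i t
    have := ((hf.symbol.2.1 i t).hasDerivAt.inv (hne i t)).deriv
    simp only [Pi.mul_apply]
    refine Eq.trans this ?_
    field_simp
  rw [e]
  refine (((h.of_succ.mul h.of_succ).mul hf.gain).weight_congr fun i t ht => ?_).const_mul (-1)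
  have := (hw i t ht).1
  simp only [Pi.mul_apply, Pi.inv_apply, Pi.div_apply]
  field_simp

end IsGainSymbol

end SymbolCalculus

/-! ### The dispersion relation and the lower bound for the phase. -/

/-- The dispersion relation as a function of the radius. -/
def radialDisp (σ r : ℝ) : ℝ := Real.sqrt (r ^ 2 + r ^ (2 - σ))

/-- The size `r^(2-σ) / p(r)` of the phase when the smallest frequency is `r`. -/
def phaseSize (σ r : ℝ) : ℝ := r ^ (2 - σ) / radialDisp σ r

theorem disp_eq (σ : ℝ) (x : R3) : disp σ x = radialDisp σ ‖x‖ := rfl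

section Radial

variable {σ r : ℝ}

theorem radialDisp_pos (hr : 0 < r) : 0 < radialDisp σ r := Real.sqrt_pos.2 (by positivity)

theorem radialDisp_nonneg : 0 ≤ radialDisp σ r := Real.sqrt_nonneg _

theorem radialDisp_sq (hr : 0 < r) : radialDisp σ r ^ 2 = r ^ (2 - σ) * (1 + r ^ σ) := by
  rw [radialDisp, Real.sq_sqrt (by positivity), mul_add, ← Real.rpow_add hr, sub_add_cancel]
  norm_num
  ring

theorem radialDisp_mono (hσ : σ < 2) {s : ℝ} (hr : 0 ≤ r) (h : r ≤ s) :
    radialDisp σ r ≤ radialDisp σ s := by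
  refine Real.sqrt_le_sqrt (add_le_add (by gcongr) ?_)
  exact Real.rpow_le_rpow hr h (by linarith)

theorem radialDisp_eq_mul (hr : 0 < r) : radialDisp σ r = r * Real.sqrt (1 + r ^ (-σ)) := by
  rw [radialDisp]
  have e : r ^ 2 + r ^ (2 - σ) = r ^ 2 * (1 + r ^ (-σ)) := by
    rw [mul_add, sub_eq_add_neg, Real.rpow_add hr]
    norm_num
  rw [e, Real.sqrt_mul (by positivity), Real.sqrt_sq hr.le]

theorem radialDisp_eq_rpow (hr : 0 < r) :
    radialDisp σ r = r ^ ((2 - σ) / 2) * Real.sqrt (1 + r ^ σ) := by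
  rw [← Real.sqrt_sq (radialDisp_nonneg (σ := σ) (r := r)), radialDisp_sq hr,
    Real.sqrt_mul (by positivity), Real.sqrt_eq_rpow (r ^ (2 - σ)), ← Real.rpow_mul hr.le]
  congr 2
  ring

/-- Here p(r)/r = sqrt(1 + r^(-σ)). Besides subadditivity, this compares the gradients of p, of size
p(r)/r, at different frequencies. -/
theorem radialDisp_div_anti (hσ : 0 < σ) {s : ℝ} (hr : 0 < r) (h : r ≤ s) :
    radialDisp σ s / s ≤ radialDisp σ r / r := by
  have hs := hr.trans_le h
  rw [radialDisp_eq_mul hr, radialDisp_eq_mul hs, mul_div_cancel_left₀ _ hr.ne',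
    mul_div_cancel_left₀ _ hs.ne']
  refine Real.sqrt_le_sqrt (add_le_add le_rfl ?_)
  exact Real.rpow_le_rpow_of_nonpos hr h (by linarith)

theorem phaseSize_pos (hr : 0 < r) : 0 < phaseSize σ r :=
  div_pos (by positivity) (radialDisp_pos hr)

theorem phaseSize_mul (hr : 0 < r) : phaseSize σ r * (1 + r ^ σ) = radialDisp σ r := by
  have h := radialDisp_pos (σ := σ) hr
  rw [phaseSize, div_mul_eq_mul_div, div_eq_iff h.ne', ← radialDisp_sq hr, sq]

theorem phaseSize_le (hr : 0 < r) : phaseSize σ r ≤ radialDisp σ r := by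
  rw [← phaseSize_mul hr]
  exact le_mul_of_one_le_right (phaseSize_pos hr).le (by linarith [Real.rpow_pos_of_pos hr σ])

/-- The power (2-σ)/2 in the numerator of the kernel is what compensates a small phase: the quotient
stays bounded for small frequencies and grows like r^(σ/2) for large ones. -/
theorem rpow_div_phaseSize (hr : 0 < r) :
    r ^ ((2 - σ) / 2) / phaseSize σ r = Real.sqrt (1 + r ^ σ) := by
  have h := radialDisp_pos (σ := σ) hr
  have e : r ^ (2 - σ) = r ^ ((2 - σ) / 2) * r ^ ((2 - σ) / 2) := by
    rw [← Real.rpow_add hr]; ring_nf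
  rw [phaseSize, radialDisp_eq_rpow hr, e]
  have := Real.rpow_pos_of_pos hr ((2 - σ) / 2)
  field_simp

/-- The constant of the quantitative strict subadditivity of the dispersion relation. -/
def subaddConst (σ : ℝ) : ℝ := (1 - 2 ^ (-σ)) / 2

theorem subaddConst_pos (hσ : 0 < σ) : 0 < subaddConst σ := by
  have := Real.rpow_lt_one_of_one_lt_of_neg (by norm_num : (1 : ℝ) < 2) (by linarith : -σ < 0)
  rw [subaddConst]
  linarith

theorem subaddConst_le_one : subaddConst σ ≤ 1 := by
  have := Real.rpow_pos_of_pos (by norm_num : (0 : ℝ) < 2) (-σ)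
  rw [subaddConst]
  linarith

/-- Write p(r) = r q(r) with q decreasing. The deficit p(z) + p(v) - p(z+v) is at least z (q(z) -
q(z+v)), hence at least z (q(z) - q(2z)). Since q(z)² - q(2z)² = z^(-σ) (1 - 2^(-σ)), division by 2
q(z) gives the constant. -/
theorem radialDisp_add_le (hσ : 0 < σ) {z v : ℝ} (hz : 0 < z) (hzv : z ≤ v) :
    radialDisp σ (z + v) ≤ radialDisp σ z + radialDisp σ v - subaddConst σ * phaseSize σ z := by
  have hv := hz.trans_le hzv
  set q : ℝ → ℝ := fun r => Real.sqrt (1 + r ^ (-σ)) with hq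
  have hqanti : ∀ r s, 0 < r → r ≤ s → q s ≤ q r := fun r s hr hrs =>
    Real.sqrt_le_sqrt (add_le_add le_rfl (Real.rpow_le_rpow_of_nonpos hr hrs (by linarith)))
  have hqpos : ∀ r, 0 < r → 0 < q r := fun r hr => Real.sqrt_pos.2 (by positivity)
  have hP : ∀ r, 0 < r → radialDisp σ r = r * q r := fun r hr => radialDisp_eq_mul hr
  have hsq : ∀ r, 0 < r → q r ^ 2 = 1 + r ^ (-σ) := fun r hr => Real.sq_sqrt (by positivity)
  have hG : phaseSize σ z = z * z ^ (-σ) / q z := by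
    rw [phaseSize, hP z hz, sub_eq_add_neg, Real.rpow_add hz]
    norm_num
    field_simp
  have hgap : z ^ (-σ) * (1 - 2 ^ (-σ)) ≤ 2 * q z * (q z - q (2 * z)) := by
    have h1 : z ^ (-σ) * (1 - 2 ^ (-σ)) = q z ^ 2 - q (2 * z) ^ 2 := by
      rw [hsq z hz, hsq _ (by positivity), Real.mul_rpow (by norm_num) hz.le]; ring
    have h2 := hqanti z (2 * z) hz (by linarith)
    rw [h1]
    nlinarith [hqpos z hz, hqpos (2 * z) (by positivity)]
  have hc : subaddConst σ * phaseSize σ z ≤ z * (q z - q (2 * z)) := by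
    rw [hG, subaddConst, mul_div_assoc', div_le_iff₀ (hqpos z hz)]
    nlinarith
  rw [hP z hz, hP v hv, hP _ (add_pos hz hv)]
  have h3 := hqanti (2 * z) (z + v) (by positivity) (by linarith)
  have h4 := hqanti v (z + v) hv (by linarith)
  nlinarith

/-- Two equal signs in front of the two larger frequencies. -/
theorem radialDisp_le_abs_of_eq (hσ : σ < 2) {z u v s₀ s₁ : ℝ} (hz : 0 < z)
    (hzv : z ≤ v) (h₀ : |s₀| = 1) (h₁ : |s₁| = 1) :
    radialDisp σ u ≤ |s₀ * radialDisp σ z + s₁ * radialDisp σ u + s₁ * radialDisp σ v| := by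
  have h1 := radialDisp_mono hσ hz.le hzv
  have h2 := radialDisp_nonneg (σ := σ) (r := u)
  have h3 := radialDisp_nonneg (σ := σ) (r := v)
  have h4 := radialDisp_nonneg (σ := σ) (r := z)
  rcases (abs_eq one_pos.le).1 h₀ with rfl | rfl <;> rcases (abs_eq one_pos.le).1 h₁ with rfl | rfl
  · exact le_trans (by linarith) (le_abs_self _)
  · exact le_trans (by linarith) (neg_le_abs _)
  · exact le_trans (by linarith) (le_abs_self _)
  · exact le_trans (by linarith) (neg_le_abs _)

/-- The phase is bounded below by the size determined by the smallest frequency. -/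
theorem phaseSize_le_abs (hσ : 0 < σ) (hσ2 : σ < 2) {z u v s₀ s₁ s₂ : ℝ} (hz : 0 < z) (hzu : z ≤ u)
    (hzv : z ≤ v) (huv : u ≤ z + v) (hvu : v ≤ z + u) (h₀ : |s₀| = 1) (h₁ : |s₁| = 1)
    (h₂ : |s₂| = 1) : subaddConst σ * phaseSize σ z ≤
      |s₀ * radialDisp σ z + s₁ * radialDisp σ u + s₂ * radialDisp σ v| := by
  have hu := hz.trans_le hzu
  have hv := hz.trans_le hzv
  have hcg : subaddConst σ * phaseSize σ z ≤ radialDisp σ u :=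
    (mul_le_of_le_one_left (phaseSize_pos hz).le subaddConst_le_one).trans
      ((phaseSize_le hz).trans (radialDisp_mono hσ2 hz.le hzu))
  have h1 := radialDisp_add_le hσ hz hzv
  have h2 := radialDisp_add_le hσ hz hzu
  have h3 := radialDisp_mono hσ2 hu.le huv
  have h4 := radialDisp_mono hσ2 hv.le hvu
  -- With equal signs nothing cancels between the larger frequencies. With opposite signs, up to a
  -- global sign the phase is p(z) plus or minus p(u) - p(v); the triangle inequalities and strict
  -- subadditivity bound |p(u) - p(v)| by p(z) minus the deficit.
  rcases eq_or_ne s₁ s₂ with rfl | hne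
  · exact hcg.trans (radialDisp_le_abs_of_eq hσ2 hz hzv h₀ h₁)
  · rcases (abs_eq one_pos.le).1 h₀ with rfl | rfl <;>
      rcases (abs_eq one_pos.le).1 h₁ with rfl | rfl <;>
      rcases (abs_eq one_pos.le).1 h₂ with rfl | rfl
    · exact absurd rfl hne
    · exact le_trans (by linarith) (le_abs_self _)
    · exact le_trans (by linarith) (le_abs_self _)
    · exact absurd rfl hne
    · exact absurd rfl hne
    · exact le_trans (by linarith) (neg_le_abs _)
    · exact le_trans (by linarith) (neg_le_abs _)
    · exact absurd rfl hne

end Radial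

/-! ### Symbol bounds for the dispersion relation, powers and brackets. -/

section SymbolDisp

variable {ι : Type*} {U : ι → ℝ → Prop} {ℓ w δ f g : ι → ℝ → ℝ} {n : ℕ}

/-- The calculus starts from squared lengths, which are polynomials along a line, so p is rewritten
as a composition of powers of r². -/
theorem sqrt_sq_add_rpow_eq (σ : ℝ) {r : ℝ} (hr : 0 < r) :
    (r ^ 2 + (r ^ 2) ^ ((2 - σ) / 2)) ^ (1 / 2 : ℝ) = radialDisp σ r := by
  rw [radialDisp, Real.sqrt_eq_rpow, ← Real.rpow_natCast r 2, ← Real.rpow_mul hr.le]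
  congr 3
  push_cast
  ring

theorem mul_add_rpow_le {b c x y : ℝ} (hb : 0 ≤ b) (hc : 0 < c) (hx : 0 < x) (h : c * x ≤ y) :
    min c (c ^ b) * (x + x ^ b) ≤ y + y ^ b := by
  rw [mul_add]
  refine add_le_add ((mul_le_mul_of_nonneg_right (min_le_left _ _) hx.le).trans h) ?_
  refine (mul_le_mul_of_nonneg_right (min_le_right _ _) (by positivity)).trans ?_
  rw [← Real.mul_rpow hc.le hx.le]
  exact Real.rpow_le_rpow (by positivity) h hb

/-- The dispersion relation of a vector whose squared length is an elliptic symbol. -/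
theorem IsSymbol.radialDisp {σ : ℝ} (hσ : σ < 2)
    (h : IsSymbol U ℓ n (fun i t => w i t ^ 2) fun i t => f i t ^ 2)
    (hℓ : ∀ i t, U i t → 0 < ℓ i t) (hf : ∀ i t, 0 < f i t) {c : ℝ} (hc : 0 < c)
    (hw : ∀ i t, U i t → 0 < w i t ∧ c * w i t ^ 2 ≤ f i t ^ 2) :
    IsSymbol U ℓ n (fun i t => radialDisp σ (w i t)) (fun i t => radialDisp σ (f i t)) := by
  have hf2 : ∀ i t, 0 < f i t ^ 2 := fun i t => pow_pos (hf i t) 2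
  have hw2 : ∀ i t, U i t → 0 < w i t ^ 2 ∧ c * w i t ^ 2 ≤ f i t ^ 2 := fun i t ht =>
    ⟨pow_pos (hw i t ht).1 2, (hw i t ht).2⟩
  set b := (2 - σ) / 2 with hb
  have h1 := h.rpow hf2 hc hw2 b
  set W : ι → ℝ → ℝ := fun i t => w i t ^ 2 + (w i t ^ 2) ^ b with hW
  have h2 : IsSymbol U ℓ n W ((fun i t => f i t ^ 2) + fun i t => (f i t ^ 2) ^ b) := by
    refine IsSymbol.add (h.weight hℓ 1 fun i t ht => ?_) (h1.weight hℓ 1 fun i t ht => ?_)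
    all_goals
      have h3 := (hw2 i t ht).1
      have h4 := Real.rpow_pos_of_pos h3 b
      constructor
      · positivity
      · simp only [hW]; linarith
  have h3 := h2.rpow (c := min c (c ^ b)) (fun i t => add_pos (hf2 i t)
    (Real.rpow_pos_of_pos (hf2 i t) b)) (lt_min hc (by positivity)) (fun i t ht =>
      ⟨add_pos (hw2 i t ht).1 (Real.rpow_pos_of_pos (hw2 i t ht).1 b),
        mul_add_rpow_le (by linarith) hc (hw2 i t ht).1 (hw2 i t ht).2⟩) (1 / 2)
  have e : (fun i t => EulerRiesz.radialDisp σ (f i t)) = fun i t =>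
      (((fun i t => f i t ^ 2) + fun i t => (f i t ^ 2) ^ b : ι → ℝ → ℝ) i t) ^ (1 / 2 : ℝ) := by
    funext i t
    exact (sqrt_sq_add_rpow_eq σ (hf i t)).symm
  rw [e]
  exact h3.weight_congr fun i t ht => sqrt_sq_add_rpow_eq σ (hw i t ht).1

theorem IsSymbolPair.radialDisp {σ : ℝ} (hσ : σ < 2)
    (h : IsSymbolPair U ℓ n δ (fun i t => w i t ^ 2) (fun i t => f i t ^ 2) fun i t => g i t ^ 2)
    (hℓ : ∀ i t, U i t → 0 < ℓ i t) (hδ : ∀ i t, U i t → 0 ≤ δ i t)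
    (hf : ∀ i t, 0 < f i t) (hg : ∀ i t, 0 < g i t) {c : ℝ} (hc : 0 < c)
    (hw : ∀ i t, U i t → 0 < w i t ∧ c * w i t ^ 2 ≤ f i t ^ 2 ∧ c * w i t ^ 2 ≤ g i t ^ 2) :
    IsSymbolPair U ℓ n δ (fun i t => radialDisp σ (w i t)) (fun i t => radialDisp σ (f i t))
      (fun i t => radialDisp σ (g i t)) := by
  have hf2 : ∀ i t, 0 < f i t ^ 2 := fun i t => pow_pos (hf i t) 2
  have hg2 : ∀ i t, 0 < g i t ^ 2 := fun i t => pow_pos (hg i t) 2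
  have hw2 : ∀ i t, U i t → 0 < w i t ^ 2 ∧ c * w i t ^ 2 ≤ f i t ^ 2 ∧ c * w i t ^ 2 ≤ g i t ^ 2 :=
    fun i t ht => ⟨pow_pos (hw i t ht).1 2, (hw i t ht).2⟩
  set b := (2 - σ) / 2 with hb
  have h1 := h.rpow hf2 hg2 hc hw2 b
  set W : ι → ℝ → ℝ := fun i t => w i t ^ 2 + (w i t ^ 2) ^ b with hW
  have hpair : ∀ {v f g : ι → ℝ → ℝ}, (∀ i t, U i t → 0 ≤ v i t ∧ v i t ≤ 1 * W i t) →
      IsSymbolPair U ℓ n δ v f g → IsSymbolPair U ℓ n δ W f g := fun hv hp =>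
    ⟨hp.left.weight hℓ 1 hv, hp.right.weight hℓ 1 hv, hp.diff.weight hℓ 1 fun i t ht =>
      ⟨mul_nonneg (hδ i t ht) (hv i t ht).1, by
        have := mul_le_mul_of_nonneg_left (hv i t ht).2 (hδ i t ht)
        simpa using this⟩⟩
  have h2 : IsSymbolPair U ℓ n δ W ((fun i t => f i t ^ 2) + fun i t => (f i t ^ 2) ^ b)
      ((fun i t => g i t ^ 2) + fun i t => (g i t ^ 2) ^ b) := by
    refine IsSymbolPair.add (hpair (fun i t ht => ?_) h) (hpair (fun i t ht => ?_) h1)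
    all_goals
      have h3 := (hw2 i t ht).1
      have h4 := Real.rpow_pos_of_pos h3 b
      constructor
      · positivity
      · simp only [hW]; linarith
  have h3 := h2.rpow (c := min c (c ^ b))
    (fun i t => add_pos (hf2 i t) (Real.rpow_pos_of_pos (hf2 i t) b))
    (fun i t => add_pos (hg2 i t) (Real.rpow_pos_of_pos (hg2 i t) b)) (lt_min hc (by positivity))
    (fun i t ht => ⟨add_pos (hw2 i t ht).1 (Real.rpow_pos_of_pos (hw2 i t ht).1 b),
        mul_add_rpow_le (by linarith) hc (hw2 i t ht).1 (hw2 i t ht).2.1,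
        mul_add_rpow_le (by linarith) hc (hw2 i t ht).1 (hw2 i t ht).2.2⟩) (1 / 2)
  have e : ∀ f : ι → ℝ → ℝ, (∀ i t, 0 < f i t) →
      (fun i t => EulerRiesz.radialDisp σ (f i t)) = fun i t =>
      (((fun i t => f i t ^ 2) + fun i t => (f i t ^ 2) ^ b : ι → ℝ → ℝ) i t) ^ (1 / 2 : ℝ) :=
    fun f hf => by
      funext i t
      exact (sqrt_sq_add_rpow_eq σ (hf i t)).symm
  rw [e f hf, e g hg]
  exact h3.weight_congr fun i t ht => sqrt_sq_add_rpow_eq σ (hw i t ht).1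

/-- Real powers of the length of a vector whose squared length is an elliptic symbol. -/
theorem IsSymbol.norm_rpow (h : IsSymbol U ℓ n (fun i t => w i t ^ 2) fun i t => f i t ^ 2)
    (hf : ∀ i t, 0 < f i t) {c : ℝ} (hc : 0 < c)
    (hw : ∀ i t, U i t → 0 < w i t ∧ c * w i t ^ 2 ≤ f i t ^ 2) (s : ℝ) :
    IsSymbol U ℓ n (fun i t => w i t ^ s) (fun i t => f i t ^ s) := by
  have h1 := h.rpow (fun i t => pow_pos (hf i t) 2) hc (fun i t ht =>
    ⟨pow_pos (hw i t ht).1 2, (hw i t ht).2⟩) (s / 2)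
  have e : ∀ r : ℝ, 0 < r → (r ^ 2) ^ (s / 2) = r ^ s := fun r hr => by
    rw [← Real.rpow_natCast r 2, ← Real.rpow_mul hr.le]
    congr 1
    push_cast
    ring
  have e' : (fun i t => f i t ^ s) = fun i t => (f i t ^ 2) ^ (s / 2) := by
    funext i t
    exact (e _ (hf i t)).symm
  rw [e']
  exact h1.weight_congr fun i t ht => e _ (hw i t ht).1

/-- Real powers of the bracket of a vector whose squared length is an elliptic symbol. -/
theorem IsSymbol.bracket_rpow (h : IsSymbol U ℓ n (fun i t => w i t ^ 2) fun i t => f i t ^ 2)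
    (hℓ : ∀ i t, U i t → 0 < ℓ i t)
    {c : ℝ} (hc : 0 < c) (hw : ∀ i t, U i t → c * w i t ^ 2 ≤ f i t ^ 2) (s : ℝ) :
    IsSymbol U ℓ n (fun i t => (1 + w i t ^ 2) ^ s) (fun i t => (1 + f i t ^ 2) ^ s) := by
  have h1 : IsSymbol U ℓ n (fun i t => 1 + w i t ^ 2) ((fun _ _ => 1) + fun i t => f i t ^ 2) :=
    IsSymbol.add (IsSymbol.param _ (fun i t _ => by positivity) hℓ
      fun i t _ => by rw [abs_one]; nlinarith [sq_nonneg (w i t)])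
      (h.weight hℓ 1 fun i t _ => ⟨by positivity, by linarith⟩)
  refine h1.rpow (c := min 1 c) (fun i t => ?_) (lt_min one_pos hc) (fun i t ht => ⟨by positivity,
    ?_⟩) s
  · change 0 < 1 + f i t ^ 2
    positivity
  · change _ ≤ 1 + f i t ^ 2
    nlinarith [min_le_left 1 c, min_le_right 1 c, hw i t ht, sq_nonneg (w i t)]

end SymbolDisp

/-! ### Test lines and the regions determined by the smallest frequency. -/

/-- A line in direction `e` avoiding the points `0` and `F ≠ 0`. -/
structure TestLine where
  F : R3
  x : R3
  e : R3
  F_ne : F ≠ 0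
  norm_e : ‖e‖ = 1
  avoid_zero : ∀ t : ℝ, x + t • e ≠ 0
  avoid_F : ∀ t : ℝ, x - F + t • e ≠ 0

namespace TestLine

/-- The length of the fixed frequency. -/
def rF (L : TestLine) (_ : ℝ) : ℝ := ‖L.F‖

/-- The length of the moving frequency. -/
def rx (L : TestLine) (t : ℝ) : ℝ := ‖L.x + t • L.e‖

/-- The length of the difference of the moving and the fixed frequency. -/
def ry (L : TestLine) (t : ℝ) : ℝ := ‖L.x - L.F + t • L.e‖

theorem rF_pos (L : TestLine) (t : ℝ) : 0 < L.rF t := norm_pos_iff.2 L.F_ne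

theorem rx_pos (L : TestLine) (t : ℝ) : 0 < L.rx t := norm_pos_iff.2 (L.avoid_zero t)

theorem ry_pos (L : TestLine) (t : ℝ) : 0 < L.ry t := norm_pos_iff.2 (L.avoid_F t)

theorem rx_le (L : TestLine) (t : ℝ) : L.rx t ≤ L.rF t + L.ry t := by
  have h := norm_add_le L.F (L.x - L.F + t • L.e)
  rwa [show L.F + (L.x - L.F + t • L.e) = L.x + t • L.e by abel] at h

theorem ry_le (L : TestLine) (t : ℝ) : L.ry t ≤ L.rF t + L.rx t := by
  have h := norm_sub_le (L.x + t • L.e) L.F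
  rw [show L.x + t • L.e - L.F = L.x - L.F + t • L.e by abel] at h
  simpa [ry, rF, rx, add_comm] using h

theorem rF_le (L : TestLine) (t : ℝ) : L.rF t ≤ L.rx t + L.ry t := by
  have h := norm_sub_le (L.x + t • L.e) (L.x - L.F + t • L.e)
  rwa [show L.x + t • L.e - (L.x - L.F + t • L.e) = L.F by abel] at h

/-- The region where the fixed frequency is the smallest one. -/
def RegionF (L : TestLine) (t : ℝ) : Prop := L.rF t ≤ L.rx t ∧ L.rF t ≤ L.ry t

/-- The region where the moving frequency is the smallest one. -/
def RegionX (L : TestLine) (t : ℝ) : Prop := L.rx t ≤ L.rF t ∧ L.rx t ≤ L.ry t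

variable {U : TestLine → ℝ → Prop} {n : ℕ}

/-- The function is affine in t: its derivative is the constant ⟨e, u⟩ and all later ones vanish, so
two bounds settle every order. -/
theorem isSymbol_inner {ℓ w : TestLine → ℝ → ℝ} (z u : TestLine → R3) {C : ℝ}
    (hw : ∀ L t, U L t → |inner ℝ (z L + t • L.e) (u L)| ≤ C * w L t)
    (hw0 : ∀ L t, U L t → 0 ≤ w L t)
    (hℓ : ∀ L t, U L t → 0 < ℓ L t) (hu : ∀ L t, U L t → ‖u L‖ ≤ C * (w L t / ℓ L t)) :
    IsSymbol U ℓ n w (fun L t => inner ℝ (z L + t • L.e) (u L)) := by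
  cases n with
  | zero => exact ⟨C, hw⟩
  | succ n =>
    have hd : ∀ L t, HasDerivAt (fun t : ℝ => inner ℝ (z L + t • TestLine.e L) (u L))
        (inner ℝ L.e (u L)) t := fun L t => by
      have h1 : HasDerivAt (fun t : ℝ => z L + t • L.e) L.e t := by
        simpa using ((hasDerivAt_id t).smul_const L.e).const_add (z L)
      simpa using h1.inner ℝ (hasDerivAt_const t (u L))
    refine ⟨⟨C, hw⟩, fun L t => (hd L t).differentiableAt, ?_⟩
    have e : (fun L => deriv fun t : ℝ => inner ℝ (z L + t • TestLine.e L) (u L)) =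
        fun (L : TestLine) (_ : ℝ) => inner ℝ L.e (u L) := by
      funext L t
      exact (hd L t).deriv
    rw [e]
    refine IsSymbol.of_param _ ⟨C, fun L t ht => ?_⟩
      (fun L t ht => div_nonneg (hw0 L t ht) (hℓ L t ht).le) hℓ
    refine (abs_real_inner_le_norm _ _).trans ?_
    rw [L.norm_e, one_mul]
    exact hu L t ht

theorem isSymbol_norm_sq (z : TestLine → R3) (hz : ∀ (L : TestLine) (t : ℝ), z L + t • L.e ≠ 0) :
    IsSymbol U (fun L t => ‖z L + t • L.e‖) n (fun L t => ‖z L + t • L.e‖ ^ 2)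
      (fun L t => ‖z L + t • L.e‖ ^ 2) := by
  have hb : ∃ C : ℝ, ∀ (L : TestLine) t, U L t →
      |‖z L + t • L.e‖ ^ 2| ≤ C * ‖z L + t • L.e‖ ^ 2 :=
    ⟨1, fun L t _ => by rw [abs_of_nonneg (by positivity), one_mul]⟩
  have hpos : ∀ (L : TestLine) (t : ℝ), 0 < ‖z L + t • L.e‖ := fun L t => norm_pos_iff.2 (hz L t)
  cases n with
  | zero => exact hb
  | succ n =>
    have hd : ∀ L t, HasDerivAt (fun t : ℝ => ‖z L + t • TestLine.e L‖ ^ 2)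
        (2 * inner ℝ (z L + t • L.e) L.e) t := fun L t => by
      have h1 : HasDerivAt (fun t : ℝ => z L + t • L.e) L.e t := by
        simpa using ((hasDerivAt_id t).smul_const L.e).const_add (z L)
      exact h1.norm_sq
    refine ⟨hb, fun L t => (hd L t).differentiableAt, ?_⟩
    have e : (fun L => deriv fun t : ℝ => ‖z L + t • TestLine.e L‖ ^ 2) =
        fun (L : TestLine) (t : ℝ) => 2 * inner ℝ (z L + t • L.e) L.e := by
      funext L t
      exact (hd L t).deriv
    rw [e]
    refine (isSymbol_inner z TestLine.e (C := 1) (fun L t _ => ?_) (fun L t _ => ?_)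
      (fun L t _ => hpos L t) (fun L t _ => ?_)).const_mul 2
    all_goals simp only [Pi.div_apply]
    · refine (abs_real_inner_le_norm _ _).trans (le_of_eq ?_)
      rw [L.norm_e]
      have := hpos L t
      field_simp
    · positivity
    · rw [L.norm_e]
      have := hpos L t
      field_simp
      rfl

theorem isSymbol_rx_sq : IsSymbol U rx n (fun L t => L.rx t ^ 2) (fun L t => L.rx t ^ 2) :=
  isSymbol_norm_sq TestLine.x avoid_zero

theorem isSymbol_ry_sq : IsSymbol U ry n (fun L t => L.ry t ^ 2) (fun L t => L.ry t ^ 2) :=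
  isSymbol_norm_sq (fun L => L.x - L.F) avoid_F

theorem isSymbol_two_mul_inner :
    IsSymbol U rx n (fun L t => L.rF t * L.rx t)
      (fun L t => 2 * inner ℝ (L.x + t • L.e) L.F) := by
  refine (isSymbol_inner TestLine.x TestLine.F (C := 1) (fun L t _ => ?_) (fun L t _ => ?_)
    (fun L t _ => L.rx_pos t) (fun L t _ => ?_)).const_mul 2
  · refine (abs_real_inner_le_norm _ _).trans (le_of_eq ?_)
    rw [one_mul, mul_comm]
    rfl
  · exact (mul_pos (L.rF_pos t) (L.rx_pos t)).le
  · have := L.rx_pos t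
    rw [mul_div_assoc, div_self this.ne', mul_one, one_mul]
    rfl

/-- The quadratic terms in t cancel. This is the source of every gain from opposite signs: the
difference of the squared lengths has size |F| |x| when |F| ≤ |x|, and the same size when |x| ≤ |F|.
-/
theorem rx_sq_sub_ry_sq (L : TestLine) (t : ℝ) :
    L.rx t ^ 2 - L.ry t ^ 2 = 2 * inner ℝ (L.x + t • L.e) L.F - L.rF t ^ 2 := by
  have h := norm_sub_sq_real (L.x + t • L.e) L.F
  rw [show L.x + t • L.e - L.F = L.x - L.F + t • L.e by abel] at h
  simp only [rx, ry, rF]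
  linarith

section RegionF

theorem RegionF.ry_le {L : TestLine} {t : ℝ} (h : RegionF L t) : L.ry t ≤ 2 * L.rx t := by
  linarith [L.ry_le t, h.1]

theorem RegionF.rx_le {L : TestLine} {t : ℝ} (h : RegionF L t) : L.rx t ≤ 2 * L.ry t := by
  linarith [L.rx_le t, h.2]

theorem regionF_isSymbol_ry_sq :
    IsSymbol RegionF rx n (fun L t => L.rx t ^ 2) (fun L t => L.ry t ^ 2) :=
  isSymbol_ry_sq.mono (fun L t _ => L.rx_pos t) 4 2
    (fun L t h => ⟨by positivity, by nlinarith [h.ry_le, L.ry_pos t]⟩)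
    fun L t h => ⟨h.rx_le, L.ry_pos t⟩

/-- Here |x| and |x - F| are comparable, and the affine difference is smaller than |x|² by the
factor |F|/|x|. -/
theorem regionF_isSymbolPair_sq :
    IsSymbolPair RegionF rx n (rF / rx) (fun L t => L.rx t ^ 2) (fun L t => L.rx t ^ 2)
      (fun L t => L.ry t ^ 2) := by
  refine ⟨isSymbol_rx_sq, regionF_isSymbol_ry_sq, ?_⟩
  have hrx : ∀ L t, RegionF L t → 0 < L.rx t := fun L t _ => L.rx_pos t
  have e : ((fun (L : TestLine) t => L.rx t ^ 2) - fun L t => L.ry t ^ 2) =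
      (fun L t => 2 * inner ℝ (L.x + t • L.e) L.F) - fun L _ => L.rF 0 ^ 2 := by
    funext L t
    exact rx_sq_sub_ry_sq L t
  rw [e]
  refine (IsSymbol.sub isSymbol_two_mul_inner
    (IsSymbol.param _ (fun L t _ => (mul_pos (L.rF_pos t) (L.rx_pos t)).le) hrx
      fun L t h => ?_)).weight_congr fun L t _ => ?_
  · have h1 := L.rF_pos t
    have h2 : L.rF 0 = L.rF t := rfl
    rw [h2, abs_of_pos (by positivity), sq]
    exact mul_le_mul_of_nonneg_left h.1 h1.le
  · have := L.rx_pos t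
    simp only [Pi.mul_apply, Pi.div_apply]
    field_simp

end RegionF

section RegionX

theorem RegionX.ry_le {L : TestLine} {t : ℝ} (h : RegionX L t) : L.ry t ≤ 2 * L.rF t := by
  linarith [L.ry_le t, h.1]

theorem RegionX.rF_le {L : TestLine} {t : ℝ} (h : RegionX L t) : L.rF t ≤ 2 * L.ry t := by
  linarith [L.rF_le t, h.2]

theorem regionX_isSymbol_ry_sq :
    IsSymbol RegionX rx n (fun L t => L.rF t ^ 2) (fun L t => L.ry t ^ 2) :=
  isSymbol_ry_sq.mono (fun L t _ => L.rx_pos t) 4 1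
    (fun L t h => ⟨by positivity, by nlinarith [h.ry_le, L.ry_pos t]⟩)
    fun L t h => ⟨by rw [one_mul]; exact h.2, L.ry_pos t⟩

/-- Here it is |F| and |x - F| that are comparable; the squared length of F is a constant symbol,
paired with that of x - F up to the factor |x|/|F|. -/
theorem regionX_isSymbolPair_sq :
    IsSymbolPair RegionX rx n (rx / rF) (fun L t => L.rF t ^ 2) (fun L t => L.rF t ^ 2)
      (fun L t => L.ry t ^ 2) := by
  have hrx : ∀ L t, RegionX L t → 0 < L.rx t := fun L t _ => L.rx_pos t
  refine ⟨IsSymbol.param (fun L => L.rF 0 ^ 2) (fun L t _ => by positivity) hrx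
    fun L t _ => le_of_eq (abs_of_nonneg (by positivity)), regionX_isSymbol_ry_sq, ?_⟩
  have e : ((fun (L : TestLine) t => L.rF t ^ 2) - fun L t => L.ry t ^ 2) =
      (fun L t => 2 * inner ℝ (L.x + t • L.e) L.F) - fun L t => L.rx t ^ 2 := by
    funext L t
    have := rx_sq_sub_ry_sq L t
    simp only [Pi.sub_apply]
    linarith
  rw [e]
  refine (IsSymbol.sub isSymbol_two_mul_inner
    (isSymbol_rx_sq.weight hrx 1 fun L t h => ?_)).weight_congr fun L t _ => ?_
  · have h1 := L.rx_pos t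
    refine ⟨by positivity, ?_⟩
    rw [one_mul, sq]
    exact mul_le_mul_of_nonneg_right h.1 h1.le
  · have := L.rF_pos t
    simp only [Pi.mul_apply, Pi.div_apply]
    field_simp

end RegionX

end TestLine

/-! ### The reciprocal of the phase along test lines. -/

/-- The phase as a function of the three radii, with arbitrary signs. -/
def radialPhase (σ s₀ s₁ s₂ f r q : ℝ) : ℝ :=
  s₀ * radialDisp σ f + s₁ * radialDisp σ r + s₂ * radialDisp σ q

/-- Symbols are differentiable on whole lines, not only in their region, so the reciprocal of the
phase needs a phase without zeros for every order of the three lengths. -/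
theorem radialPhase_ne_zero {σ s₀ s₁ s₂ f r q : ℝ} (hσ : 0 < σ) (hσ2 : σ < 2) (hf : 0 < f)
    (hr : 0 < r) (hq : 0 < q) (h₀ : |s₀| = 1) (h₁ : |s₁| = 1) (h₂ : |s₂| = 1)
    (hfrq : f ≤ r + q) (hrfq : r ≤ f + q) (hqfr : q ≤ f + r) :
    radialPhase σ s₀ s₁ s₂ f r q ≠ 0 := by
  have key : ∀ {z u v t₀ t₁ t₂ : ℝ}, 0 < z → z ≤ u → z ≤ v → u ≤ z + v → v ≤ z + u → |t₀| = 1 →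
      |t₁| = 1 → |t₂| = 1 →
      t₀ * radialDisp σ z + t₁ * radialDisp σ u + t₂ * radialDisp σ v ≠ 0 :=
    fun hz h1 h2 h3 h4 h5 h6 h7 h8 => by
      have h := phaseSize_le_abs hσ hσ2 hz h1 h2 h3 h4 h5 h6 h7
      rw [h8, abs_zero] at h
      exact absurd h (not_le.2 (mul_pos (subaddConst_pos hσ) (phaseSize_pos hz)))
  rw [radialPhase]
  rcases le_total f r with h1 | h1 <;> rcases le_total f q with h2 | h2 <;>
    rcases le_total r q with h3 | h3
  · exact key hf h1 h2 hrfq hqfr h₀ h₁ h₂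
  · exact key hf h1 h2 hrfq hqfr h₀ h₁ h₂
  · rw [add_comm, ← add_assoc]
    exact key hq h2 (h2.trans h1) (by linarith) (by linarith) h₂ h₀ h₁
  · rw [add_comm, ← add_assoc]
    exact key hq h2 h3 (by linarith) (by linarith) h₂ h₀ h₁
  · rw [add_comm (s₀ * _)]
    exact key hr h1 h3 (by linarith) (by linarith) h₁ h₀ h₂
  · rw [add_comm (s₀ * _)]
    exact key hr h1 (h1.trans h2) (by linarith) (by linarith) h₁ h₀ h₂
  · rw [add_comm (s₀ * _)]
    exact key hr h1 h3 (by linarith) (by linarith) h₁ h₀ h₂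
  · rw [add_comm, ← add_assoc]
    exact key hq h2 h3 (by linarith) (by linarith) h₂ h₀ h₁

namespace TestLine

variable {U : TestLine → ℝ → Prop} {n : ℕ} {σ s₀ s₁ s₂ : ℝ}

theorem isSymbol_disp_rx (hσ2 : σ < 2) :
    IsSymbol U rx n (fun L t => radialDisp σ (L.rx t)) fun L t => radialDisp σ (L.rx t) :=
  isSymbol_rx_sq.radialDisp hσ2 (fun L t _ => L.rx_pos t) rx_pos one_pos
    fun L t _ => ⟨L.rx_pos t, by rw [one_mul]⟩

theorem isSymbol_disp_ry (hσ2 : σ < 2) :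
    IsSymbol U ry n (fun L t => radialDisp σ (L.ry t)) fun L t => radialDisp σ (L.ry t) :=
  isSymbol_ry_sq.radialDisp hσ2 (fun L t _ => L.ry_pos t) ry_pos one_pos
    fun L t _ => ⟨L.ry_pos t, by rw [one_mul]⟩

theorem regionF_isSymbolPair_disp (hσ2 : σ < 2) :
    IsSymbolPair RegionF rx n (rF / rx) (fun L t => radialDisp σ (L.rx t))
      (fun L t => radialDisp σ (L.rx t)) fun L t => radialDisp σ (L.ry t) :=
  regionF_isSymbolPair_sq.radialDisp hσ2 (fun L t _ => L.rx_pos t)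
    (fun L t _ => (div_pos (L.rF_pos t) (L.rx_pos t)).le) rx_pos ry_pos
    (by norm_num : (0 : ℝ) < 1 / 4)
    fun L t h => ⟨L.rx_pos t, by nlinarith [L.rx_pos t], by nlinarith [L.rx_pos t, h.rx_le]⟩

theorem regionX_isSymbolPair_disp (hσ2 : σ < 2) :
    IsSymbolPair RegionX rx n (rx / rF) (fun L t => radialDisp σ (L.rF t))
      (fun L t => radialDisp σ (L.rF t)) fun L t => radialDisp σ (L.ry t) :=
  regionX_isSymbolPair_sq.radialDisp hσ2 (fun L t _ => L.rx_pos t)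
    (fun L t _ => (div_pos (L.rx_pos t) (L.rF_pos t)).le) rF_pos ry_pos
    (by norm_num : (0 : ℝ) < 1 / 4)
    fun L t h => ⟨L.rF_pos t, by nlinarith [L.rF_pos t], by nlinarith [L.rF_pos t, h.rF_le]⟩

/-- The phase along a test line. -/
def phase (σ s₀ s₁ s₂ : ℝ) (L : TestLine) (t : ℝ) : ℝ :=
  radialPhase σ s₀ s₁ s₂ (L.rF t) (L.rx t) (L.ry t)

theorem phase_ne_zero (hσ : 0 < σ) (hσ2 : σ < 2) (h₀ : |s₀| = 1) (h₁ : |s₁| = 1) (h₂ : |s₂| = 1)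
    (L : TestLine) (t : ℝ) : phase σ s₀ s₁ s₂ L t ≠ 0 :=
  radialPhase_ne_zero hσ hσ2 (L.rF_pos t) (L.rx_pos t) (L.ry_pos t) h₀ h₁ h₂ (L.rF_le t)
    (L.rx_le t) (L.ry_le t)

theorem hasDerivAt_phase (hσ2 : σ < 2) (L : TestLine) (t : ℝ) :
    HasDerivAt (phase σ s₀ s₁ s₂ L) (s₁ * deriv (fun t => radialDisp σ (L.rx t)) t +
      s₂ * deriv (fun t => radialDisp σ (L.ry t)) t) t := by
  have hx := ((isSymbol_disp_rx (U := fun _ _ => True) (n := 1) hσ2).differentiable L t).hasDerivAt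
  have hy := ((isSymbol_disp_ry (U := fun _ _ => True) (n := 1) hσ2).differentiable L t).hasDerivAt
  have hF : HasDerivAt (fun t => s₀ * radialDisp σ (L.rF t)) 0 t :=
    hasDerivAt_const t (s₀ * radialDisp σ ‖L.F‖)
  have h := (hF.add (hx.const_mul s₁)).add (hy.const_mul s₂)
  rw [zero_add] at h
  exact h

theorem deriv_phase (hσ2 : σ < 2) : (fun L => deriv (phase σ s₀ s₁ s₂ L)) =
    (fun L t => s₁ * deriv (fun t => radialDisp σ (L.rx t)) t) +
      fun L t => s₂ * deriv (fun t => radialDisp σ (L.ry t)) t := by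
  funext L t
  exact (hasDerivAt_phase hσ2 L t).deriv

theorem differentiable_phase (hσ2 : σ < 2) (L : TestLine) :
    Differentiable ℝ (phase σ s₀ s₁ s₂ L) :=
  fun t => (hasDerivAt_phase hσ2 L t).differentiableAt

theorem eq_or_eq_neg_of_abs_eq_one {a b : ℝ} (ha : |a| = 1) (hb : |b| = 1) : a = b ∨ a = -b :=
  abs_eq_abs.1 (ha.trans hb.symm)

theorem one_le_one_add_rpow {r : ℝ} (hr : 0 < r) : 1 ≤ 1 + r ^ σ := by
  linarith [Real.rpow_pos_of_pos hr σ]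

theorem scale_pos {r f : ℝ} (hr : 0 < r) (hf : 0 < f) : 0 < r / (1 + f ^ σ) :=
  div_pos hr (by linarith [one_le_one_add_rpow (σ := σ) hf])

theorem scale_le {r f : ℝ} (hr : 0 < r) (hf : 0 < f) : r / (1 + f ^ σ) ≤ r :=
  div_le_self hr.le (one_le_one_add_rpow hf)

/-- The reciprocal of the phase where the fixed frequency is the smallest one. -/
theorem regionF_isSymbol_inv_phase (hσ : 0 < σ) (hσ2 : σ < 2) (h₀ : |s₀| = 1) (h₁ : |s₁| = 1)
    (h₂ : |s₂| = 1) :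
    IsSymbol RegionF (fun L t => L.rx t / (1 + L.rF t ^ σ)) 2
      (fun L t => (phaseSize σ (L.rF t))⁻¹) (fun L t => (phase σ s₀ s₁ s₂ L t)⁻¹) := by
  -- Equal signs: the phase dominates p(x) and a derivative costs 1/|x|. Opposite signs: only the
  -- size of the smallest frequency bounds the phase below, but its derivative is a difference of
  -- gradients and carries the factor |F|/|x|.
  rcases eq_or_eq_neg_of_abs_eq_one h₂ h₁ with rfl | rfl
  · have hd : IsSymbol RegionF rx 1 ((fun L t => radialDisp σ (L.rx t)) / rx)
        (fun L => deriv (phase σ s₀ s₂ s₂ L)) := by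
      rw [deriv_phase hσ2]
      exact ((regionF_isSymbolPair_disp hσ2).deriv.left.const_mul s₂).add
        ((regionF_isSymbolPair_disp hσ2).deriv.right.const_mul s₂)
    refine (IsSymbol.inv (differentiable_phase hσ2) (phase_ne_zero hσ hσ2 h₀ h₂ h₂) one_pos
      (fun L t h => ⟨radialDisp_pos (L.rx_pos t), ?_⟩) hd).mono
      (fun L t _ => scale_pos (L.rx_pos t) (L.rF_pos t)) 1 1 (fun L t h => ⟨?_, ?_⟩)
      fun L t _ => ⟨by rw [one_mul]; exact scale_le (L.rx_pos t) (L.rF_pos t), L.rx_pos t⟩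
    · rw [one_mul]
      exact radialDisp_le_abs_of_eq hσ2 (L.rF_pos t) h.2 h₀ h₂
    · exact inv_nonneg.2 radialDisp_nonneg
    · rw [one_mul]
      exact inv_anti₀ (phaseSize_pos (L.rF_pos t))
        ((phaseSize_le (L.rF_pos t)).trans (radialDisp_mono hσ2 (L.rF_pos t).le h.1))
  · refine IsSymbol.inv (differentiable_phase hσ2) (phase_ne_zero hσ hσ2 h₀ h₁ h₂)
      (subaddConst_pos hσ) (fun L t h => ⟨phaseSize_pos (L.rF_pos t),
        phaseSize_le_abs hσ hσ2 (L.rF_pos t) h.1 h.2 (L.rx_le t) (L.ry_le t) h₀ h₁ h₂⟩) ?_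
    have hd : IsSymbol RegionF rx 1 (rF / rx * (fun L t => radialDisp σ (L.rx t)) / rx)
        (fun L => deriv (phase σ s₀ s₁ (-s₁) L)) := by
      have h := (regionF_isSymbolPair_disp (n := 2) hσ2).deriv.diff.const_mul s₁
      rw [← mul_div_assoc] at h
      rw [deriv_phase hσ2]
      convert h using 1
      funext L t
      simp only [Pi.add_apply, Pi.sub_apply]
      ring
    refine hd.mono (fun L t _ => scale_pos (L.rx_pos t) (L.rF_pos t)) 1 1 (fun L t h => ?_)
      fun L t _ => ⟨by rw [one_mul]; exact scale_le (L.rx_pos t) (L.rF_pos t), L.rx_pos t⟩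
    have hx := L.rx_pos t
    have hF := L.rF_pos t
    have hP := radialDisp_pos (σ := σ) hx
    -- By monotonicity of p(r)/r, (|F|/|x|) p(x) ≤ p(F), and p(F) is the phase size at |F| times 1 +
    -- |F|^σ. This loss fixes the scale |x|/(1 + |F|^σ).
    have ha := radialDisp_div_anti hσ hF h.1
    have hA := one_le_one_add_rpow (σ := σ) hF
    simp only [Pi.div_apply, Pi.mul_apply]
    refine ⟨by positivity, ?_⟩
    rw [one_mul, div_div_eq_mul_div, phaseSize_mul hF]
    refine div_le_div_of_nonneg_right ?_ hx.le
    rw [div_le_div_iff₀ hx hF] at ha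
    rw [div_mul_eq_mul_div, div_le_iff₀ hx]
    linarith

/-- The term of F is constant along the line, and the gradient at x - F is dominated by the one at x
because p(r)/r is decreasing and |x| ≤ |x - F|. -/
theorem regionX_isSymbol_deriv_phase (hσ : 0 < σ) (hσ2 : σ < 2) :
    IsSymbol RegionX rx n ((fun L t => radialDisp σ (L.rx t)) / rx)
      (fun L => deriv (phase σ s₀ s₁ s₂ L)) := by
  rw [deriv_phase hσ2]
  refine ((isSymbol_disp_rx hσ2).deriv.const_mul s₁).add
    (((isSymbol_disp_ry hσ2).deriv.mono (fun L t _ => L.rx_pos t) 1 1 (fun L t h => ?_)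
      fun L t h => ⟨by rw [one_mul]; exact h.2, L.ry_pos t⟩).const_mul s₂)
  refine ⟨div_nonneg radialDisp_nonneg (L.ry_pos t).le, ?_⟩
  rw [one_mul]
  exact radialDisp_div_anti hσ (L.rx_pos t) h.2

theorem regionX_phase_eq (L : TestLine) (t : ℝ) : phase σ s₀ s₁ s₂ L t =
    s₁ * radialDisp σ (L.rx t) + s₀ * radialDisp σ (L.rF t) + s₂ * radialDisp σ (L.ry t) := by
  rw [phase, radialPhase, add_comm (s₀ * _)]

theorem regionX_phaseSize_le (hσ : 0 < σ) (hσ2 : σ < 2) (h₀ : |s₀| = 1) (h₁ : |s₁| = 1)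
    (h₂ : |s₂| = 1) {L : TestLine} {t : ℝ} (h : RegionX L t) :
    subaddConst σ * phaseSize σ (L.rx t) ≤ |phase σ s₀ s₁ s₂ L t| := by
  rw [regionX_phase_eq]
  exact phaseSize_le_abs hσ hσ2 (L.rx_pos t) h.1 h.2 (L.rF_le t) (by linarith [L.ry_le t])
    h₁ h₀ h₂

/-- The reciprocal of the phase where the moving frequency is the smallest one. -/
theorem regionX_isSymbol_inv_phase (hσ : 0 < σ) (hσ2 : σ < 2) (h₀ : |s₀| = 1) (h₁ : |s₁| = 1)
    (h₂ : |s₂| = 1) :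
    IsSymbol RegionX (fun L t => L.rx t / (1 + L.rx t ^ σ)) 2
      (fun L t => (phaseSize σ (L.rx t))⁻¹) (fun L t => (phase σ s₀ s₁ s₂ L t)⁻¹) := by
  refine IsSymbol.inv (differentiable_phase hσ2) (phase_ne_zero hσ hσ2 h₀ h₁ h₂)
    (subaddConst_pos hσ) (fun L t h => ⟨phaseSize_pos (L.rx_pos t),
      regionX_phaseSize_le hσ hσ2 h₀ h₁ h₂ h⟩) ?_
  refine (regionX_isSymbol_deriv_phase hσ hσ2).mono
    (fun L t _ => scale_pos (L.rx_pos t) (L.rx_pos t)) 1 1 (fun L t h => ?_)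
      fun L t _ => ⟨by rw [one_mul]; exact scale_le (L.rx_pos t) (L.rx_pos t), L.rx_pos t⟩
  refine ⟨div_nonneg radialDisp_nonneg (L.rx_pos t).le, le_of_eq ?_⟩
  simp only [Pi.div_apply]
  rw [one_mul, div_div_eq_mul_div, phaseSize_mul (L.rx_pos t)]

/-- Where the moving frequency is the smallest one and the other two have equal signs, the phase
has the size of the larger frequencies. -/
theorem regionX_isSymbol_inv_phase_of_eq (hσ : 0 < σ) (hσ2 : σ < 2) (h₀ : |s₀| = 1)
    (h₁ : |s₁| = 1) :
    IsSymbol RegionX rx 2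
      (fun L t => (radialDisp σ (L.rF t))⁻¹) (fun L t => (phase σ s₀ s₁ s₀ L t)⁻¹) := by
  refine IsSymbol.inv (differentiable_phase hσ2) (phase_ne_zero hσ hσ2 h₀ h₁ h₀)
    one_pos (fun L t h => ⟨radialDisp_pos (L.rF_pos t), ?_⟩) ?_
  · rw [one_mul, regionX_phase_eq]
    exact radialDisp_le_abs_of_eq hσ2 (L.rx_pos t) h.2 h₁ h₀
  · refine (regionX_isSymbol_deriv_phase hσ hσ2).weight (fun L t _ => L.rx_pos t) 1 fun L t h => ?_
    refine ⟨div_nonneg radialDisp_nonneg (L.rx_pos t).le, ?_⟩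
    rw [one_mul]
    exact div_le_div_of_nonneg_right (radialDisp_mono hσ2 (L.rx_pos t).le h.1) (L.rx_pos t).le

end TestLine

/-! ### Absorption of the losses by the brackets. -/

section Weights

variable {σ lam s f r : ℝ}

theorem one_add_sq_rpow_neg_le (hlam : 0 ≤ lam) :
    (1 + s ^ 2) ^ (-lam) ≤ max 1 s ^ (-(2 * lam)) := by
  have hM : 0 < max 1 s := lt_max_of_lt_left one_pos
  have h1 : max 1 s ^ 2 ≤ 1 + s ^ 2 := by
    rcases max_cases 1 s with ⟨h, _⟩ | ⟨h, _⟩ <;> rw [h] <;> nlinarith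
  calc (1 + s ^ 2) ^ (-lam) ≤ (max 1 s ^ 2) ^ (-lam) :=
        Real.rpow_le_rpow_of_nonpos (by positivity) h1 (by linarith)
    _ = _ := by
        rw [← Real.rpow_natCast (max 1 s) 2, ← Real.rpow_mul hM.le]
        congr 1
        push_cast
        ring

/-- Decay can be moved from the smaller to the larger frequency. -/
theorem one_add_sq_rpow_mul_le {b c : ℝ} (hlam : 0 ≤ lam) (hf : 0 < f) (hfr : f ≤ r)
    (hb : b ≤ lam) (hbc : b + c = 2 * lam) :
    (1 + f ^ 2) ^ (-b) * (1 + r ^ 2) ^ (-c) ≤ max 1 f ^ (-(2 * lam)) * max 1 r ^ (-(2 * lam)) := by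
  have hr := hf.trans_le hfr
  refine le_trans ?_ (mul_le_mul (one_add_sq_rpow_neg_le hlam) (one_add_sq_rpow_neg_le hlam)
    (by positivity) (by positivity))
  have e1 : (1 + f ^ 2) ^ (-b) = (1 + f ^ 2) ^ (lam - b) * (1 + f ^ 2) ^ (-lam) := by
    rw [← Real.rpow_add (by positivity)]
    congr 1
    ring
  have e2 : (1 + r ^ 2) ^ (-lam) = (1 + r ^ 2) ^ (lam - b) * (1 + r ^ 2) ^ (-c) := by
    rw [← Real.rpow_add (by positivity)]
    congr 1
    linarith
  rw [e1, e2]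
  have h1 : (1 + f ^ 2) ^ (lam - b) ≤ (1 + r ^ 2) ^ (lam - b) :=
    Real.rpow_le_rpow (by positivity) (by nlinarith) (by linarith)
  calc _ = (1 + f ^ 2) ^ (lam - b) * ((1 + f ^ 2) ^ (-lam) * (1 + r ^ 2) ^ (-c)) := by ring
    _ ≤ (1 + r ^ 2) ^ (lam - b) * ((1 + f ^ 2) ^ (-lam) * (1 + r ^ 2) ^ (-c)) := by gcongr
    _ = _ := by ring

theorem rpow_mul_max_rpow_le {θ : ℝ} (hf : 0 < f) (hθ : 0 ≤ θ) (hθl : θ ≤ 2 * lam) :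
    f ^ θ * max 1 f ^ (-(2 * lam)) ≤ 1 := by
  have hM : 0 < max 1 f := lt_max_of_lt_left one_pos
  calc f ^ θ * max 1 f ^ (-(2 * lam)) ≤ max 1 f ^ θ * max 1 f ^ (-(2 * lam)) := by
        gcongr
        exact le_max_right _ _
    _ = max 1 f ^ (θ - 2 * lam) := by rw [← Real.rpow_add hM, sub_eq_add_neg]
    _ ≤ 1 := Real.rpow_le_one_of_one_le_of_nonpos (le_max_left _ _) (by linarith)

theorem one_add_rpow_le (hσ : 0 < σ) (hσ2 : σ < 2) (hs : 0 < s) : 1 + s ^ σ ≤ 2 * max 1 s ^ 2 := by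
  have h1 : (1 : ℝ) ≤ max 1 s := le_max_left _ _
  have h2 : s ^ σ ≤ max 1 s ^ 2 := by
    calc s ^ σ ≤ max 1 s ^ σ := Real.rpow_le_rpow hs.le (le_max_right _ _) hσ.le
      _ ≤ max 1 s ^ (2 : ℝ) := Real.rpow_le_rpow_of_exponent_le h1 hσ2.le
      _ = _ := by norm_num
  nlinarith

/-- The loss coming from the smallness of the phase is compensated by the decay in the smallest
frequency. -/
theorem sqrt_mul_pow_mul_le (hσ : 0 < σ) (hσ2 : σ < 2) (hlam : 7 / 4 ≤ lam) (hs : 0 < s) {j : ℕ}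
    (hj : j ≤ 2) :
    Real.sqrt (1 + s ^ σ) * (1 + s ^ σ) ^ j * max 1 s ^ (-(2 * lam)) ≤ 8 * max 1 s ^ j := by
  have h1 : (1 : ℝ) ≤ max 1 s := le_max_left _ _
  have hA := one_add_rpow_le hσ hσ2 hs
  have hA0 : 0 < 1 + s ^ σ := by positivity
  have hsq : Real.sqrt (1 + s ^ σ) ≤ 2 * max 1 s := by
    rw [Real.sqrt_le_left (by positivity)]
    nlinarith
  -- With M = max(1, s), the square root is O(M) and (1 + s^σ)^j is O(M^(2j)). Decay M^(-(j+1))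
  -- brings the product down to M^j; it is available since 2λ ≥ 7/2 ≥ j + 1.
  have hdec : max 1 s ^ (-(2 * lam)) ≤ (max 1 s ^ (j + 1))⁻¹ := by
    rw [← Real.rpow_natCast, ← Real.rpow_neg (by positivity)]
    refine Real.rpow_le_rpow_of_exponent_le h1 ?_
    have : (j : ℝ) ≤ 2 := by exact_mod_cast hj
    push_cast
    linarith
  have h2 : (2 : ℝ) ^ j ≤ 2 ^ 2 := pow_le_pow_right₀ (by norm_num) hj
  calc _ ≤ (2 * max 1 s) * (2 * max 1 s ^ 2) ^ j * (max 1 s ^ (j + 1))⁻¹ := by gcongr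
    _ = 2 * 2 ^ j * max 1 s ^ j := by
        have : max 1 s ≠ 0 := by positivity
        rw [mul_pow, ← pow_mul]
        field_simp
        ring
    _ ≤ _ := by
        gcongr
        linarith

/-- Once the loss in f is absorbed, the derivatives leave max(1, f)^j / r^j. This is r^(-j) for r ≤
1 and at most 1 for r ≥ 1, as f ≤ r. -/
theorem regionF_weight_le {a α : ℝ} (hσ : 0 < σ) (hσ2 : σ < 2) (hlam : 7 / 4 ≤ lam) (hf : 0 < f)
    (hfr : f ≤ r) {j : ℕ} (hj : j ≤ 2) (hα : α ≤ 2 * a - j) :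
    Real.sqrt (1 + f ^ σ) * r ^ (2 * a) * (max 1 f ^ (-(2 * lam)) * max 1 r ^ (-(2 * lam))) *
      ((1 + f ^ σ) / r) ^ j ≤ 8 * profile α (2 * lam - 2 * a) r := by
  have hr := hf.trans_le hfr
  have h1 := sqrt_mul_pow_mul_le hσ hσ2 hlam hf hj
  calc _ = (Real.sqrt (1 + f ^ σ) * (1 + f ^ σ) ^ j * max 1 f ^ (-(2 * lam))) *
        (r ^ (2 * a) * max 1 r ^ (-(2 * lam)) / r ^ j) := by
        rw [div_pow]; ring
    _ ≤ (8 * max 1 f ^ j) * (r ^ (2 * a) * max 1 r ^ (-(2 * lam)) / r ^ j) := by gcongr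
    _ ≤ _ := by
        rcases le_total r 1 with hr1 | hr1
        · rw [profile_of_le_one _ _ hr1, max_eq_left hr1, max_eq_left (hfr.trans hr1), one_pow,
            Real.one_rpow, mul_one, mul_one, ← Real.rpow_natCast, ← Real.rpow_sub hr]
          gcongr 8 * ?_
          exact Real.rpow_le_rpow_of_exponent_ge hr hr1 hα
        · rw [profile_of_one_le _ _ hr1, max_eq_right hr1, ← Real.rpow_add hr]
          have h2 : max 1 f ^ j ≤ r ^ j := by gcongr; exact max_le hr1 hfr
          have e : 2 * a + -(2 * lam) = -(2 * lam - 2 * a) := by ring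
          rw [e]
          calc _ ≤ 8 * r ^ j * (r ^ (-(2 * lam - 2 * a)) / r ^ j) := by gcongr
            _ = _ := by field_simp

/-- For r ≥ 1 the factor r^(-j) cancels the remaining max(1, r)^j, and the decay in the larger f is
converted into decay in r. -/
theorem regionX_weight_le {a α : ℝ} (hσ : 0 < σ) (hσ2 : σ < 2) (hlam : 7 / 4 ≤ lam) (hr : 1 ≤ r)
    (hrf : r ≤ f) {j : ℕ} (hj : j ≤ 2) (ha : a ≤ lam) :
    Real.sqrt (1 + r ^ σ) * f ^ (2 * a) * (max 1 r ^ (-(2 * lam)) * max 1 f ^ (-(2 * lam))) *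
      ((1 + r ^ σ) / r) ^ j ≤ 8 * profile α (2 * lam - 2 * a) r := by
  have hr0 : 0 < r := one_pos.trans_le hr
  have hf0 : 0 < f := hr0.trans_le hrf
  have h1 := sqrt_mul_pow_mul_le hσ hσ2 hlam hr0 hj
  calc _ = (Real.sqrt (1 + r ^ σ) * (1 + r ^ σ) ^ j * max 1 r ^ (-(2 * lam))) *
        (f ^ (2 * a) * max 1 f ^ (-(2 * lam)) / r ^ j) := by
        rw [div_pow]; ring
    _ ≤ (8 * max 1 r ^ j) * (f ^ (2 * a) * max 1 f ^ (-(2 * lam)) / r ^ j) := by gcongr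
    _ = 8 * f ^ (-(2 * lam - 2 * a)) := by
        rw [max_eq_right hr, max_eq_right (hr.trans hrf), ← Real.rpow_add hf0,
          show 2 * a + -(2 * lam) = -(2 * lam - 2 * a) by ring]
        field_simp
    _ ≤ _ := by
        rw [profile_of_one_le _ _ hr]
        gcongr 8 * ?_
        exact Real.rpow_le_rpow_of_nonpos hr0 hrf (by linarith)

end Weights

/-! ### Kernel bounds when F is smallest, or when x is smallest and |x| ≥ 1. -/

section Kernel

/-- The kernel as a function of the three radii, with arbitrary signs and weights. -/
def radialKernel (σ b₀ b₁ b₂ s₀ s₁ s₂ f r q : ℝ) : ℝ :=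
  f ^ ((2 - σ) / 2) * r ^ ((2 - σ) / 2) * q ^ ((2 - σ) / 2) *
    ((1 + f ^ 2) ^ (-b₀) * (1 + r ^ 2) ^ (-b₁) * (1 + q ^ 2) ^ (-b₂)) *
    (radialPhase σ s₀ s₁ s₂ f r q)⁻¹

theorem radialKernel_swap (σ b₀ b₁ b₂ s₀ s₁ s₂ f r q : ℝ) :
    radialKernel σ b₀ b₁ b₂ s₀ s₁ s₂ f r q = radialKernel σ b₀ b₂ b₁ s₀ s₂ s₁ f q r := by
  have : radialPhase σ s₀ s₁ s₂ f r q = radialPhase σ s₀ s₂ s₁ f q r := by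
    rw [radialPhase, radialPhase]; ring
  rw [radialKernel, radialKernel, this]
  ring

namespace TestLine

/-- The kernel along a test line. -/
def kernel (σ b₀ b₁ b₂ s₀ s₁ s₂ : ℝ) (L : TestLine) (t : ℝ) : ℝ :=
  radialKernel σ b₀ b₁ b₂ s₀ s₁ s₂ (L.rF t) (L.rx t) (L.ry t)

/-- The bounds for the kernel and its first two derivatives near the singularity `x = 0`. -/
def HasBounds (U : TestLine → ℝ → Prop) (ε β : ℝ) (K : TestLine → ℝ → ℝ) : Prop :=
  ∃ C, 0 ≤ C ∧ ∀ L t, U L t → |K L t| ≤ C * profile 0 β (L.rx t) ∧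
    |deriv (K L) t| ≤ C * profile (ε - 1) β (L.rx t) ∧
    |deriv (deriv (K L)) t| ≤ C * profile (ε - 2) β (L.rx t)

variable {U V : TestLine → ℝ → Prop} {ℓ w v κ f : TestLine → ℝ → ℝ} {n : ℕ}
variable {σ b₀ b₁ b₂ s₀ s₁ s₂ lam ε β : ℝ}

theorem HasBounds.of_bounds (h0 : ∃ C, ∀ L t, U L t → |f L t| ≤ C * profile 0 β (L.rx t))
    (h1 : ∃ C, ∀ L t, U L t → |deriv (f L) t| ≤ C * profile (ε - 1) β (L.rx t))
    (h2 : ∃ C, ∀ L t, U L t → |deriv (deriv (f L)) t| ≤ C * profile (ε - 2) β (L.rx t)) :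
    HasBounds U ε β f := by
  obtain ⟨C₀, h0⟩ := h0
  obtain ⟨C₁, h1⟩ := h1
  obtain ⟨C₂, h2⟩ := h2
  have hp : ∀ (L : TestLine) t α, 0 ≤ profile α β (L.rx t) := fun L t α =>
    profile_nonneg _ _ (L.rx_pos t).le
  refine ⟨max (max C₀ C₁) (max C₂ 0), le_max_of_le_right (le_max_right _ _), fun L t ht =>
    ⟨(h0 L t ht).trans ?_, (h1 L t ht).trans ?_, (h2 L t ht).trans ?_⟩⟩
  · exact mul_le_mul_of_nonneg_right (by simp) (hp L t _)
  · exact mul_le_mul_of_nonneg_right (by simp) (hp L t _)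
  · exact mul_le_mul_of_nonneg_right (by simp) (hp L t _)

theorem exists_bound_of_le {α : ℝ} {g w : TestLine → ℝ → ℝ}
    (h : ∃ C, ∀ L t, U L t → |g L t| ≤ C * w L t) (hw0 : ∀ L t, U L t → 0 ≤ w L t) (D : ℝ)
    (hw : ∀ L t, U L t → w L t ≤ D * profile α β (L.rx t)) :
    ∃ C, ∀ L t, U L t → |g L t| ≤ C * profile α β (L.rx t) := by
  obtain ⟨C, hC⟩ := h
  refine ⟨|C| * D, fun L t ht => (hC L t ht).trans ?_⟩
  rw [mul_assoc]
  exact (mul_le_mul_of_nonneg_right (le_abs_self C) (hw0 L t ht)).trans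
    (mul_le_mul_of_nonneg_left (hw L t ht) (abs_nonneg C))

/-- The factors of the kernel other than the phase. -/
theorem isSymbol_numerator (σ b₀ b₁ b₂ : ℝ)
    (hv : IsSymbol U rx n (fun L t => v L t ^ 2) fun L t => L.ry t ^ 2)
    (hv' : ∀ L t, U L t → 0 < v L t ∧ 1 / 4 * v L t ^ 2 ≤ L.ry t ^ 2) :
    IsSymbol U rx n
      (fun L t => L.rF t ^ ((2 - σ) / 2) * L.rx t ^ ((2 - σ) / 2) * v L t ^ ((2 - σ) / 2) *
        ((1 + L.rF t ^ 2) ^ (-b₀) * (1 + L.rx t ^ 2) ^ (-b₁) * (1 + v L t ^ 2) ^ (-b₂)))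
      (fun L t => L.rF t ^ ((2 - σ) / 2) * L.rx t ^ ((2 - σ) / 2) * L.ry t ^ ((2 - σ) / 2) *
        ((1 + L.rF t ^ 2) ^ (-b₀) * (1 + L.rx t ^ 2) ^ (-b₁) * (1 + L.ry t ^ 2) ^ (-b₂))) := by
  have hℓ : ∀ (L : TestLine) t, U L t → 0 < L.rx t := fun L t _ => L.rx_pos t
  have hpar : ∀ s : ℝ → ℝ, (∀ r, 0 < r → 0 ≤ s r) →
      IsSymbol U rx n (fun L t => s (L.rF t)) fun L t => s (L.rF t) := fun s hs =>
    IsSymbol.param (fun L => s (L.rF 0)) (fun L t _ => hs _ (L.rF_pos t)) hℓ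
      fun L t _ => le_of_eq (abs_of_nonneg (hs _ (L.rF_pos t)))
  have h1 := hpar (fun r => r ^ ((2 - σ) / 2)) fun r hr => by positivity
  have h2 := (isSymbol_rx_sq (U := U) (n := n)).norm_rpow rx_pos one_pos
    (fun L t _ => ⟨L.rx_pos t, by rw [one_mul]⟩) ((2 - σ) / 2)
  have h3 := hv.norm_rpow ry_pos (by norm_num) hv' ((2 - σ) / 2)
  have h4 := hpar (fun r => (1 + r ^ 2) ^ (-b₀)) fun r hr => by positivity
  have h5 := (isSymbol_rx_sq (U := U) (n := n)).bracket_rpow hℓ one_pos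
    (fun L t _ => by rw [one_mul]) (-b₁)
  have h6 := hv.bracket_rpow hℓ (by norm_num) (fun L t h => (hv' L t h).2) (-b₂)
  exact ((h1.mul h2).mul h3).mul ((h4.mul h5).mul h6)

/-- Besides the bounds, this records that the kernel is twice differentiable along the whole of
every test line. -/
theorem regionF_isSymbol_kernel (hσ : 0 < σ) (hσ2 : σ < 2) (h₀ : |s₀| = 1) (h₁ : |s₁| = 1)
    (h₂ : |s₂| = 1) :
    IsSymbol RegionF (fun L t => L.rx t / (1 + L.rF t ^ σ)) 2
      ((fun L t => L.rF t ^ ((2 - σ) / 2) * L.rx t ^ ((2 - σ) / 2) * L.rx t ^ ((2 - σ) / 2) *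
        ((1 + L.rF t ^ 2) ^ (-b₀) * (1 + L.rx t ^ 2) ^ (-b₁) * (1 + L.rx t ^ 2) ^ (-b₂))) *
        fun L t => (phaseSize σ (L.rF t))⁻¹)
      (kernel σ b₀ b₁ b₂ s₀ s₁ s₂) := by
  have hnum := isSymbol_numerator (U := RegionF) (n := 2) σ b₀ b₁ b₂ (v := rx)
    regionF_isSymbol_ry_sq fun L t h => ⟨L.rx_pos t, by nlinarith [L.rx_pos t, h.rx_le]⟩
  exact (hnum.mono (fun L t _ => scale_pos (σ := σ) (L.rx_pos t) (L.rF_pos t)) 1 1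
    (fun L t _ => by
      have := L.rx_pos t
      have := L.rF_pos t
      exact ⟨by positivity, (one_mul _).ge⟩)
    fun L t _ => ⟨by rw [one_mul]; exact scale_le (L.rx_pos t) (L.rF_pos t), L.rx_pos t⟩).mul
      (regionF_isSymbol_inv_phase hσ hσ2 h₀ h₁ h₂)

/-- The kernel where the fixed frequency is the smallest one. -/
theorem regionF_hasBounds (hσ : 0 < σ) (hσ2 : σ < 2) (hlam : 7 / 4 ≤ lam) (h₀ : |s₀| = 1)
    (h₁ : |s₁| = 1) (h₂ : |s₂| = 1) (hb₀ : b₀ ≤ lam) (hb : b₀ + b₁ + b₂ = 2 * lam)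
    (hε : ε ≤ 2 - σ) :
    HasBounds RegionF ε (2 * lam - (2 - σ)) (kernel σ b₀ b₁ b₂ s₀ s₁ s₂) := by
  set a := (2 - σ) / 2 with ha
  have hsym := regionF_isSymbol_kernel (b₀ := b₀) (b₁ := b₁) (b₂ := b₂) hσ hσ2 h₀ h₁ h₂
  set W : TestLine → ℝ → ℝ := fun L t => Real.sqrt (1 + L.rF t ^ σ) * L.rx t ^ (2 * a) *
    (max 1 (L.rF t) ^ (-(2 * lam)) * max 1 (L.rx t) ^ (-(2 * lam))) with hW
  have hsym' : IsSymbol RegionF (fun L t => L.rx t / (1 + L.rF t ^ σ)) 2 W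
      (kernel σ b₀ b₁ b₂ s₀ s₁ s₂) := by
    refine hsym.weight (fun L t _ => scale_pos (L.rx_pos t) (L.rF_pos t)) 1 fun L t h => ?_
    have hx := L.rx_pos t
    have hF := L.rF_pos t
    have hg := phaseSize_pos (σ := σ) hF
    simp only [Pi.mul_apply]
    refine ⟨by positivity, ?_⟩
    rw [one_mul, hW]
    beta_reduce
    rw [← rpow_div_phaseSize hF]
    -- The total bracket exponent 2λ is redistributed as λ on |F| and λ on |x|. Taking b₀ at most λ
    -- means that decay only moves from the larger frequency x to the smaller F, which increases the
    -- weight.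
    have h5 := one_add_sq_rpow_mul_le (by linarith : 0 ≤ lam) hF h.1 hb₀
      (by linarith : b₀ + (b₁ + b₂) = 2 * lam)
    rw [neg_add, Real.rpow_add (by positivity)] at h5
    have e : L.rx t ^ (2 * a) = L.rx t ^ a * L.rx t ^ a := by
      rw [← Real.rpow_add hx]; ring_nf
    rw [e, ← ha]
    calc _ = L.rF t ^ a / phaseSize σ (L.rF t) * (L.rx t ^ a * L.rx t ^ a) *
          ((1 + L.rF t ^ 2) ^ (-b₀) * ((1 + L.rx t ^ 2) ^ (-b₁) * (1 + L.rx t ^ 2) ^ (-b₂))) := by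
          ring
      _ ≤ _ := by gcongr
  have hW0 : ∀ L t, 0 ≤ W L t := fun L t => by
    have := L.rx_pos t
    positivity
  have hsc : ∀ (L : TestLine) t, 0 ≤ L.rx t / (1 + L.rF t ^ σ) := fun L t =>
    (scale_pos (L.rx_pos t) (L.rF_pos t)).le
  have eβ : 2 * lam - (2 - σ) = 2 * lam - 2 * a := by rw [ha]; ring
  rw [eβ]
  refine .of_bounds (exists_bound_of_le hsym'.bound (fun L t _ => hW0 L t) 8 fun L t h => ?_)
    (exists_bound_of_le hsym'.deriv.bound (fun L t _ => div_nonneg (hW0 L t) (hsc L t)) 8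
      fun L t h => ?_)
    (exists_bound_of_le hsym'.deriv.deriv.bound
      (fun L t _ => div_nonneg (div_nonneg (hW0 L t) (hsc L t)) (hsc L t)) 8 fun L t h => ?_)
  · have := regionF_weight_le (a := a) (α := 0) hσ hσ2 hlam (L.rF_pos t) h.1 (j := 0)
      (by norm_num) (by rw [ha]; push_cast; linarith)
    simpa using this
  · have := regionF_weight_le (a := a) (α := ε - 1) hσ hσ2 hlam (L.rF_pos t) h.1 (j := 1)
      (by norm_num) (by rw [ha]; push_cast; linarith)
    refine le_trans (le_of_eq ?_) this
    simp only [Pi.div_apply, hW]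
    rw [div_div_eq_mul_div, pow_one]
    ring
  · have := regionF_weight_le (a := a) (α := ε - 2) hσ hσ2 hlam (L.rF_pos t) h.1 (j := 2)
      (by norm_num) (by rw [ha]; push_cast; linarith)
    refine le_trans (le_of_eq ?_) this
    simp only [Pi.div_apply, hW]
    rw [div_div_eq_mul_div, div_div_eq_mul_div, div_pow]
    ring

theorem regionX_isSymbol_numerator (σ b₀ b₁ b₂ : ℝ) : IsSymbol RegionX rx n
      (fun L t => L.rF t ^ ((2 - σ) / 2) * L.rx t ^ ((2 - σ) / 2) * L.rF t ^ ((2 - σ) / 2) *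
        ((1 + L.rF t ^ 2) ^ (-b₀) * (1 + L.rx t ^ 2) ^ (-b₁) * (1 + L.rF t ^ 2) ^ (-b₂)))
      (fun L t => L.rF t ^ ((2 - σ) / 2) * L.rx t ^ ((2 - σ) / 2) * L.ry t ^ ((2 - σ) / 2) *
        ((1 + L.rF t ^ 2) ^ (-b₀) * (1 + L.rx t ^ 2) ^ (-b₁) * (1 + L.ry t ^ 2) ^ (-b₂))) :=
  isSymbol_numerator σ b₀ b₁ b₂ (v := rF) regionX_isSymbol_ry_sq
    fun L t h => ⟨L.rF_pos t, by nlinarith [L.rF_pos t, h.rF_le]⟩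

/-- The kernel where the moving frequency is the smallest one and at least `1`. -/
theorem regionX_large_hasBounds (hσ : 0 < σ) (hσ2 : σ < 2) (hlam : 7 / 4 ≤ lam) (h₀ : |s₀| = 1)
    (h₁ : |s₁| = 1) (h₂ : |s₂| = 1) (hb₁ : b₁ ≤ lam) (hb : b₀ + b₁ + b₂ = 2 * lam) :
    HasBounds (fun L t => RegionX L t ∧ 1 ≤ L.rx t) ε (2 * lam - (2 - σ))
      (kernel σ b₀ b₁ b₂ s₀ s₁ s₂) := by
  set a := (2 - σ) / 2 with ha
  have hsym := ((regionX_isSymbol_numerator σ b₀ b₁ b₂).mono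
    (fun L t _ => scale_pos (σ := σ) (L.rx_pos t) (L.rx_pos t)) 1 1
    (fun L t _ => by
      have := L.rx_pos t
      have := L.rF_pos t
      exact ⟨by positivity, (one_mul _).ge⟩)
    fun L t _ => ⟨by rw [one_mul]; exact scale_le (L.rx_pos t) (L.rx_pos t), L.rx_pos t⟩).mul
      (regionX_isSymbol_inv_phase hσ hσ2 h₀ h₁ h₂)
  set W : TestLine → ℝ → ℝ := fun L t => Real.sqrt (1 + L.rx t ^ σ) * L.rF t ^ (2 * a) *
    (max 1 (L.rx t) ^ (-(2 * lam)) * max 1 (L.rF t) ^ (-(2 * lam))) with hW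
  have hsym' : IsSymbol (fun L t => RegionX L t ∧ 1 ≤ L.rx t)
      (fun L t => L.rx t / (1 + L.rx t ^ σ)) 2 W (kernel σ b₀ b₁ b₂ s₀ s₁ s₂) := by
    refine (hsym.weight (fun L t _ => scale_pos (L.rx_pos t) (L.rx_pos t)) 1 fun L t h => ?_).region
      fun L t h => h.1
    have hx := L.rx_pos t
    have hF := L.rF_pos t
    have hg := phaseSize_pos (σ := σ) hx
    simp only [Pi.mul_apply]
    refine ⟨by positivity, ?_⟩
    rw [one_mul, hW]
    beta_reduce
    rw [← rpow_div_phaseSize hx]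
    have h5 := one_add_sq_rpow_mul_le (by linarith : 0 ≤ lam) hx h.1 hb₁
      (by linarith : b₁ + (b₀ + b₂) = 2 * lam)
    rw [neg_add, Real.rpow_add (by positivity)] at h5
    have e : L.rF t ^ (2 * a) = L.rF t ^ a * L.rF t ^ a := by
      rw [← Real.rpow_add hF]; ring_nf
    rw [e, ← ha]
    calc _ = L.rx t ^ a / phaseSize σ (L.rx t) * (L.rF t ^ a * L.rF t ^ a) *
          ((1 + L.rx t ^ 2) ^ (-b₁) * ((1 + L.rF t ^ 2) ^ (-b₀) * (1 + L.rF t ^ 2) ^ (-b₂))) := by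
          ring
      _ ≤ _ := by gcongr
  have hW0 : ∀ L t, 0 ≤ W L t := fun L t => by
    have := L.rF_pos t
    positivity
  have hsc : ∀ (L : TestLine) t, 0 ≤ L.rx t / (1 + L.rx t ^ σ) := fun L t =>
    (scale_pos (L.rx_pos t) (L.rx_pos t)).le
  have eβ : 2 * lam - (2 - σ) = 2 * lam - 2 * a := by rw [ha]; ring
  have hal : a ≤ lam := by rw [ha]; linarith
  rw [eβ]
  refine .of_bounds (exists_bound_of_le hsym'.bound (fun L t _ => hW0 L t) 8 fun L t h => ?_)
    (exists_bound_of_le hsym'.deriv.bound (fun L t _ => div_nonneg (hW0 L t) (hsc L t)) 8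
      fun L t h => ?_)
    (exists_bound_of_le hsym'.deriv.deriv.bound
      (fun L t _ => div_nonneg (div_nonneg (hW0 L t) (hsc L t)) (hsc L t)) 8 fun L t h => ?_)
  · have := regionX_weight_le (a := a) (α := 0) hσ hσ2 hlam h.2 h.1.1 (j := 0) (by norm_num) hal
    simpa using this
  · have := regionX_weight_le (a := a) (α := ε - 1) hσ hσ2 hlam h.2 h.1.1 (j := 1) (by norm_num) hal
    refine le_trans (le_of_eq ?_) this
    simp only [Pi.div_apply, hW]
    rw [div_div_eq_mul_div, pow_one]
    ring
  · have := regionX_weight_le (a := a) (α := ε - 2) hσ hσ2 hlam h.2 h.1.1 (j := 2) (by norm_num) hal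
    refine le_trans (le_of_eq ?_) this
    simp only [Pi.div_apply, hW]
    rw [div_div_eq_mul_div, div_div_eq_mul_div, div_pow]
    ring

end TestLine

end Kernel

/-! ### The moving frequency near 0: the gain in the derivatives. -/

namespace IsGainSymbol

variable {ι : Type*} {U : ι → ℝ → Prop} {ℓ w v κ f g : ι → ℝ → ℝ}

theorem of_isSymbol (h : IsSymbol U ℓ 2 v f) (hℓ : ∀ i t, U i t → 0 < ℓ i t) (D E : ℝ)
    (hv : ∀ i t, U i t → 0 ≤ v i t ∧ v i t ≤ D * (κ i t * w i t))
    (hκ : ∀ i t, U i t → D * (κ i t * w i t) ≤ E * w i t) : IsGainSymbol U ℓ κ w f := by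
  refine ⟨h.weight hℓ E fun i t ht => ⟨(hv i t ht).1, (hv i t ht).2.trans (hκ i t ht)⟩,
    h.deriv.weight hℓ D fun i t ht => ⟨div_nonneg (hv i t ht).1 (hℓ i t ht).le, ?_⟩⟩
  simp only [Pi.div_apply, Pi.mul_apply]
  rw [← mul_div_assoc]
  exact div_le_div_of_nonneg_right (hv i t ht).2 (hℓ i t ht).le

theorem param (c : ι → ℝ) (hw : ∀ i t, U i t → 0 ≤ w i t) (hκ : ∀ i t, U i t → 0 ≤ κ i t)
    (hℓ : ∀ i t, U i t → 0 < ℓ i t) (hc : ∀ i t, U i t → |c i| ≤ w i t) :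
    IsGainSymbol U ℓ κ w (fun i _ => c i) := by
  refine ⟨IsSymbol.param c hw hℓ hc, ?_⟩
  have e : (fun i => deriv fun _ : ℝ => c i) = fun _ _ => 0 := by
    funext i t
    simp
  have h0 : ∀ i t, U i t → 0 ≤ (κ * w / ℓ) i t := fun i t ht =>
    div_nonneg (mul_nonneg (hκ i t ht) (hw i t ht)) (hℓ i t ht).le
  rw [e]
  exact IsSymbol.param (fun _ => 0) h0 hℓ fun i t ht => by simpa using h0 i t ht

theorem add (hf : IsGainSymbol U ℓ κ w f) (hg : IsGainSymbol U ℓ κ w g) :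
    IsGainSymbol U ℓ κ w (f + g) := by
  refine ⟨hf.symbol.add hg.symbol, ?_⟩
  have e : (fun i => deriv ((f + g) i)) = (fun i => deriv (f i)) + fun i => deriv (g i) := by
    funext i t
    exact deriv_add (hf.symbol.2.1 i t) (hg.symbol.2.1 i t)
  rw [e]
  exact hf.gain.add hg.gain

theorem const_mul (c : ℝ) (hf : IsGainSymbol U ℓ κ w f) :
    IsGainSymbol U ℓ κ w (fun i t => c * f i t) := by
  refine ⟨hf.symbol.const_mul c, ?_⟩
  have e : (fun i => deriv fun t => c * f i t) = fun i t => c * deriv (f i) t := by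
    funext i t
    exact deriv_const_mul c (hf.symbol.2.1 i t)
  rw [e]
  exact hf.gain.const_mul c

end IsGainSymbol

theorem rpow_le_radialDisp {σ r : ℝ} (hr : 0 < r) : r ^ ((2 - σ) / 2) ≤ radialDisp σ r := by
  rw [radialDisp_eq_rpow hr]
  refine le_mul_of_one_le_right (by positivity) ?_
  rw [Real.one_le_sqrt]
  linarith [Real.rpow_pos_of_pos hr σ]

/-- Near x = 0 the bracket of x is of order 1, so growth in |F| is absorbed by the other two, whose
exponents add up to at least λ. -/
theorem rpow_mul_brackets_le {lam b₀ b₂ f θ : ℝ} (hlam : 0 ≤ lam) (hf : 0 < f) (hθ : 0 ≤ θ)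
    (hθl : θ ≤ 2 * lam) (hb : lam ≤ b₀ + b₂) :
    f ^ θ * ((1 + f ^ 2) ^ (-b₀) * (1 + f ^ 2) ^ (-b₂)) ≤ 1 := by
  refine le_trans ?_ (rpow_mul_max_rpow_le hf hθ hθl)
  gcongr
  refine le_trans ?_ (one_add_sq_rpow_neg_le hlam)
  rw [← Real.rpow_add (by positivity)]
  exact Real.rpow_le_rpow_of_exponent_le (by nlinarith) (by linarith)

theorem radialDisp_mul_rpow_neg {σ r : ℝ} (hr : 0 < r) :
    radialDisp σ r * r ^ (-((2 - σ) / 2)) = (1 + r ^ σ) ^ (1 / 2 : ℝ) := by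
  rw [radialDisp_eq_rpow hr, Real.sqrt_eq_rpow, mul_right_comm, ← Real.rpow_add hr, add_neg_cancel,
    Real.rpow_zero, one_mul]

/-- For r ≤ 1 the normalisation by r^((2-σ)/2) brings the lower bound for the phase to order 1. -/
theorem one_half_le_phaseSize_mul {σ r : ℝ} (hσ : 0 < σ) (hr : 0 < r) (hr1 : r ≤ 1) :
    1 / 2 ≤ phaseSize σ r * r ^ (-((2 - σ) / 2)) := by
  have h := rpow_div_phaseSize (σ := σ) hr
  have hg := phaseSize_pos (σ := σ) hr
  have ha := Real.rpow_pos_of_pos hr ((2 - σ) / 2)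
  have h2 : Real.sqrt (1 + r ^ σ) ≤ 2 := by
    rw [Real.sqrt_le_left (by norm_num)]
    linarith [Real.rpow_le_one hr.le hr1 hσ.le]
  rw [div_eq_iff hg.ne'] at h
  rw [Real.rpow_neg hr.le, ← div_eq_mul_inv, le_div_iff₀ ha]
  nlinarith

/-- The left side equals r^(σ/2) sqrt(1 + f^(-σ)), hence is at most r^(σ/2) + (r/f)^(σ/2). The two
terms dictate the form of the gain and the restriction ε ≤ σ/2. -/
theorem rpow_mul_radialDisp_le {σ f r ε : ℝ} (hσ : 0 < σ) (hf : 0 < f) (hr : 0 < r) (hr1 : r ≤ 1)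
    (hrf : r ≤ f) (hε : ε ≤ σ / 2) :
    r / f * radialDisp σ f * r ^ (-((2 - σ) / 2)) ≤ r ^ ε + (r / f) ^ ε := by
  have hq : Real.sqrt (1 + f ^ (-σ)) ≤ 1 + f ^ (-(σ / 2)) := by
    have e : f ^ (-σ) = (f ^ (-(σ / 2))) ^ 2 := by
      rw [← Real.rpow_natCast, ← Real.rpow_mul hf.le]
      congr 1
      push_cast
      ring
    have := Real.rpow_pos_of_pos hf (-(σ / 2))
    rw [Real.sqrt_le_left (by positivity), e]
    nlinarith
  have e1 : r * r ^ (-((2 - σ) / 2)) = r ^ (σ / 2) := by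
    rw [← Real.rpow_one_add' hr.le (by linarith)]
    congr 1
    ring
  have hrf1 : r / f ≤ 1 := (div_le_one hf).2 hrf
  calc r / f * radialDisp σ f * r ^ (-((2 - σ) / 2)) =
        r * r ^ (-((2 - σ) / 2)) * Real.sqrt (1 + f ^ (-σ)) := by
        rw [radialDisp_eq_mul hf]
        field_simp
    _ ≤ r ^ (σ / 2) * (1 + f ^ (-(σ / 2))) := by
        rw [e1]
        gcongr
    _ = r ^ (σ / 2) + (r / f) ^ (σ / 2) := by
        rw [Real.div_rpow hr.le hf.le, Real.rpow_neg hf.le]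
        ring
    _ ≤ _ := add_le_add (Real.rpow_le_rpow_of_exponent_ge hr hr1 hε)
        (Real.rpow_le_rpow_of_exponent_ge (by positivity) hrf1 hε)

namespace TestLine

variable {σ b₀ b₁ b₂ s₀ s₁ s₂ lam ε β : ℝ}

/-- The region where the moving frequency is the smallest one and at most `1`. -/
def RegionSmallX (L : TestLine) (t : ℝ) : Prop := RegionX L t ∧ L.rx t ≤ 1

/-- The phase is at least p(F), which absorbs |F|^((2-σ)/2), so the factor |x|^((2-σ)/2) survives.
The kernel vanishes at x = 0 to that order, and ε may be any exponent up to it. -/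
theorem regionSmallX_hasBounds_of_eq (hσ : 0 < σ) (hσ2 : σ < 2) (hlam : 7 / 4 ≤ lam)
    (h₀ : |s₀| = 1) (h₁ : |s₁| = 1) (hb₁ : b₁ ≤ lam) (hb₁0 : 0 ≤ b₁)
    (hb : b₀ + b₁ + b₂ = 2 * lam) (hε : ε ≤ (2 - σ) / 2) :
    HasBounds RegionSmallX ε β (kernel σ b₀ b₁ b₂ s₀ s₁ s₀) := by
  set a := (2 - σ) / 2 with ha
  have hsym : IsSymbol RegionSmallX rx 2 (fun L t => L.rx t ^ a)
      (kernel σ b₀ b₁ b₂ s₀ s₁ s₀) := by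
    have h := (regionX_isSymbol_numerator σ b₀ b₁ b₂).mul
      (regionX_isSymbol_inv_phase_of_eq hσ hσ2 h₀ h₁)
    refine (h.weight (fun L t _ => L.rx_pos t) 1 fun L t h => ?_).region fun L t h => h.1
    have hx := L.rx_pos t
    have hF := L.rF_pos t
    have hP := radialDisp_pos (σ := σ) hF
    simp only [Pi.mul_apply]
    refine ⟨by positivity, ?_⟩
    rw [one_mul, ← ha]
    have k1 : L.rF t ^ a / radialDisp σ (L.rF t) ≤ 1 :=
      (div_le_one hP).2 (rpow_le_radialDisp hF)
    have k2 : (1 + L.rx t ^ 2) ^ (-b₁) ≤ 1 :=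
      Real.rpow_le_one_of_one_le_of_nonpos (by nlinarith) (by linarith)
    have k3 := rpow_mul_brackets_le (lam := lam) (b₀ := b₀) (b₂ := b₂) (θ := a) (by linarith) hF
      (by rw [ha]; linarith) (by rw [ha]; linarith) (by linarith)
    calc _ = L.rx t ^ a * (L.rF t ^ a / radialDisp σ (L.rF t) * (1 + L.rx t ^ 2) ^ (-b₁) *
          (L.rF t ^ a * ((1 + L.rF t ^ 2) ^ (-b₀) * (1 + L.rF t ^ 2) ^ (-b₂)))) := by ring
      _ ≤ L.rx t ^ a * (1 * 1 * 1) := by gcongr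
      _ = _ := by ring
  have ha0 : 0 ≤ a := by rw [ha]; linarith
  refine .of_bounds
    (exists_bound_of_le hsym.bound (fun L t _ => Real.rpow_nonneg (L.rx_pos t).le _) 1
      fun L t h => ?_)
    (exists_bound_of_le hsym.deriv.bound
      (fun L t _ => div_nonneg (Real.rpow_nonneg (L.rx_pos t).le _) (L.rx_pos t).le) 1
      fun L t h => ?_)
    (exists_bound_of_le hsym.deriv.deriv.bound
      (fun L t _ => div_nonneg (div_nonneg (Real.rpow_nonneg (L.rx_pos t).le _) (L.rx_pos t).le)
        (L.rx_pos t).le) 1 fun L t h => ?_)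
  all_goals
    have hx := L.rx_pos t
    rw [profile_of_le_one _ _ h.2, one_mul]
  · exact Real.rpow_le_rpow_of_exponent_ge hx h.2 ha0
  · simp only [Pi.div_apply]
    rw [← Real.rpow_sub_one hx.ne']
    exact Real.rpow_le_rpow_of_exponent_ge hx h.2 (by linarith)
  · simp only [Pi.div_apply]
    rw [← Real.rpow_sub_one hx.ne', ← Real.rpow_sub_one hx.ne']
    exact Real.rpow_le_rpow_of_exponent_ge hx h.2 (by linarith)

/-- The gain for the derivatives at `x = 0`. -/
def gain (ε : ℝ) (L : TestLine) (t : ℝ) : ℝ := L.rx t ^ ε + (L.rx t / L.rF t) ^ ε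

theorem gain_pos (L : TestLine) (t : ℝ) : 0 < gain ε L t := by
  have := L.rx_pos t
  have := L.rF_pos t
  rw [gain]
  positivity

theorem rpow_le_gain (L : TestLine) (t : ℝ) : L.rx t ^ ε ≤ gain ε L t := by
  have := L.rx_pos t
  have := L.rF_pos t
  rw [gain]
  linarith [Real.rpow_pos_of_pos (div_pos (L.rx_pos t) (L.rF_pos t)) ε]

theorem RegionSmallX.rpow_le_gain {L : TestLine} {t : ℝ} (h : RegionSmallX L t) {θ : ℝ}
    (hθ : ε ≤ θ) : L.rx t ^ θ ≤ gain ε L t :=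
  (Real.rpow_le_rpow_of_exponent_ge (L.rx_pos t) h.2 hθ).trans (TestLine.rpow_le_gain L t)

theorem RegionSmallX.div_le_gain {L : TestLine} {t : ℝ} (h : RegionSmallX L t) (hε : ε ≤ 1) :
    L.rx t / L.rF t ≤ gain ε L t := by
  have h1 := div_pos (L.rx_pos t) (L.rF_pos t)
  have h2 := Real.rpow_le_rpow_of_exponent_ge h1 ((div_le_one (L.rF_pos t)).2 h.1.1) hε
  rw [Real.rpow_one] at h2
  rw [gain]
  linarith [Real.rpow_pos_of_pos (L.rx_pos t) ε]

theorem RegionSmallX.gain_le {L : TestLine} {t : ℝ} (h : RegionSmallX L t) (hε : 0 ≤ ε) :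
    gain ε L t ≤ 2 := by
  have h1 := Real.rpow_le_one (L.rx_pos t).le h.2 hε
  have h2 := Real.rpow_le_one (div_pos (L.rx_pos t) (L.rF_pos t)).le
    ((div_le_one (L.rF_pos t)).2 h.1.1) hε
  rw [gain]
  linarith

/-- Functions varying at the scale of the large frequency `y` have a gain at `x = 0`. -/
theorem isGainSymbol_of_ry {v w f : TestLine → ℝ → ℝ} (hε : ε ≤ 1)
    (h : IsSymbol RegionSmallX ry 2 v f) (D : ℝ)
    (hv : ∀ L t, RegionSmallX L t → 0 ≤ v L t ∧ v L t ≤ D * w L t) :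
    IsGainSymbol RegionSmallX rx (gain ε) w f := by
  have hℓ : ∀ (L : TestLine) t, RegionSmallX L t → L.rx t ≤ 1 * L.ry t ∧ 0 < L.ry t :=
    fun L t h => ⟨by rw [one_mul]; exact h.1.2, L.ry_pos t⟩
  refine ⟨h.mono (fun L t _ => L.rx_pos t) D 1 hv hℓ,
    h.deriv.mono (fun L t _ => L.rx_pos t) (2 * D) 1 (fun L t ht => ?_) hℓ⟩
  obtain ⟨h1, h2⟩ := hv L t ht
  have hx := L.rx_pos t
  have hy := L.ry_pos t
  have hF := L.rF_pos t
  have h3 := h1.trans h2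
  simp only [Pi.div_apply, Pi.mul_apply]
  refine ⟨div_nonneg h1 hy.le, ?_⟩
  -- Replacing |x - F| by |F| costs the factor 2, since |F| ≤ 2 |x - F| in this region.
  have h4 : L.rx t / L.ry t ≤ 2 * gain ε L t := by
    refine le_trans ?_ (mul_le_mul_of_nonneg_left (ht.div_le_gain hε) (by norm_num))
    rw [← mul_div_assoc, div_le_div_iff₀ hy hF]
    nlinarith [ht.1.rF_le]
  calc v L t / L.ry t ≤ D * w L t / L.ry t := by gcongr
    _ = D * w L t * (L.rx t / L.ry t) / L.rx t := by field_simp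
    _ ≤ D * w L t * (2 * gain ε L t) / L.rx t := by gcongr
    _ = _ := by ring

/-- The constant disappears on differentiation, and |x|^θ with θ ≥ ε is already as small as the
gain. -/
theorem isGainSymbol_one_add_rpow {θ : ℝ} (hε : 0 ≤ ε) (hθ : ε ≤ θ) :
    IsGainSymbol RegionSmallX rx (gain ε) (fun _ _ => 1)
      ((fun _ _ => 1) + fun L t => L.rx t ^ θ) := by
  have hℓ : ∀ (L : TestLine) t, RegionSmallX L t → 0 < L.rx t := fun L t _ => L.rx_pos t
  refine IsGainSymbol.add (IsGainSymbol.param (fun _ => 1) (fun _ _ _ => zero_le_one)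
    (fun L t _ => (gain_pos L t).le) hℓ fun _ _ _ => by rw [abs_one]) ?_
  refine IsGainSymbol.of_isSymbol (isSymbol_rx_sq.norm_rpow rx_pos one_pos
    (fun L t _ => ⟨L.rx_pos t, by rw [one_mul]⟩) θ) hℓ 1 2 (fun L t h => ?_) fun L t h => ?_
  · have := L.rx_pos t
    rw [one_mul, mul_one]
    exact ⟨by positivity, h.rpow_le_gain hθ⟩
  · rw [one_mul, mul_one, mul_one]
    exact h.gain_le hε

/-- The factor |x|^((2-σ)/2) is left out: by itself it has no gain relative to its size, and it is
paired with the phase instead. -/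
theorem isGainSymbol_numerator (hσ2 : σ < 2) (hε : 0 ≤ ε) (hε1 : ε ≤ 1) :
    IsGainSymbol RegionSmallX rx (gain ε)
      (fun L t => L.rF t ^ ((2 - σ) / 2) * L.rF t ^ ((2 - σ) / 2) *
        ((1 + L.rF t ^ 2) ^ (-b₀) * 1 * (1 + L.rF t ^ 2) ^ (-b₂)))
      (fun L t => L.rF t ^ ((2 - σ) / 2) * L.ry t ^ ((2 - σ) / 2) *
        ((1 + L.rF t ^ 2) ^ (-b₀) * (1 + L.rx t ^ 2) ^ (-b₁) * (1 + L.ry t ^ 2) ^ (-b₂))) := by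
  have hpar : ∀ s : ℝ → ℝ, (∀ r, 0 < r → 0 ≤ s r) → IsGainSymbol RegionSmallX rx (gain ε)
      (fun L t => s (L.rF t)) fun L t => s (L.rF t) := fun s hs =>
    IsGainSymbol.param (fun L => s (L.rF 0)) (fun L t _ => hs _ (L.rF_pos t))
      (fun L t _ => (gain_pos L t).le) (fun L t _ => L.rx_pos t)
      fun L t _ => le_of_eq (abs_of_nonneg (hs _ (L.rF_pos t)))
  have h1 := hpar (fun r => r ^ ((2 - σ) / 2)) fun r hr => by positivity
  have h2 : IsGainSymbol RegionSmallX rx (gain ε) (fun L t => L.rF t ^ ((2 - σ) / 2))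
      (fun L t => L.ry t ^ ((2 - σ) / 2)) := by
    refine isGainSymbol_of_ry hε1 (isSymbol_ry_sq.norm_rpow ry_pos one_pos
      (fun L t _ => ⟨L.ry_pos t, by rw [one_mul]⟩) _) (2 ^ ((2 - σ) / 2)) fun L t h => ?_
    have hy := L.ry_pos t
    refine ⟨by positivity, ?_⟩
    rw [← Real.mul_rpow (by norm_num) (L.rF_pos t).le]
    exact Real.rpow_le_rpow hy.le h.1.ry_le (by linarith)
  have h3 := hpar (fun r => (1 + r ^ 2) ^ (-b₀)) fun r hr => by positivity
  have h4 : IsGainSymbol RegionSmallX rx (gain ε) (fun _ _ => 1)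
      (fun L t => (1 + L.rx t ^ 2) ^ (-b₁)) := by
    have h := (isGainSymbol_one_add_rpow (θ := 2) hε (by linarith)).rpow (c := 1) (fun L t => ?_)
      one_pos (fun L t _ => ?_) (-b₁)
    · simpa using h
    · have := L.rx_pos t
      change 0 < 1 + L.rx t ^ (2 : ℝ)
      positivity
    · have := L.rx_pos t
      refine ⟨one_pos, ?_⟩
      change 1 * 1 ≤ 1 + L.rx t ^ (2 : ℝ)
      linarith [Real.rpow_pos_of_pos this 2]
  have h5 : IsGainSymbol RegionSmallX rx (gain ε) (fun L t => (1 + L.rF t ^ 2) ^ (-b₂))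
      (fun L t => (1 + L.ry t ^ 2) ^ (-b₂)) := by
    refine isGainSymbol_of_ry hε1 (isSymbol_ry_sq.bracket_rpow (fun L t _ => L.ry_pos t) one_pos
      (fun L t _ => by rw [one_mul]) (-b₂)) (max (4 ^ (-b₂)) ((1 / 4) ^ (-b₂))) fun L t h => ?_
    have hy := L.ry_pos t
    have hF := L.rF_pos t
    refine ⟨by positivity, ?_⟩
    have k1 := h.1.ry_le
    have k2 := h.1.rF_le
    rcases le_total 0 (-b₂) with hs | hs
    · calc _ ≤ (4 * (1 + L.rF t ^ 2)) ^ (-b₂) :=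
            Real.rpow_le_rpow (by positivity) (by nlinarith) hs
        _ = 4 ^ (-b₂) * (1 + L.rF t ^ 2) ^ (-b₂) := Real.mul_rpow (by norm_num) (by positivity)
        _ ≤ _ := by
            gcongr
            exact le_max_left _ _
    · calc _ ≤ (1 / 4 * (1 + L.rF t ^ 2)) ^ (-b₂) :=
            Real.rpow_le_rpow_of_nonpos (by positivity) (by nlinarith) hs
        _ = (1 / 4) ^ (-b₂) * (1 + L.rF t ^ 2) ^ (-b₂) :=
            Real.mul_rpow (by norm_num) (by positivity)
        _ ≤ _ := by
            gcongr
            exact le_max_right _ _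
  exact (h1.mul h2).mul ((h3.mul h4).mul h5)

/-- The phase divided by `|x|^((2-σ)/2)`, when the two large frequencies have opposite signs. -/
def normalizedPhase (σ s₀ s₁ : ℝ) (L : TestLine) (t : ℝ) : ℝ :=
  s₁ * (1 + L.rx t ^ σ) ^ (1 / 2 : ℝ) +
    s₀ * ((radialDisp σ (L.rF t) - radialDisp σ (L.ry t)) * L.rx t ^ (-((2 - σ) / 2)))

theorem normalizedPhase_eq (L : TestLine) (t : ℝ) : normalizedPhase σ s₀ s₁ L t =
    phase σ s₀ s₁ (-s₀) L t * L.rx t ^ (-((2 - σ) / 2)) := by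
  rw [normalizedPhase, ← radialDisp_mul_rpow_neg (L.rx_pos t), phase, radialPhase]
  ring

/-- One term is sqrt(1 + |x|^σ), a constant plus O(|x|^σ). In the other, p(F) - p(x-F) is
O((|x|/|F|) p(F)) with matching derivatives, and after normalisation this is bounded by the gain. -/
theorem isGainSymbol_normalizedPhase (hσ : 0 < σ) (hσ2 : σ < 2) (hε : 0 ≤ ε) (hεσ : ε ≤ σ / 2) :
    IsGainSymbol RegionSmallX rx (gain ε) (fun _ _ => 1) (normalizedPhase σ s₀ s₁) := by
  have h1 : IsGainSymbol RegionSmallX rx (gain ε) (fun _ _ => 1)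
      (fun L t => (1 + L.rx t ^ σ) ^ (1 / 2 : ℝ)) := by
    have h := (isGainSymbol_one_add_rpow (θ := σ) hε (by linarith)).rpow (c := 1) (fun L t => ?_)
      one_pos (fun L t _ => ?_) (1 / 2)
    · simp only [Real.one_rpow] at h
      exact h
    · have := L.rx_pos t
      change 0 < 1 + L.rx t ^ σ
      positivity
    · have := L.rx_pos t
      refine ⟨one_pos, ?_⟩
      change 1 * 1 ≤ 1 + L.rx t ^ σ
      linarith [Real.rpow_pos_of_pos this σ]
  have h2 : IsGainSymbol RegionSmallX rx (gain ε) (fun _ _ => 1)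
      (fun L t => (radialDisp σ (L.rF t) - radialDisp σ (L.ry t)) *
        L.rx t ^ (-((2 - σ) / 2))) := by
    have h := ((regionX_isSymbolPair_disp (n := 2) hσ2).diff.mul
      ((isSymbol_rx_sq (U := RegionX) (n := 2)).norm_rpow rx_pos one_pos
        (fun L t _ => ⟨L.rx_pos t, by rw [one_mul]⟩) (-((2 - σ) / 2)))).region
        (V := RegionSmallX) fun L t h => h.1
    refine IsGainSymbol.of_isSymbol h (fun L t _ => L.rx_pos t) 1 2 (fun L t h => ?_)
      fun L t h => ?_
    · have hx := L.rx_pos t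
      have hF := L.rF_pos t
      have hP := radialDisp_pos (σ := σ) hF
      simp only [Pi.mul_apply, Pi.div_apply]
      refine ⟨by positivity, ?_⟩
      rw [one_mul, mul_one]
      exact rpow_mul_radialDisp_le hσ hF hx h.2 h.1.1 hεσ
    · rw [one_mul, mul_one, mul_one]
      exact h.gain_le hε
  exact (h1.const_mul s₁).add (h2.const_mul s₀)

/-- The critical case: the kernel is only bounded at x = 0. It is the product of the numerator
without its power of |x| and the reciprocal normalised phase, both of which have a gain. -/
theorem regionSmallX_hasBounds_of_neg (hσ : 0 < σ) (hσ2 : σ < 2) (hlam : 7 / 4 ≤ lam)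
    (h₀ : |s₀| = 1) (h₁ : |s₁| = 1) (hb₁ : b₁ ≤ lam)
    (hb : b₀ + b₁ + b₂ = 2 * lam) (hε0 : 0 ≤ ε) (hεσ : ε ≤ σ / 2) (hε : ε ≤ (2 - σ) / 2) :
    HasBounds RegionSmallX ε β (kernel σ b₀ b₁ b₂ s₀ s₁ (-s₀)) := by
  set a := (2 - σ) / 2 with ha
  have h₂ : |-s₀| = 1 := by rwa [abs_neg]
  have hne : ∀ L t, normalizedPhase σ s₀ s₁ L t ≠ 0 := fun L t => by
    rw [normalizedPhase_eq]
    exact mul_ne_zero (phase_ne_zero hσ hσ2 h₀ h₁ h₂ L t)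
      (Real.rpow_pos_of_pos (L.rx_pos t) _).ne'
  have hinv := (isGainSymbol_normalizedPhase (s₀ := s₀) (s₁ := s₁) hσ hσ2 hε0 hεσ).inv hne
    (c := subaddConst σ / 2) (by linarith [subaddConst_pos hσ]) fun L t h => ⟨one_pos, by
      have hx := L.rx_pos t
      have k1 := regionX_phaseSize_le hσ hσ2 h₀ h₁ h₂ h.1
      have k2 := one_half_le_phaseSize_mul hσ hx h.2
      have k3 := subaddConst_pos hσ
      rw [normalizedPhase_eq, abs_mul, abs_of_pos (Real.rpow_pos_of_pos hx _)]
      calc subaddConst σ / 2 * 1 = subaddConst σ * (1 / 2) := by ring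
        _ ≤ subaddConst σ * (phaseSize σ (L.rx t) * L.rx t ^ (-((2 - σ) / 2))) := by gcongr
        _ = subaddConst σ * phaseSize σ (L.rx t) * L.rx t ^ (-((2 - σ) / 2)) := by ring
        _ ≤ _ := by gcongr⟩
  have hK := (isGainSymbol_numerator (b₀ := b₀) (b₁ := b₁) (b₂ := b₂) (σ := σ) hσ2 hε0
    (by linarith)).mul hinv
  have e : (fun (L : TestLine) t => L.rF t ^ ((2 - σ) / 2) * L.ry t ^ ((2 - σ) / 2) *
        ((1 + L.rF t ^ 2) ^ (-b₀) * (1 + L.rx t ^ 2) ^ (-b₁) * (1 + L.ry t ^ 2) ^ (-b₂))) *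
      (fun L t => (normalizedPhase σ s₀ s₁ L t)⁻¹) = kernel σ b₀ b₁ b₂ s₀ s₁ (-s₀) := by
    funext L t
    have hx := L.rx_pos t
    simp only [Pi.mul_apply]
    rw [normalizedPhase_eq, kernel, radialKernel, Real.rpow_neg hx.le, mul_inv, inv_inv]
    change _ = _ * (phase σ s₀ s₁ (-s₀) L t)⁻¹
    ring
  rw [e] at hK
  set W : TestLine → ℝ → ℝ := (fun (L : TestLine) t =>
    L.rF t ^ ((2 - σ) / 2) * L.rF t ^ ((2 - σ) / 2) *
        ((1 + L.rF t ^ 2) ^ (-b₀) * 1 * (1 + L.rF t ^ 2) ^ (-b₂))) * (fun _ _ => 1)⁻¹ with hW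
  have eW : ∀ L t, W L t =
      L.rF t ^ (2 * a) * ((1 + L.rF t ^ 2) ^ (-b₀) * (1 + L.rF t ^ 2) ^ (-b₂)) := fun L t => by
    have e2 : L.rF t ^ (2 * a) = L.rF t ^ a * L.rF t ^ a := by
      rw [← Real.rpow_add (L.rF_pos t)]; ring_nf
    rw [e2]
    simp [hW, ha]
  have hW0 : ∀ L t, 0 ≤ W L t := fun L t => by
    have := L.rF_pos t
    rw [eW]
    positivity
  have hW1 : ∀ L t, W L t ≤ 1 := fun L t => by
    rw [eW]
    exact rpow_mul_brackets_le (lam := lam) (by linarith) (L.rF_pos t) (by rw [ha]; linarith)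
      (by rw [ha]; linarith) (by linarith)
  -- A small |F| spoils (|x|/|F|)^ε, but the numerator provides |F|^(2-σ), and |F|^(2-σ-ε) still has
  -- a nonnegative exponent that the brackets control.
  have hgW : ∀ L t, gain ε L t * W L t ≤ 2 * L.rx t ^ ε := fun L t => by
    have hx := L.rx_pos t
    have hF := L.rF_pos t
    have k := rpow_mul_brackets_le (lam := lam) (b₀ := b₀) (b₂ := b₂) (θ := 2 * a - ε)
      (by linarith) hF (by rw [ha]; linarith) (by rw [ha]; linarith) (by linarith)
    have e3 : (L.rx t / L.rF t) ^ ε * W L t = L.rx t ^ ε *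
        (L.rF t ^ (2 * a - ε) * ((1 + L.rF t ^ 2) ^ (-b₀) * (1 + L.rF t ^ 2) ^ (-b₂))) := by
      rw [eW, Real.div_rpow hx.le hF.le, Real.rpow_sub hF]
      ring
    rw [gain, add_mul, e3]
    have hp := Real.rpow_pos_of_pos hx ε
    nlinarith [mul_le_mul_of_nonneg_left (hW1 L t) hp.le, mul_le_mul_of_nonneg_left k hp.le]
  have hgW0 : ∀ L t, 0 ≤ gain ε L t * W L t := fun L t => mul_nonneg (gain_pos L t).le (hW0 L t)
  refine .of_bounds
    (exists_bound_of_le hK.symbol.bound (fun L t _ => hW0 L t) 1 fun L t h => ?_)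
    (exists_bound_of_le hK.gain.bound (fun L t _ => div_nonneg (hgW0 L t) (L.rx_pos t).le) 2
      fun L t h => ?_)
    (exists_bound_of_le hK.gain.deriv.bound
      (fun L t _ => div_nonneg (div_nonneg (hgW0 L t) (L.rx_pos t).le) (L.rx_pos t).le) 2
      fun L t h => ?_)
  all_goals
    have hx := L.rx_pos t
    rw [profile_of_le_one _ _ h.2]
  · rw [Real.rpow_zero, one_mul]
    exact hW1 L t
  · rw [Real.rpow_sub_one hx.ne', ← mul_div_assoc]
    exact div_le_div_of_nonneg_right (hgW L t) hx.le
  · rw [show ε - 2 = ε - 1 - 1 by ring, Real.rpow_sub_one hx.ne', Real.rpow_sub_one hx.ne',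
      ← mul_div_assoc, ← mul_div_assoc]
    exact div_le_div_of_nonneg_right (div_le_div_of_nonneg_right (hgW L t) hx.le) hx.le

end TestLine

/-! ### Kernel bounds in all regions, by reflection. -/

namespace TestLine

variable {U V : TestLine → ℝ → Prop} {K : TestLine → ℝ → ℝ}
variable {σ b₀ b₁ b₂ s₀ s₁ s₂ lam ε β : ℝ}

theorem HasBounds.or (hU : HasBounds U ε β K) (hV : HasBounds V ε β K) :
    HasBounds (fun L t => U L t ∨ V L t) ε β K := by
  have hp : ∀ (L : TestLine) t α, 0 ≤ profile α β (L.rx t) := fun L t α =>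
    profile_nonneg _ _ (L.rx_pos t).le
  obtain ⟨C, hC, hU⟩ := hU
  obtain ⟨D, hD, hV⟩ := hV
  refine ⟨C + D, by positivity, fun L t h => ?_⟩
  rw [add_mul, add_mul, add_mul]
  have c : ∀ α, 0 ≤ C * profile α β (L.rx t) := fun α => mul_nonneg hC (hp L t α)
  have d : ∀ α, 0 ≤ D * profile α β (L.rx t) := fun α => mul_nonneg hD (hp L t α)
  rcases h with h | h
  · obtain ⟨h1, h2, h3⟩ := hU L t h
    exact ⟨by linarith [d 0], by linarith [d (ε - 1)], by linarith [d (ε - 2)]⟩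
  · obtain ⟨h1, h2, h3⟩ := hV L t h
    exact ⟨by linarith [c 0], by linarith [c (ε - 1)], by linarith [c (ε - 2)]⟩

theorem HasBounds.region (h : HasBounds U ε β K) (hVU : ∀ L t, V L t → U L t) :
    HasBounds V ε β K :=
  h.imp fun _ h => ⟨h.1, fun L t ht => h.2 L t (hVU L t ht)⟩

/-- The kernel where the moving frequency is the smallest one. -/
theorem regionX_hasBounds (hσ : 0 < σ) (hσ2 : σ < 2) (hlam : 7 / 4 ≤ lam) (h₀ : |s₀| = 1)
    (h₁ : |s₁| = 1) (h₂ : |s₂| = 1) (hb₁ : b₁ ≤ lam) (hb₁0 : 0 ≤ b₁)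
    (hb : b₀ + b₁ + b₂ = 2 * lam) (hε0 : 0 ≤ ε) (hεσ : ε ≤ σ / 2) (hε : ε ≤ (2 - σ) / 2) :
    HasBounds RegionX ε (2 * lam - (2 - σ)) (kernel σ b₀ b₁ b₂ s₀ s₁ s₂) := by
  have hsmall : HasBounds RegionSmallX ε (2 * lam - (2 - σ)) (kernel σ b₀ b₁ b₂ s₀ s₁ s₂) := by
    rcases eq_or_eq_neg_of_abs_eq_one h₂ h₀ with rfl | rfl
    · exact regionSmallX_hasBounds_of_eq hσ hσ2 hlam h₀ h₁ hb₁ hb₁0 hb hε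
    · exact regionSmallX_hasBounds_of_neg hσ hσ2 hlam h₀ h₁ hb₁ hb hε0 hεσ hε
  exact (hsmall.or (regionX_large_hasBounds hσ hσ2 hlam h₀ h₁ h₂ hb₁ hb)).region fun L t h =>
    (le_total (L.rx t) 1).imp (fun h1 => ⟨h, h1⟩) fun h1 => ⟨h, h1⟩

/-- The reflection of a test line exchanging the points `0` and `F`. -/
def swap (L : TestLine) : TestLine where
  F := -L.F
  x := L.x - L.F
  e := L.e
  F_ne := neg_ne_zero.2 L.F_ne
  norm_e := L.norm_e
  avoid_zero := L.avoid_F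
  avoid_F t := by
    rw [sub_neg_eq_add, sub_add_cancel]
    exact L.avoid_zero t

theorem rF_swap (L : TestLine) : L.swap.rF = L.rF := by
  funext t
  exact norm_neg L.F

theorem rx_swap (L : TestLine) : L.swap.rx = L.ry := rfl

theorem ry_swap (L : TestLine) : L.swap.ry = L.rx := by
  funext t
  simp only [ry, rx, swap, sub_neg_eq_add, sub_add_cancel]

theorem kernel_swap (L : TestLine) :
    kernel σ b₀ b₂ b₁ s₀ s₂ s₁ L.swap = kernel σ b₀ b₁ b₂ s₀ s₁ s₂ L := by
  funext t
  rw [kernel, kernel, rF_swap, rx_swap, ry_swap]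
  exact (radialKernel_swap ..).symm

/-- The bounds for the kernel and its first two derivatives along all test lines. -/
theorem exists_kernel_bounds (hσ : 0 < σ) (hσ2 : σ < 2) (hlam : 7 / 4 ≤ lam) (h₀ : |s₀| = 1)
    (h₁ : |s₁| = 1) (h₂ : |s₂| = 1) (hb₀ : b₀ ≤ lam) (hb₁ : b₁ ∈ Set.Icc 0 lam)
    (hb₂ : b₂ ∈ Set.Icc 0 lam) (hb : b₀ + b₁ + b₂ = 2 * lam) (hε0 : 0 ≤ ε) (hεσ : ε ≤ σ / 2)
    (hε : ε ≤ (2 - σ) / 2) :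
    ∃ C, 0 ≤ C ∧ ∀ L t,
      |kernel σ b₀ b₁ b₂ s₀ s₁ s₂ L t| ≤ C * (profile 0 (2 * lam - (2 - σ)) (L.rx t) +
        profile 0 (2 * lam - (2 - σ)) (L.ry t)) ∧
      |deriv (kernel σ b₀ b₁ b₂ s₀ s₁ s₂ L) t| ≤
        C * (profile (ε - 1) (2 * lam - (2 - σ)) (L.rx t) +
          profile (ε - 1) (2 * lam - (2 - σ)) (L.ry t)) ∧
      |deriv (deriv (kernel σ b₀ b₁ b₂ s₀ s₁ s₂ L)) t| ≤
        C * (profile (ε - 2) (2 * lam - (2 - σ)) (L.rx t) +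
          profile (ε - 2) (2 * lam - (2 - σ)) (L.ry t)) := by
  have hF := regionF_hasBounds (b₁ := b₁) (b₂ := b₂) hσ hσ2 hlam h₀ h₁ h₂ hb₀ hb
    (hε.trans (by linarith))
  -- The first set of bounds is centred at x = 0; the second, with the moving weights and signs
  -- exchanged, is for the reflected line, where x - F plays the role of x.
  obtain ⟨C, hC, h⟩ := hF.or (regionX_hasBounds hσ hσ2 hlam h₀ h₁ h₂ hb₁.2 hb₁.1 hb hε0 hεσ hε)
  obtain ⟨D, hD, h'⟩ := regionX_hasBounds (b₀ := b₀) (b₁ := b₂) (b₂ := b₁) hσ hσ2 hlam h₀ h₂ h₁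
    hb₂.2 hb₂.1 (by linarith) hε0 hεσ hε
  refine ⟨C + D, by positivity, fun L t => ?_⟩
  have hx := fun α => profile_nonneg α (2 * lam - (2 - σ)) (L.rx_pos t).le
  have hy := fun α => profile_nonneg α (2 * lam - (2 - σ)) (L.ry_pos t).le
  have e : ∀ α, C * profile α (2 * lam - (2 - σ)) (L.rx t) ≤ (C + D) *
      (profile α (2 * lam - (2 - σ)) (L.rx t) + profile α (2 * lam - (2 - σ)) (L.ry t)) := fun α =>
    mul_le_mul (by linarith) (by linarith [hy α]) (hx α) (by positivity)
  have e' : ∀ α, D * profile α (2 * lam - (2 - σ)) (L.ry t) ≤ (C + D) *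
      (profile α (2 * lam - (2 - σ)) (L.rx t) + profile α (2 * lam - (2 - σ)) (L.ry t)) := fun α =>
    mul_le_mul (by linarith) (by linarith [hx α]) (hy α) (by positivity)
  by_cases hU : RegionF L t ∨ RegionX L t
  · obtain ⟨h1, h2, h3⟩ := h L t hU
    exact ⟨h1.trans (e _), h2.trans (e _), h3.trans (e _)⟩
  · have hX : RegionX L.swap t := by
      rw [RegionX, rF_swap, rx_swap, ry_swap]
      simp only [RegionF, RegionX, not_or, not_and, not_le] at hU
      rcases le_total (L.rF t) (L.rx t) with h1 | h1
      · have := hU.1 h1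
        exact ⟨this.le, by linarith⟩
      · have := hU.2 h1
        exact ⟨by linarith, this.le⟩
    obtain ⟨h1, h2, h3⟩ := h' L.swap t hX
    rw [kernel_swap, rx_swap] at h1 h2 h3
    exact ⟨h1.trans (e' _), h2.trans (e' _), h3.trans (e' _)⟩

end TestLine

/-! ### From lines back to space, and conclusion. -/

/-- The kernel as a function of the moving frequency. -/
def pointKernel (σ b₀ b₁ b₂ s₀ s₁ s₂ : ℝ) (F x : R3) : ℝ :=
  radialKernel σ b₀ b₁ b₂ s₀ s₁ s₂ ‖F‖ ‖x‖ ‖x - F‖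

theorem measurable_pointKernel (σ b₀ b₁ b₂ s₀ s₁ s₂ : ℝ) (F : R3) :
    Measurable (pointKernel σ b₀ b₁ b₂ s₀ s₁ s₂ F) := by
  unfold pointKernel radialKernel radialPhase radialDisp
  fun_prop

theorem ae_forall_coord_ne (F : R3) : ∀ᵐ x : R3, ∀ j, x j ≠ F j :=
  ae_all_iff.2 fun j => (PiLp.volume_preserving_ofLp (Fin 3)).quasiMeasurePreserving.ae
    (Measure.ae_eval_ne (μ := fun _ : Fin 3 => (volume : Measure ℝ)) j (F j))

/-- A coordinate other than the i-th is not moved and stays nonzero. Hence points with no vanishing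
coordinate, a set of full measure, have good lines in all three directions. -/
theorem add_smul_single_ne_zero {x : R3} (hx : ∀ j, x j ≠ 0) (i : Fin 3) (t : ℝ) :
    x + t • EuclideanSpace.single i (1 : ℝ) ≠ 0 := by
  obtain ⟨j, hj⟩ := exists_ne i
  intro h
  have := congrArg (fun y : R3 => y j) h
  exact hx j (by simpa [hj] using this)

/-- Almost every line parallel to a coordinate axis is a test line. -/
theorem ae_exists_testLine {F : R3} (hF : F ≠ 0) : ∀ᵐ x : R3, ∀ i : Fin 3,
    ∃ L : TestLine, L.F = F ∧ L.x = x ∧ L.e = EuclideanSpace.single i 1 := by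
  filter_upwards [ae_forall_coord_ne 0, ae_forall_coord_ne F] with x h0 h1 i
  exact ⟨⟨F, x, EuclideanSpace.single i 1, hF, by simp,
    add_smul_single_ne_zero (fun j => by simpa using h0 j) i,
    add_smul_single_ne_zero (fun j => by simpa [sub_eq_zero] using h1 j) i⟩, rfl, rfl, rfl⟩

theorem pointKernel_line (σ b₀ b₁ b₂ s₀ s₁ s₂ : ℝ) (L : TestLine) (t : ℝ) :
    pointKernel σ b₀ b₁ b₂ s₀ s₁ s₂ L.F (L.x + t • L.e) = L.kernel σ b₀ b₁ b₂ s₀ s₁ s₂ t := by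
  rw [pointKernel, add_sub_right_comm]
  rfl

theorem exists_mixedNorm_pointKernel_le (ψ : Cutoff) {σ b₀ b₁ b₂ s₀ s₁ s₂ lam k : ℝ}
    (hσ : 0 < σ) (hσ2 : σ < 2) (hlam : 7 / 4 < lam) (h₀ : |s₀| = 1) (h₁ : |s₁| = 1)
    (h₂ : |s₂| = 1) (hb₀ : b₀ ≤ lam) (hb₁ : b₁ ∈ Set.Icc 0 lam) (hb₂ : b₂ ∈ Set.Icc 0 lam)
    (hb : b₀ + b₁ + b₂ = 2 * lam) (hk0 : 0 ≤ k) (hk : k ≤ 3 / 2) :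
    ∃ D : ℝ≥0, mixedNorm ψ k (fun F x => (pointKernel σ b₀ b₁ b₂ s₀ s₁ s₂ F x : ℂ)) ≤ D := by
  set ε := min (σ / 2) ((2 - σ) / 2)
  set β := 2 * lam - (2 - σ) with hβ
  have hε : 0 < ε := lt_min (by linarith) (by linarith)
  have hεσ : ε ≤ σ / 2 := min_le_left _ _
  have hε' : ε ≤ (2 - σ) / 2 := min_le_right _ _
  -- From 2λ > 7/2 one gets 2λ - (2 - σ) > 3/2 + σ: the decay is square integrable at infinity.
  have hβ' : 3 / 2 < β := by linarith
  obtain ⟨C, hC, hK⟩ := TestLine.exists_kernel_bounds (b₀ := b₀) (ε := ε) hσ hσ2 hlam.le h₀ h₁ h₂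
    hb₀ hb₁ hb₂ hb hε.le hεσ hε'
  set A := 2 ^ (β + 2) + 256 * (1 + 2 / ε) * 4 ^ β
  have hA : 1 ≤ A := by
    have h1 : (1 : ℝ) ≤ 2 ^ (β + 2) := Real.one_le_rpow (by norm_num) (by linarith)
    have : 0 ≤ 256 * (1 + 2 / ε) * 4 ^ β := by positivity
    linarith
  -- The order 3/2 + ε/2 exceeds every admissible k, and its weight exponent ε/2 - 3/2 stays above
  -- -3/2. The spare weight δ takes half of the surplus of β over 3/2.
  obtain ⟨D, hD⟩ := exists_mixedNorm_le ψ (k := k) (s := 3 / 2 + ε / 2) (δ := (β - 3 / 2) / 2)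
    (C := C * A) (w := fun x => profile 0 β ‖x‖)
    (W := fun x => profile (ε / 2 - 3 / 2) β ‖x‖) hk0 (by linarith) (by linarith) (by positivity)
    (fun x => profile_nonneg _ _ (norm_nonneg x)) (memLp_profile (by norm_num) hβ')
    (memLp_rpow_mul_profile (by linarith) (by linarith)) (memLp_profile (by linarith) hβ')
  refine ⟨D, hD _ ?_⟩
  filter_upwards [ae_forall_coord_ne 0] with F hF
  have hF0 : F ≠ 0 := fun h => hF 0 (by rw [h])
  refine ⟨(Complex.measurable_ofReal.comp
    (measurable_pointKernel σ b₀ b₁ b₂ s₀ s₁ s₂ F)).aestronglyMeasurable, ?_, fun i h hh hh1 => ?_⟩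
  · filter_upwards [ae_exists_testLine hF0] with x hx
    obtain ⟨L, rfl, rfl, -⟩ := hx 0
    have h1 := (hK L 0).1
    rw [← pointKernel_line, zero_smul, add_zero] at h1
    rw [Complex.norm_real, Real.norm_eq_abs]
    refine h1.trans ?_
    simp only [TestLine.rx, TestLine.ry, zero_smul, add_zero, twoCentre]
    have := profile_nonneg 0 β (norm_nonneg L.x)
    have := profile_nonneg 0 β (norm_nonneg (L.x - L.F))
    gcongr
    exact le_mul_of_one_le_right hC hA
  · filter_upwards [ae_exists_testLine hF0] with x hx
    obtain ⟨L, rfl, rfl, he⟩ := hx i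
    have hs : EuclideanSpace.single i h = h • L.e := by
      rw [he]
      ext j
      simp
    -- Used only for differentiability, which holds on the whole line; the bounds come from `hK`.
    have hsym := TestLine.regionF_isSymbol_kernel (b₀ := b₀) (b₁ := b₁) (b₂ := b₂) hσ hσ2 h₀ h₁ h₂
    have h3 := abs_secondDiff_line_le hε (by linarith) hβ'.le hC L.norm_e L.avoid_zero L.avoid_F
      (fun t => (hsym.differentiable L t).hasDerivAt)
      (fun t => (hsym.deriv.differentiable L t).hasDerivAt)
      (fun t => (hK L t).2.1) (fun t => (hK L t).2.2) hh hh1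
    simp only [← pointKernel_line, zero_smul, add_zero] at h3
    refine le_trans (le_of_eq ?_) h3
    rw [secondDiff, hs, ← add_smul, ← two_mul, ← Complex.ofReal_add, ← Complex.ofReal_sub,
      ← Complex.ofReal_add, Complex.norm_real, Real.norm_eq_abs]

theorem bracket_rpow (x : R3) (lam : ℝ) : bracket x ^ (2 * lam) = (1 + ‖x‖ ^ 2) ^ lam := by
  rw [bracket, Real.sqrt_eq_rpow, ← Real.rpow_mul (by positivity)]
  congr 1
  ring

/-- With ξ fixed, both brackets sit on the moving lengths |η| and |ξ - η|. -/
theorem kernel_eq_pointKernel_right (σ lam : ℝ) (r l : ℕ) (ξ η : R3) :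
    kernel σ lam r l ξ η = pointKernel σ 0 lam lam 1 ((-1) ^ l) ((-1) ^ r) ξ η := by
  have e : phase σ r l ξ η =
      radialPhase σ 1 ((-1) ^ l) ((-1) ^ r) ‖ξ‖ ‖η‖ ‖ξ - η‖ := by
    rw [phase, radialPhase, disp_eq, disp_eq, disp_eq]
    ring
  rw [kernel, pointKernel, radialKernel, norm_sub_rev η ξ, e, bracket_rpow, bracket_rpow,
    Real.rpow_neg (by positivity), Real.rpow_neg (by positivity), Real.rpow_neg (by positivity),
    Real.rpow_zero, div_eq_mul_inv, mul_inv, mul_inv]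
  ring

/-- With η fixed, one bracket sits on the fixed frequency and none on the moving ξ. -/
theorem kernel_eq_pointKernel_left (σ lam : ℝ) (r l : ℕ) (ξ η : R3) :
    kernel σ lam r l ξ η = pointKernel σ lam 0 lam ((-1) ^ l) 1 ((-1) ^ r) η ξ := by
  have e : phase σ r l ξ η =
      radialPhase σ ((-1) ^ l) 1 ((-1) ^ r) ‖η‖ ‖ξ‖ ‖ξ - η‖ := by
    rw [phase, radialPhase, disp_eq, disp_eq, disp_eq]
    ring
  rw [kernel, pointKernel, radialKernel, e, bracket_rpow, bracket_rpow,
    Real.rpow_neg (by positivity), Real.rpow_neg (by positivity), Real.rpow_neg (by positivity),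
    Real.rpow_zero, div_eq_mul_inv, mul_inv, mul_inv]
  ring

theorem exists_normXiEta_add_normEtaXi_le (ψ : Cutoff) {σ lam k : ℝ} (hσ : 0 < σ) (hσ2 : σ < 2)
    (hlam : 7 / 4 < lam) (hk0 : 0 ≤ k) (hk : k ≤ 3 / 2) (r l : ℕ) :
    ∃ D : ℝ≥0, normXiEta ψ k (kernel σ lam r l) + normEtaXi ψ k (kernel σ lam r l) ≤ D := by
  have hs : ∀ n : ℕ, |(-1 : ℝ) ^ n| = 1 := fun n => by simp
  have hl : (0 : ℝ) ≤ lam := by linarith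
  obtain ⟨D, hD⟩ := exists_mixedNorm_pointKernel_le ψ (b₀ := 0) (b₁ := lam) (b₂ := lam) (k := k)
    hσ hσ2 hlam (abs_one (α := ℝ)) (hs l) (hs r) hl ⟨hl, le_rfl⟩ ⟨hl, le_rfl⟩ (by ring) hk0 hk
  obtain ⟨E, hE⟩ := exists_mixedNorm_pointKernel_le ψ (b₀ := lam) (b₁ := 0) (b₂ := lam) (k := k)
    hσ hσ2 hlam (hs l) (abs_one (α := ℝ)) (hs r) le_rfl ⟨le_rfl, hl⟩ ⟨hl, le_rfl⟩ (by ring) hk0 hk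
  refine ⟨D + E, ?_⟩
  rw [ENNReal.coe_add, normXiEta, normEtaXi]
  refine add_le_add ?_ ?_
  · simpa only [kernel_eq_pointKernel_right] using hD
  · simpa only [kernel_eq_pointKernel_left] using hE

end EulerRiesz

end

theorem proposition3p4 (ψ : EulerRiesz.Cutoff) (σ k lam : ℝ)
    (hσ0 : 0 < σ) (hσ2 : σ < 2) (hk0 : 0 ≤ k) (hk : k ≤ 3 / 2)
    (hlam : 7 / 4 + σ * k < lam) :
    ∃ C : ℝ≥0, ∀ r ∈ ({1, 2} : Set ℕ), ∀ l ∈ ({1, 2} : Set ℕ),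
      EulerRiesz.normXiEta ψ k (EulerRiesz.kernel σ lam r l) +
        EulerRiesz.normEtaXi ψ k (EulerRiesz.kernel σ lam r l) ≤ (C : ℝ≥0∞) := by
  have hlam' : 7 / 4 < lam := by linarith [mul_nonneg hσ0.le hk0]
  choose D hD using EulerRiesz.exists_normXiEta_add_normEtaXi_le ψ hσ0 hσ2 hlam' hk0 hk
  -- Summing the four constants gives one bound for all choices of signs.
  refine ⟨∑ r ∈ {1, 2}, ∑ l ∈ {1, 2}, D r l, fun r hr l hl => (hD r l).trans ?_⟩
  rw [ENNReal.coe_le_coe]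
  have hr' : r ∈ ({1, 2} : Finset ℕ) := by simpa using hr
  have hl' : l ∈ ({1, 2} : Finset ℕ) := by simpa using hl
  exact (Finset.single_le_sum (f := fun l => D r l) (fun _ _ => zero_le) hl').trans
    (Finset.single_le_sum (f := fun r => ∑ l ∈ {1, 2}, D r l) (fun _ _ => zero_le) hr')
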